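/- **Setting.** Let $G$ be a compact Lie group with Lie algebra $\mathfrak g$, let $e_1,\dots,e_n$ be a basis of $\mathfrak g$ with $[e_j,e_k]=\sum_i c^i_{jk}e_i$, and let $G$ act smoothly from the left on a smooth closed manifold $M$. Let $(f_i^j)_{1\le i,j\le n}$ be arbitrary real numbers. The Weil algebra is $W(\mathfrak g)=\Lambda(\mathfrak g^*)\otimes S(\mathfrak g^*)$, where the dual basis gives generators $\theta^1,\dots,\theta^n$ (degree 1) of $\Lambda(\mathfrak g^*)$ and $\phi^1,\dots,\phi^n$ (degree 2) of $S(\mathfrak g^*)$. Its differential $d_W$ is the antiderivation with $$d_W\theta^i=-\tfrac12\sum_{j,k}c^i_{jk}\theta^j\theta^k+\phi^i,\qquad d_W\phi^i=-\sum_{j,k}c^i_{jk}\theta^j\phi^k .$$ For $X\in\mathfrak g$ let $X^M$ be the vector field $(X^Mh)(x)=\frac{d}{dt}h(\exp(-tX)\cdot x)|_{t=0}$. Let $d$ be the exterior derivative on $\Omega^*(M)$, and let $\iota_i$, $\mathcal L_i$ be the contraction and the Lie derivative along $e_i^M$. Put $$I_i=\iota_i+\sqrt{-1}\sum_j f_i^j\iota_j,\qquad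 \Lambda_i=\mathcal L_i+\sqrt{-1}\sum_j f_i^j\mathcal L_j .$$ Let $B=W(\mathfrak g)\otimes\Omega^*(M)$ with complex coefficients, with the graded tensor product algebra structure and the total degree; tensor products of operators follow the usual sign rule. Define $D=d_W\otimes1+1\otimes d$ and the twisted BRST operator $$\delta=d_W\otimes1+1\otimes d+\sum_i\theta^i\otimes\Lambda_i-\sum_a\phi^a\otimes I_a+\tfrac12\sum_{i,j,k}c^i_{jk}\theta^j\theta^k\otimes I_i-\sum_{j<k}\theta^j\theta^k\otimes(\Lambda_jI_k-I_k\Lambda_j).$$ **Theorem 1.** $(B,\delta)$ and $(B,D)$ are differential graded algebras: each of $\delta$ and $D$ has degree $1$, is an antiderivation and squares to zero. The operator $\sum_i\theta^i\otimes I_i$ is nilpotent, and the map $$\psi=\prod_{i=1}^n(1-\theta^i\otimes I_i)=\exp\Big(-\sum_{i=1}^n\theta^i\otimes I_i\Big):B\to B$$ is an isomorphism of differential graded algebras from $(B,\delta)$ to $(B,D)$: it is a degree-preserving automorphism of the complex algebra $B$ and $$D\circ\psi=\psi\circ\delta,\qquad\text{that is,}\qquad \delta=\psi^{-1}D\,\psi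 .$$ -/

import Mathlib

open scoped Manifold ContDiff TensorProduct DirectSum

namespace BRST

section Wedge
variable {R V : Type*} [CommRing R] [AddCommGroup V] [Module R V]

/-- Wedge product of alternating forms with values in `R`: the signed sum over shuffles of
products of values. -/
noncomputable def wedgeSum {α β : Type*} [Fintype α] [Fintype β] [DecidableEq α] [DecidableEq β]
    (a : V [⋀^α]→ₗ[R] R) (b : V [⋀^β]→ₗ[R] R) : V [⋀^α ⊕ β]→ₗ[R] R :=
  (LinearMap.mul' R R).compAlternatingMap (a.domCoprod b)

/-- Wedge product of a `p`-form and a `q`-form, as a `(p + q)`-form. -/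
noncomputable def wedge {p q : ℕ} (a : V [⋀^Fin p]→ₗ[R] R) (b : V [⋀^Fin q]→ₗ[R] R) :
    V [⋀^Fin (p + q)]→ₗ[R] R :=
  (wedgeSum a b).domDomCongr finSumFinEquiv

/-- Product of the values of two multilinear forms in separate variables. -/
noncomputable def mulM {α β : Type*}
    (a : MultilinearMap R (fun _ : α => V) R) (b : MultilinearMap R (fun _ : β => V) R) :
    MultilinearMap R (fun _ : α ⊕ β => V) R :=
  (LinearMap.mul' R R).compMultilinearMap (a.domCoprod b)

variable {α β γ : Type*} [Fintype α] [Fintype β] [DecidableEq α] [DecidableEq β]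
  [Fintype γ] [DecidableEq γ]

theorem mulM_apply {α β : Type*}  (a : MultilinearMap R (fun _ : α => V) R) (b : MultilinearMap R (fun _ : β => V) R) (v : α ⊕ β → V) : mulM a b v = a (fun i => v (.inl i)) * b (fun i => v (.inr i)) := by
  simp [mulM]

theorem wedgeSum_alt (a : MultilinearMap R (fun _ : α => V) R)
    (b : MultilinearMap R (fun _ : β => V) R) :
    wedgeSum (MultilinearMap.alternatization a) (MultilinearMap.alternatization b) =
      MultilinearMap.alternatization (mulM a b) := by
  rw [wedgeSum, ← MultilinearMap.domCoprod_alternization, mulM, LinearMap.compMultilinearMap_alternatization]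

theorem alt_domDomCongr {δ : Type*} [Fintype δ] [DecidableEq δ] (e : α ≃ δ) (a : MultilinearMap R (fun _ : α => V) R) : MultilinearMap.alternatization (a.domDomCongr e) = (MultilinearMap.alternatization a).domDomCongr e := by
  ext v
  simp only [MultilinearMap.alternatization_apply, AlternatingMap.domDomCongr_apply, MultilinearMap.domDomCongr_apply]
  refine Fintype.sum_equiv (Equiv.permCongr e.symm) _ _ fun σ => ?_
  congr 1
  · simp
  · congr 1; ext i; simp

theorem wedgeSum_smul (m n : ℕ) (a : V [⋀^α]→ₗ[R] R) (b : V [⋀^β]→ₗ[R] R) :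
    wedgeSum (m • a) (n • b) = (m * n) • wedgeSum a b := by
  have h : ∀ (a : V [⋀^α]→ₗ[R] R) (b : V [⋀^β]→ₗ[R] R), wedgeSum a b =
      (LinearMap.mul' R R).compAlternatingMap
        (AlternatingMap.domCoprod' (R' := R) (a ⊗ₜ[R] b)) := fun a b => rfl
  simp only [h, ← Nat.cast_smul_eq_nsmul R, TensorProduct.smul_tmul_smul, map_smul]
  ext v
  simp

theorem factorial_smul_wedgeSum (a : V [⋀^α]→ₗ[R] R) (b : V [⋀^β]→ₗ[R] R) :
    ((Fintype.card α).factorial * (Fintype.card β).factorial) • wedgeSum a b =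
      MultilinearMap.alternatization (mulM (a : MultilinearMap R (fun _ : α => V) R)
        (b : MultilinearMap R (fun _ : β => V) R)) := by
  rw [← wedgeSum_smul, ← AlternatingMap.coe_alternatization, ← AlternatingMap.coe_alternatization,
    wedgeSum_alt]

theorem nsmul_cancel [Algebra ℝ R] {n : ℕ} (hn : n ≠ 0) {a b : V [⋀^α]→ₗ[R] R}
    (h : n • a = n • b) : a = b := by
  ext v
  have hv : n • a v = n • b v := by simpa using congrArg (fun c => c v) h
  rw [← Nat.cast_smul_eq_nsmul ℝ, ← Nat.cast_smul_eq_nsmul ℝ] at hv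
  have h0 : (n : ℝ) ≠ 0 := by exact_mod_cast hn
  simpa [smul_smul, h0] using congrArg (fun x => (n : ℝ)⁻¹ • x) hv

theorem wedgeSum_assoc [Algebra ℝ R] (a : V [⋀^α]→ₗ[R] R) (b : V [⋀^β]→ₗ[R] R)
    (c : V [⋀^γ]→ₗ[R] R) :
    (wedgeSum (wedgeSum a b) c).domDomCongr (Equiv.sumAssoc α β γ) =
      wedgeSum a (wedgeSum b c) := by
  set A := (Fintype.card α).factorial
  set B := (Fintype.card β).factorial
  set C := (Fintype.card γ).factorial
  have key : (A * B * C) • (wedgeSum (wedgeSum a b) c).domDomCongr (Equiv.sumAssoc α β γ) =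
      (A * B * C) • wedgeSum a (wedgeSum b c) := by
    have h1 : (A * B * C) • wedgeSum (wedgeSum a b) c = MultilinearMap.alternatization
        (mulM (mulM (a : MultilinearMap R (fun _ : α => V) R)
          (b : MultilinearMap R (fun _ : β => V) R))
          (c : MultilinearMap R (fun _ : γ => V) R)) := by
      rw [← wedgeSum_alt, ← factorial_smul_wedgeSum, AlternatingMap.coe_alternatization,
        wedgeSum_smul]
    have h2 : (A * (B * C)) • wedgeSum a (wedgeSum b c) = MultilinearMap.alternatization
        (mulM (a : MultilinearMap R (fun _ : α => V) R)
          (mulM (b : MultilinearMap R (fun _ : β => V) R)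
          (c : MultilinearMap R (fun _ : γ => V) R))) := by
      rw [← wedgeSum_alt, ← factorial_smul_wedgeSum, AlternatingMap.coe_alternatization,
        wedgeSum_smul]
    have h3 : (A * B * C) • (wedgeSum (wedgeSum a b) c).domDomCongr (Equiv.sumAssoc α β γ) =
        ((A * B * C) • (wedgeSum (wedgeSum a b) c)).domDomCongr (Equiv.sumAssoc α β γ) := by
      ext v; simp
    rw [h3, h1, mul_assoc, h2, ← alt_domDomCongr]
    congr 1
    ext v
    simp [mulM_apply, mul_assoc]
  exact nsmul_cancel (by positivity) key

theorem wedgeSum_const_left [Algebra ℝ R] [IsEmpty α] (r : R) (a : V [⋀^β]→ₗ[R] R) :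
    wedgeSum (AlternatingMap.constOfIsEmpty R V α r) a =
      (r • a).domDomCongr (Equiv.emptySum α β).symm := by
  have key := factorial_smul_wedgeSum (AlternatingMap.constOfIsEmpty R V α r) a
  have h : mulM ((AlternatingMap.constOfIsEmpty R V α r : V [⋀^α]→ₗ[R] R) :
      MultilinearMap R (fun _ : α => V) R) (a : MultilinearMap R (fun _ : β => V) R) =
      (((r • a) : V [⋀^β]→ₗ[R] R) : MultilinearMap R (fun _ : β => V) R).domDomCongr
        (Equiv.emptySum α β).symm := by
    ext v; simp [mulM_apply]; rfl
  rw [h, alt_domDomCongr, AlternatingMap.coe_alternatization] at key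
  simp only [Fintype.card_eq_zero, Nat.factorial_zero, one_mul] at key
  have h3 : ((Fintype.card β).factorial • r • a).domDomCongr (Equiv.emptySum α β).symm =
      (Fintype.card β).factorial • (r • a).domDomCongr (Equiv.emptySum α β).symm := by
    ext v; simp
  rw [h3] at key
  exact nsmul_cancel (by positivity) key

theorem wedgeSum_const_right [Algebra ℝ R] [IsEmpty α] (r : R) (a : V [⋀^β]→ₗ[R] R) :
    wedgeSum a (AlternatingMap.constOfIsEmpty R V α r) =
      (r • a).domDomCongr (Equiv.sumEmpty β α).symm := by
  have key := factorial_smul_wedgeSum a (AlternatingMap.constOfIsEmpty R V α r)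
  have h : mulM (a : MultilinearMap R (fun _ : β => V) R)
      ((AlternatingMap.constOfIsEmpty R V α r : V [⋀^α]→ₗ[R] R) :
      MultilinearMap R (fun _ : α => V) R) =
      (((r • a) : V [⋀^β]→ₗ[R] R) : MultilinearMap R (fun _ : β => V) R).domDomCongr
        (Equiv.sumEmpty β α).symm := by
    ext v; simp [mulM_apply, mul_comm]; rfl
  rw [h, alt_domDomCongr, AlternatingMap.coe_alternatization] at key
  simp only [Fintype.card_eq_zero, Nat.factorial_zero, mul_one] at key
  have h3 : ((Fintype.card β).factorial • r • a).domDomCongr (Equiv.sumEmpty β α).symm =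
      (Fintype.card β).factorial • (r • a).domDomCongr (Equiv.sumEmpty β α).symm := by
    ext v; simp
  rw [h3] at key
  exact nsmul_cancel (by positivity) key

theorem wedgeSum_congr {δ ε : Type*} [Fintype δ] [DecidableEq δ] [Fintype ε] [DecidableEq ε]
    [Algebra ℝ R] (e : α ≃ δ) (f : β ≃ ε)
    (a : V [⋀^α]→ₗ[R] R) (b : V [⋀^β]→ₗ[R] R) :
    wedgeSum (a.domDomCongr e) (b.domDomCongr f) =
      (wedgeSum a b).domDomCongr (Equiv.sumCongr e f) := by
  have key := factorial_smul_wedgeSum (a.domDomCongr e) (b.domDomCongr f)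
  have h : mulM ((a.domDomCongr e : V [⋀^δ]→ₗ[R] R) : MultilinearMap R (fun _ : δ => V) R)
      ((b.domDomCongr f : V [⋀^ε]→ₗ[R] R) : MultilinearMap R (fun _ : ε => V) R) =
      (mulM (a : MultilinearMap R (fun _ : α => V) R)
        (b : MultilinearMap R (fun _ : β => V) R)).domDomCongr (Equiv.sumCongr e f) := by
    ext v; simp [mulM_apply]; rfl
  rw [h, alt_domDomCongr, ← factorial_smul_wedgeSum, ← Fintype.card_congr e,
    ← Fintype.card_congr f] at key
  have h3 : ∀ n : ℕ, (n • wedgeSum a b).domDomCongr (Equiv.sumCongr e f) =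
      n • (wedgeSum a b).domDomCongr (Equiv.sumCongr e f) := by
    intro n; ext v; simp
  rw [h3] at key
  exact nsmul_cancel (by positivity) key

end Wedge

section Forms

variable (R : Type*) [CommRing R] [Algebra ℝ R]

/-- Differential `k`-forms over the algebra of functions `R`: alternating `R`-multilinear maps
from vector fields (derivations of `R`) to functions. For `R = C^∞(M)`, `M` a closed manifold, these
are the smooth differential `k`-forms on `M`. -/
abbrev AltForm (k : ℕ) : Type _ := Derivation ℝ R R [⋀^Fin k]→ₗ[R] R

variable {R}

theorem altForm_ext {x y : GradedMonoid (AltForm R)} (h : x.fst = y.fst)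
    (h' : x.snd.domDomCongr (finCongr h) = y.snd) : x = y := by
  obtain ⟨i, a⟩ := x
  obtain ⟨j, b⟩ := y
  obtain rfl : i = j := h
  have : a = b := h'
  rw [this]

instance altFormGOne : GradedMonoid.GOne (AltForm R) where
  one := AlternatingMap.constOfIsEmpty R _ (Fin 0) 1

noncomputable instance altFormGMul : GradedMonoid.GMul (AltForm R) where
  mul a b := wedge a b

noncomputable instance altFormGMonoid : GradedMonoid.GMonoid (AltForm R) where
  __ := altFormGOne
  __ := altFormGMul
  one_mul a := by
    refine altForm_ext (zero_add _) ?_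
    change (wedge (AlternatingMap.constOfIsEmpty R _ (Fin 0) 1) a.snd).domDomCongr _ = _
    rw [wedge, wedgeSum_const_left]
    ext v
    simp only [one_smul, AlternatingMap.domDomCongr_apply]
    congr 1
    ext i
    simp
  mul_one a := by
    refine altForm_ext (add_zero _) ?_
    change (wedge a.snd (AlternatingMap.constOfIsEmpty R _ (Fin 0) 1)).domDomCongr _ = _
    rw [wedge, wedgeSum_const_right]
    ext v
    simp only [one_smul, AlternatingMap.domDomCongr_apply]
    congr 1
  mul_assoc a b c := by
    refine altForm_ext (add_assoc _ _ _) ?_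
    change (wedge (wedge a.snd b.snd) c.snd).domDomCongr _ = wedge a.snd (wedge b.snd c.snd)
    have h1 := wedgeSum_congr (finSumFinEquiv (m := a.fst) (n := b.fst)) (Equiv.refl (Fin c.fst))
      (wedgeSum a.snd b.snd) c.snd
    have h2 := wedgeSum_congr (Equiv.refl (Fin a.fst)) (finSumFinEquiv (m := b.fst) (n := c.fst))
      a.snd (wedgeSum b.snd c.snd)
    simp only [AlternatingMap.domDomCongr_refl] at h1 h2
    simp only [wedge]
    rw [h1, h2, ← wedgeSum_assoc]
    ext v
    simp only [AlternatingMap.domDomCongr_apply]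
    congr 1
    funext i
    simp only [Function.comp_apply]
    congr 1
    rcases i with (i | i) | i <;> apply Fin.ext <;> simp [add_assoc]

theorem wedge_const_left (r : R) {k : ℕ} (a : AltForm R k) :
    (wedge (AlternatingMap.constOfIsEmpty R _ (Fin 0) r) a).domDomCongr (finCongr (zero_add k)) =
      r • a := by
  rw [wedge, wedgeSum_const_left]
  ext v
  simp only [AlternatingMap.domDomCongr_apply]
  congr 1
  funext i
  simp only [Function.comp_apply]
  congr 1
  apply Fin.ext
  simp

theorem wedge_const_right (r : R) {k : ℕ} (a : AltForm R k) :
    (wedge a (AlternatingMap.constOfIsEmpty R _ (Fin 0) r)).domDomCongr (finCongr (add_zero k)) =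
      r • a := by
  rw [wedge, wedgeSum_const_right]
  ext v
  simp only [AlternatingMap.domDomCongr_apply]
  congr 1

noncomputable def wedgeHom (p q : ℕ) : AltForm R p →ₗ[R] AltForm R q →ₗ[R] AltForm R (p + q) :=
  LinearMap.mk₂ R (fun a b => wedge a b)
    (fun a a' b => by
      ext v
      simp [wedge, wedgeSum, ← AlternatingMap.domCoprod'_apply, TensorProduct.add_tmul])
    (fun c a b => by
      ext v
      simp [wedge, wedgeSum, ← AlternatingMap.domCoprod'_apply, ← TensorProduct.smul_tmul'])
    (fun a b b' => by
      ext v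
      simp [wedge, wedgeSum, ← AlternatingMap.domCoprod'_apply, TensorProduct.tmul_add])
    (fun c a b => by
      ext v
      simp [wedge, wedgeSum, ← AlternatingMap.domCoprod'_apply])

noncomputable instance altFormGRing : DirectSum.GRing (AltForm R) where
  __ := altFormGMonoid
  mul_zero := fun {i j} a => map_zero (wedgeHom (R := R) i j a)
  zero_mul := fun {i j} b => LinearMap.map_zero₂ (wedgeHom (R := R) i j) b
  mul_add := fun {i j} a b c => map_add (wedgeHom (R := R) i j a) b c
  add_mul := fun {i j} a b c => LinearMap.map_add₂ (wedgeHom (R := R) i j) a b c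
  natCast n := AlternatingMap.constOfIsEmpty R _ (Fin 0) (n : R)
  natCast_zero := by ext v; simp
  natCast_succ n := by ext v; simp; rfl
  intCast n := AlternatingMap.constOfIsEmpty R _ (Fin 0) (n : R)
  intCast_ofNat n := by ext v; simp
  intCast_negSucc_ofNat n := by ext v; simp

noncomputable instance altFormGAlgebra : DirectSum.GAlgebra ℝ (AltForm R) where
  toFun :=
    { toFun r := AlternatingMap.constOfIsEmpty R _ (Fin 0) (algebraMap ℝ R r)
      map_zero' := by ext v; simp
      map_add' r s := by ext v; simp }
  map_one := by
    ext v
    simp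
    rfl
  map_mul r s := by
    refine altForm_ext (zero_add 0).symm ?_
    change _ = wedge (AlternatingMap.constOfIsEmpty R _ (Fin 0) (algebraMap ℝ R r))
      (AlternatingMap.constOfIsEmpty R _ (Fin 0) (algebraMap ℝ R s))
    have h := wedge_const_left (algebraMap ℝ R r)
      (AlternatingMap.constOfIsEmpty R _ (Fin 0) (algebraMap ℝ R s) : AltForm R 0)
    refine Eq.trans ?_ h.symm
    ext v
    change algebraMap ℝ R (r * s) = algebraMap ℝ R r * algebraMap ℝ R s
    exact map_mul _ _ _
  commutes r x := by
    refine altForm_ext (add_comm _ _) ?_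
    change (wedge (AlternatingMap.constOfIsEmpty R _ (Fin 0) (algebraMap ℝ R r))
      x.snd).domDomCongr _ = wedge x.snd
        (AlternatingMap.constOfIsEmpty R _ (Fin 0) (algebraMap ℝ R r))
    have h := wedge_const_left (algebraMap ℝ R r) x.snd
    rw [← wedge_const_right (algebraMap ℝ R r) x.snd] at h
    ext v
    have := congrArg (fun f => f (v ∘ Fin.cast (add_zero _).symm)) h
    exact this
  smul_def r x := by
    refine altForm_ext (zero_add x.fst).symm ?_
    change (r • x.snd).domDomCongr _ = wedge (AlternatingMap.constOfIsEmpty R _ (Fin 0)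
      (algebraMap ℝ R r)) x.snd
    have h := wedge_const_left (algebraMap ℝ R r) x.snd
    have h2 : r • x.snd = algebraMap ℝ R r • x.snd := by
      ext v
      simp [Algebra.smul_def]
    rw [h2, ← h]
    rfl

variable (R) in
/-- The algebra `Ω^*` of differential forms, the direct sum of the spaces of `k`-forms. -/
def Forms : Type _ := ⨁ k, AltForm R k

noncomputable instance : Ring (Forms R) := inferInstanceAs (Ring (⨁ k, AltForm R k))

noncomputable instance : Algebra ℝ (Forms R) := inferInstanceAs (Algebra ℝ (⨁ k, AltForm R k))

/-- `Forms R` as a direct sum. -/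
noncomputable def Forms.equiv : Forms R ≃ₗ[ℝ] ⨁ k, AltForm R k where
  toFun x := x
  invFun x := x
  map_add' _ _ := rfl
  map_smul' _ _ := rfl
  left_inv _ := rfl
  right_inv _ := rfl

/-- The inclusion of the `k`-forms. -/
noncomputable def Forms.of (k : ℕ) : AltForm R k →ₗ[ℝ] Forms R :=
  Forms.equiv.symm.toLinearMap ∘ₗ DirectSum.lof ℝ ℕ (AltForm R) k

theorem Forms.of_mul_of {p q : ℕ} (a : AltForm R p) (b : AltForm R q) :
    Forms.of p a * Forms.of q b = Forms.of (p + q) (wedge a b) :=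
  DirectSum.of_mul_of a b

variable (R) in
/-- The form-degree grading. -/
noncomputable def Forms.grading (k : ℕ) : Submodule ℝ (Forms R) :=
  LinearMap.range (Forms.of (R := R) k)

/-- The linear map out of `Forms R` with prescribed restrictions to the `k`-forms. -/
noncomputable def Forms.lift {W : Type*} [AddCommMonoid W] [Module ℝ W]
   (φ : ∀ k, AltForm R k →ₗ[ℝ] W) : Forms R →ₗ[ℝ] W :=
  DirectSum.toModule ℝ ℕ W φ ∘ₗ Forms.equiv.toLinearMap

@[simp] theorem Forms.lift_of {W : Type*} [AddCommMonoid W] [Module ℝ W]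
   (φ : ∀ k, AltForm R k →ₗ[ℝ] W) (k : ℕ) (a : AltForm R k) : Forms.lift φ (Forms.of k a) = φ k a := by
  simp [Forms.lift, Forms.of]

theorem Forms.hom_ext {W : Type*} [AddCommMonoid W] [Module ℝ W] {φ ψ : Forms R →ₗ[ℝ] W}
    (h : ∀ k a, φ (Forms.of k a) = ψ (Forms.of k a)) : φ = ψ := by
  have : φ ∘ₗ Forms.equiv.symm.toLinearMap = ψ ∘ₗ Forms.equiv.symm.toLinearMap := by
    refine DirectSum.linearMap_ext ℝ fun k => ?_
    ext a
    exact h k a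
  ext x
  exact LinearMap.congr_fun this (Forms.equiv x)

noncomputable instance : GradedAlgebra (Forms.grading R) where
  one_mem := ⟨AlternatingMap.constOfIsEmpty R _ (Fin 0) 1, rfl⟩
  mul_mem := by
    rintro i j _ _ ⟨a, rfl⟩ ⟨b, rfl⟩
    exact ⟨wedge a b, (Forms.of_mul_of a b).symm⟩
  toDecomposition := DirectSum.Decomposition.ofLinearMap _
    (Forms.lift fun k => DirectSum.lof ℝ ℕ (fun k => Forms.grading R k) k ∘ₗ
      (Forms.of (R := R) k).rangeRestrict)
    (Forms.hom_ext fun k a => by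
      rw [LinearMap.comp_apply, Forms.lift_of]
      exact DirectSum.coeLinearMap_lof (Forms.grading R) k ⟨Forms.of k a, a, rfl⟩)
    (by
      refine DirectSum.linearMap_ext ℝ fun k => ?_
      ext ⟨_, ⟨a, rfl⟩⟩ : 1
      simp
      rfl)

theorem lieForm_aux (X : Derivation ℝ R R) {k : ℕ} (ζ : AltForm R k)
    (v : Fin k → Derivation ℝ R R) (i : Fin k) (z : Derivation ℝ R R) :
    ∑ j, ζ (Function.update (Function.update v i z) j ⁅X, Function.update v i z j⁆) =
      ζ (Function.update v i ⁅X, z⁆) + ∑ j ∈ Finset.univ.erase i,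
        ζ (Function.update (Function.update v j ⁅X, v j⁆) i z) := by
  rw [← Finset.add_sum_erase _ _ (Finset.mem_univ i)]
  congr 1
  · simp
  · refine Finset.sum_congr rfl fun j hj => ?_
    have hji : j ≠ i := Finset.ne_of_mem_erase hj
    rw [Function.update_of_ne hji, Function.update_comm hji.symm]

/-- The Lie derivative of a form:
`(L_X ζ)(v_1, …, v_k) = X(ζ(v_1, …, v_k)) - ∑ i, ζ(v_1, …, [X, v_i], …, v_k)`. -/
noncomputable def lieForm (X : Derivation ℝ R R) {k : ℕ} (ζ : AltForm R k) : AltForm R k where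
  toFun v := X (ζ v) - ∑ i, ζ (Function.update v i ⁅X, v i⁆)
  map_update_add' v i x y := by
    rename_i inst
    obtain rfl : inst = instDecidableEqFin k := Subsingleton.elim _ _
    have h := lieForm_aux X ζ v i
    rw [h, h, h]
    simp only [lie_add, ζ.map_update_add, map_add, Finset.sum_add_distrib]
    abel
  map_update_smul' v i c x := by
    rename_i inst
    obtain rfl : inst = instDecidableEqFin k := Subsingleton.elim _ _
    have h := lieForm_aux X ζ v i
    have hX : ⁅X, c • x⁆ = c • ⁅X, x⁆ + X c • x := by
      ext a
      simp [Derivation.commutator_apply]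
    rw [h, h, hX]
    simp only [ζ.map_update_smul, ζ.map_update_add, smul_eq_mul, Derivation.leibniz,
      ← Finset.mul_sum]
    ring
  map_eq_zero_of_eq' v i j hij hne := by
    have h0 : ζ v = 0 := ζ.map_eq_zero_of_eq v hij hne
    rw [h0, map_zero, zero_sub, neg_eq_zero,
      ← Finset.add_sum_erase _ _ (Finset.mem_univ i),
      ← Finset.add_sum_erase _ _ (Finset.mem_erase.2 ⟨hne.symm, Finset.mem_univ j⟩),
      Finset.sum_eq_zero, add_zero]
    · have h1 : Function.update v j ⁅X, v j⁆ =
          Function.update v i ⁅X, v i⁆ ∘ Equiv.swap i j := by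
        funext l
        rcases eq_or_ne l i with rfl | hl
        · simp [hij, hne, hne.symm]
        · rcases eq_or_ne l j with rfl | hl'
          · simp [hij]
          · simp [Equiv.swap_apply_of_ne_of_ne hl hl', hl, hl']
      rw [h1, ζ.map_swap _ hne]
      simp
    · intro l hl
      simp only [Finset.mem_erase, Finset.mem_univ, and_true] at hl
      refine ζ.map_eq_zero_of_eq _ (i := i) (j := j) ?_ hne
      simp [hl.1.symm, hl.2.symm, hij]

/-- A form, as an alternating map that is multilinear over `ℝ`. -/
def AltForm.restrictScalars {k : ℕ} (ζ : AltForm R k) : Derivation ℝ R R [⋀^Fin k]→ₗ[ℝ] R where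
  __ := ζ.toMultilinearMap.restrictScalars ℝ
  map_eq_zero_of_eq' := ζ.map_eq_zero_of_eq'

@[simp] theorem AltForm.restrictScalars_apply {k : ℕ} (ζ : AltForm R k)
    (v : Fin k → Derivation ℝ R R) : ζ.restrictScalars v = ζ v := rfl

theorem lieForm_apply (X : Derivation ℝ R R) {k : ℕ} (ζ : AltForm R k)
    (v : Fin k → Derivation ℝ R R) :
    lieForm X ζ v = X (ζ v) - ∑ i, ζ (Function.update v i ⁅X, v i⁆) := rfl

/-- Auxiliary map used to build the exterior derivative, see `koszulTerm_apply`. -/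
noncomputable def koszulTerm {k : ℕ} (ζ : AltForm R k) :
    Derivation ℝ R R →ₗ[ℝ] Derivation ℝ R R [⋀^Fin k]→ₗ[ℝ] R where
  toFun X := (2⁻¹ : ℝ) • ((X : R →ₗ[ℝ] R).compAlternatingMap ζ.restrictScalars +
    (lieForm X ζ).restrictScalars)
  map_add' X Y := by
    ext v
    simp only [AlternatingMap.smul_apply, AlternatingMap.add_apply,
      LinearMap.compAlternatingMap_apply, AltForm.restrictScalars_apply, lieForm_apply,
      Derivation.coeFn_coe, Derivation.add_apply, add_lie, AlternatingMap.map_update_add,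
      Finset.sum_add_distrib]
    module
  map_smul' c X := by
    ext v
    have h : ∀ i, ζ (Function.update v i (c • ⁅X, v i⁆)) =
        c • ζ (Function.update v i ⁅X, v i⁆) := fun i => ζ.restrictScalars.map_update_smul v i c _
    simp only [AlternatingMap.smul_apply, AlternatingMap.add_apply,
      LinearMap.compAlternatingMap_apply, AltForm.restrictScalars_apply, lieForm_apply,
      Derivation.coeFn_coe, Derivation.smul_apply, smul_lie, h, ← Finset.smul_sum,
      RingHom.id_apply]
    module

theorem koszulTerm_apply {k : ℕ} (ζ : AltForm R k) (X : Derivation ℝ R R)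
    (v : Fin k → Derivation ℝ R R) :
    koszulTerm ζ X v = X (ζ v) - (2⁻¹ : ℝ) • ∑ j, ζ (Function.update v j ⁅X, v j⁆) := by
  simp only [koszulTerm, LinearMap.coe_mk, AddHom.coe_mk, AlternatingMap.smul_apply,
    AlternatingMap.add_apply, LinearMap.compAlternatingMap_apply, AltForm.restrictScalars_apply,
    lieForm_apply, Derivation.coeFn_coe]
  module

/-- The exterior derivative as an alternating map that is multilinear over `ℝ`. -/
noncomputable def koszulAux {k : ℕ} (ζ : AltForm R k) :
    Derivation ℝ R R [⋀^Fin (k + 1)]→ₗ[ℝ] R :=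
  AlternatingMap.alternatizeUncurryFin (koszulTerm ζ)

theorem pow_smul_cons_removeNth {k : ℕ} (ζ : AltForm R (k + 1))
    (w : Fin (k + 1) → Derivation ℝ R R) (i : Fin (k + 1)) (Z : Derivation ℝ R R) :
    (-1 : ℤ) ^ (i : ℕ) • ζ (Matrix.vecCons Z (i.removeNth w)) = ζ (Function.update w i Z) := by
  rw [← Fin.insertNth_removeNth, AlternatingMap.map_insertNth]

theorem koszulTerm_cons {k : ℕ} (ζ : AltForm R (k + 1)) (X Y : Derivation ℝ R R)
    (u : Fin k → Derivation ℝ R R) :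
    koszulTerm ζ Y (Matrix.vecCons X u) = koszulTerm (ζ.curryLeft X) Y u -
      (2⁻¹ : ℝ) • ζ (Matrix.vecCons ⁅Y, X⁆ u) := by
  have h0 : ∀ Z : Derivation ℝ R R, Function.update (Matrix.vecCons X u) 0 Z =
      Matrix.vecCons Z u := fun Z => Fin.update_cons_zero _ _ _
  have h1 : ∀ (i : Fin k) (Z : Derivation ℝ R R), Function.update (Matrix.vecCons X u) i.succ Z =
      Matrix.vecCons X (Function.update u i Z) := fun i Z => (Fin.cons_update _ _ _ _).symm
  simp only [koszulTerm_apply, Fin.sum_univ_succ, h0, h1, Matrix.cons_val_zero,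
    Matrix.cons_val_succ, AlternatingMap.curryLeft_apply_apply]
  module

theorem koszulAux_cons {k : ℕ} (ζ : AltForm R (k + 1)) (X : Derivation ℝ R R)
    (w : Fin (k + 1) → Derivation ℝ R R) :
    koszulAux ζ (Matrix.vecCons X w) = lieForm X ζ w - koszulAux (ζ.curryLeft X) w := by
  have h2 : ∀ i : Fin (k + 1), i.succ.removeNth (Matrix.vecCons X w) =
      Matrix.vecCons X (i.removeNth w) := by
    intro i
    funext j
    refine Fin.cases ?_ (fun j => ?_) j
    · simp [Fin.removeNth]
    · simp [Fin.removeNth]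
  have h3 : ∀ i : Fin (k + 1), ⁅w i, X⁆ = -⁅X, w i⁆ := fun i => (lie_skew _ _).symm
  have h4 : ∀ (i : Fin (k + 1)) (Z : Derivation ℝ R R),
      ζ (Function.update w i (-Z)) = - ζ (Function.update w i Z) := fun i Z => by
    rw [AlternatingMap.map_update_neg]
  rw [koszulAux, koszulAux, AlternatingMap.alternatizeUncurryFin_apply, Fin.sum_univ_succ,
    AlternatingMap.alternatizeUncurryFin_apply]
  have h5 : ∀ i : Fin (k + 1), (-1 : ℤ) ^ (i.succ : ℕ) •
      koszulTerm ζ (Matrix.vecCons X w i.succ) (i.succ.removeNth (Matrix.vecCons X w)) =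
      - ((-1 : ℤ) ^ (i : ℕ) • koszulTerm (ζ.curryLeft X) (w i) (i.removeNth w)) -
      (2⁻¹ : ℝ) • ζ (Function.update w i ⁅X, w i⁆) := by
    intro i
    rw [h2, koszulTerm_cons, Fin.val_succ, pow_succ, Matrix.cons_val_succ, ← neg_neg ⁅X, w i⁆,
      ← h3, h4, ← pow_smul_cons_removeNth]
    simp only [mul_neg, mul_one, neg_smul, smul_sub, smul_neg]
    rw [smul_comm (2⁻¹ : ℝ)]
  rw [Finset.sum_congr rfl fun i _ => h5 i]
  simp only [Finset.sum_sub_distrib, Finset.sum_neg_distrib, ← Finset.smul_sum, lieForm_apply]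
  simp [koszulTerm_apply]
  module

theorem koszulAux_zero {ζ : AltForm R 0} (v : Fin 1 → Derivation ℝ R R) :
    koszulAux ζ v = v 0 (ζ ![]) := by
  simp [koszulAux, AlternatingMap.alternatizeUncurryFin_apply, koszulTerm_apply]
  congr 2
  exact Subsingleton.elim _ _

theorem koszulAux_smul {k : ℕ} (f : R) (η : AltForm R k) (w : Fin (k + 1) → Derivation ℝ R R) :
    koszulAux (f • η) w = f * koszulAux η w +
      ∑ i : Fin (k + 1), (-1 : ℤ) ^ (i : ℕ) • (w i f * η (i.removeNth w)) := by
  simp only [koszulAux, AlternatingMap.alternatizeUncurryFin_apply, koszulTerm_apply,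
    AlternatingMap.smul_apply, smul_eq_mul, Derivation.leibniz, ← Finset.mul_sum]
  rw [Finset.mul_sum, ← Finset.sum_add_distrib]
  refine Finset.sum_congr rfl fun i _ => ?_
  rw [mul_smul_comm, ← smul_add]
  congr 1
  simp only [mul_sub, mul_smul_comm]
  ring

theorem lieForm_smul {k : ℕ} (f : R) (X : Derivation ℝ R R) (ζ : AltForm R k)
    (w : Fin k → Derivation ℝ R R) :
    lieForm (f • X) ζ w = f * lieForm X ζ w + ∑ i, w i f * ζ (Function.update w i X) := by
  have h : ∀ i, ⁅f • X, w i⁆ = f • ⁅X, w i⁆ + (-(w i f)) • X := by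
    intro i
    ext a
    simp [Derivation.commutator_apply]
    ring
  simp only [lieForm_apply, h, AlternatingMap.map_update_add, AlternatingMap.map_update_smul,
    Finset.sum_add_distrib, smul_eq_mul, neg_mul, Finset.sum_neg_distrib, ← Finset.mul_sum,
    Derivation.smul_apply]
  ring

theorem koszulAux_smul_cons {k : ℕ} (ζ : AltForm R k) (f : R) (X : Derivation ℝ R R)
    (w : Fin k → Derivation ℝ R R) :
    koszulAux ζ (Matrix.vecCons (f • X) w) = f * koszulAux ζ (Matrix.vecCons X w) := by
  cases k with
  | zero => simp [koszulAux_zero]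
  | succ k =>
    rw [koszulAux_cons, koszulAux_cons, lieForm_smul, map_smul, koszulAux_smul, mul_sub]
    have h : ∀ i : Fin (k + 1), (-1 : ℤ) ^ (i : ℕ) • (w i f * ζ.curryLeft X (i.removeNth w)) =
        w i f * ζ (Function.update w i X) := by
      intro i
      rw [AlternatingMap.curryLeft_apply_apply, ← pow_smul_cons_removeNth, mul_smul_comm]
    rw [Finset.sum_congr rfl fun i _ => h i]
    ring

/-- The exterior derivative of a `k`-form, by the invariant formula
`dζ(v_0, …, v_k) = ∑ i, (-1)^i v_i(ζ(…, v̂_i, …))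
  + ∑ i < j, (-1)^(i + j) ζ([v_i, v_j], …, v̂_i, …, v̂_j, …)`.
The bracket terms are written with `[v_i, v_j]` at the place of `v_j`, summed over all ordered pairs,
so that each unordered pair occurs twice, whence the factor `1/2`. -/
noncomputable def extForm {k : ℕ} (ζ : AltForm R k) : AltForm R (k + 1) where
  toFun v := ∑ i : Fin (k + 1), (-1 : ℤ) ^ (i : ℕ) • (v i (ζ (i.removeNth v)) -
    (2⁻¹ : ℝ) • ∑ j : Fin k,
      ζ (Function.update (i.removeNth v) j ⁅v i, i.removeNth v j⁆))
  map_update_add' v i x y := by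
    rename_i inst
    obtain rfl : inst = instDecidableEqFin (k + 1) := Subsingleton.elim _ _
    simp only [← koszulTerm_apply, ← AlternatingMap.alternatizeUncurryFin_apply]
    exact (koszulAux ζ).map_update_add v i x y
  map_update_smul' v i f x := by
    rename_i inst
    obtain rfl : inst = instDecidableEqFin (k + 1) := Subsingleton.elim _ _
    simp only [← koszulTerm_apply, ← AlternatingMap.alternatizeUncurryFin_apply]
    change koszulAux ζ _ = f * koszulAux ζ _
    have h0 : ∀ (u : Fin (k + 1) → Derivation ℝ R R) (z : Derivation ℝ R R),
        Function.update u 0 z = Matrix.vecCons z (Fin.tail u) := by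
      intro u z
      funext j
      refine Fin.cases ?_ (fun j => ?_) j <;> simp [Fin.tail]
    rcases eq_or_ne i 0 with rfl | hi
    · rw [h0, h0, koszulAux_smul_cons]
    · have h1 : ∀ z : Derivation ℝ R R, koszulAux ζ (Function.update v i z) =
          - koszulAux ζ (Matrix.vecCons z (Fin.tail (v ∘ Equiv.swap i 0))) := by
        intro z
        rw [← AlternatingMap.map_swap _ _ hi]
        congr 1
        rw [← h0]
        funext j
        rcases eq_or_ne j 0 with rfl | hj
        · simp [hi, hi.symm]
        · rcases eq_or_ne j i with rfl | hj'
          · simp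
          · simp [hj, hj', Equiv.swap_apply_of_ne_of_ne hj' hj]
      rw [h1, h1, koszulAux_smul_cons, mul_neg]
  map_eq_zero_of_eq' v i j hij hne := by
    simp only [← koszulTerm_apply, ← AlternatingMap.alternatizeUncurryFin_apply]
    exact (koszulAux ζ).map_eq_zero_of_eq v hij hne

theorem extForm_apply {k : ℕ} (ζ : AltForm R k) (v : Fin (k + 1) → Derivation ℝ R R) :
    extForm ζ v = ∑ i : Fin (k + 1), (-1 : ℤ) ^ (i : ℕ) • (v i (ζ (i.removeNth v)) -
    (2⁻¹ : ℝ) • ∑ j : Fin k,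
      ζ (Function.update (i.removeNth v) j ⁅v i, i.removeNth v j⁆)) := rfl

/-- Contraction `ι_X` on the algebra of forms (insertion of `X` as first argument). -/
noncomputable def Forms.contract (X : Derivation ℝ R R) : Module.End ℝ (Forms R) :=
  Forms.lift fun k => match k with
    | 0 => 0
    | k + 1 => Forms.of k ∘ₗ
      { toFun ζ := ζ.curryLeft X
        map_add' _ _ := rfl
        map_smul' _ _ := rfl }

/-- Lie derivative `L_X` on the algebra of forms. -/
noncomputable def Forms.lieDerivative (X : Derivation ℝ R R) : Module.End ℝ (Forms R) :=
  Forms.lift fun k => Forms.of k ∘ₗ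
      { toFun ζ := lieForm X ζ
        map_add' ζ η := by
          ext v
          simp only [lieForm_apply, AlternatingMap.add_apply, map_add, Finset.sum_add_distrib]
          abel
        map_smul' c ζ := by
          ext v
          simp only [lieForm_apply, AlternatingMap.smul_apply, Derivation.map_smul, ← Finset.smul_sum, smul_sub, RingHom.id_apply] }

/-- Exterior derivative on the algebra of forms. -/
noncomputable def Forms.d : Module.End ℝ (Forms R) :=
  Forms.lift fun k => Forms.of (k + 1) ∘ₗ
      { toFun ζ := extForm ζ
        map_add' ζ η := by
          ext v
          simp only [extForm_apply, AlternatingMap.add_apply, map_add, Finset.sum_add_distrib, smul_add, smul_sub, Finset.sum_sub_distrib]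
          abel
        map_smul' c ζ := by
          ext v
          simp only [extForm_apply, AlternatingMap.smul_apply, Derivation.map_smul, ← Finset.smul_sum, smul_sub, RingHom.id_apply]
          rw [Finset.smul_sum]
          refine Finset.sum_congr rfl fun i _ => ?_
          rw [smul_sub, smul_comm c, smul_comm c, smul_comm c (2⁻¹ : ℝ)] }

end Forms
section Action
variable {E F H K: Type*} [NormedAddCommGroup E] [NormedSpace ℝ E]
  [NormedAddCommGroup F] [NormedSpace ℝ F] [TopologicalSpace H] [TopologicalSpace K]
  {I : ModelWithCorners ℝ E H} {J : ModelWithCorners ℝ F K}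
  {G M : Type*} [TopologicalSpace G] [ChartedSpace H G] [Group G] [LieGroup I ∞ G]
  [TopologicalSpace M] [ChartedSpace K M] [IsManifold J ∞ M] [MulAction G M]
  [ContMDiffSMul I J ∞ G M]

variable (I) in
/-- Derivative at `g = 1`, in the direction `X`, of `g ↦ f (g • x)`. -/
noncomputable def orbitDeriv (X : GroupLieAlgebra I G) (f : M → ℝ) (x : M) : ℝ :=
  mfderiv I 𝓘(ℝ, ℝ) (fun g : G => f (g • x)) 1 X

theorem contMDiff_orbitDeriv (X : GroupLieAlgebra I G) (f : C^∞⟮J, M; ℝ⟯) :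
    ContMDiff J 𝓘(ℝ, ℝ) ∞ (orbitDeriv I X f) := by
  have : IsManifold I ∞ G := inferInstance
  intro x₀
  have hF : ContMDiff (J.prod I) 𝓘(ℝ, ℝ) ∞ (Function.uncurry fun (x : M) (g : G) => f (g • x)) := by
    have h : ContMDiff (I.prod J) J ∞ (fun p : G × M => p.1 • p.2) := contMDiff_smul
    exact f.contMDiff.comp (h.comp (contMDiff_snd.prodMk contMDiff_fst))
  have : IsManifold I 1 G := IsManifold.of_le (n := ∞) (by simp)
  have key := ContMDiffAt.mfderiv_apply (I := I) (I' := 𝓘(ℝ, ℝ)) (J := J) (m := ∞) (n := ∞) (x₀ := x₀) (fun (x : M) (g : G) => f (g • x))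
    (fun _ => 1) id (fun _ => (X : E))
    hF.contMDiffAt contMDiffAt_const contMDiffAt_id contMDiffAt_const (by simp)
  refine key.congr_of_eventuallyEq (Filter.Eventually.of_forall fun x => ?_)
  have h1 := inTangentCoordinates_eq (I := I) (I' := 𝓘(ℝ, ℝ)) (fun _ : M => (1 : G))
    (fun x : M => f ((1 : G) • x)) (fun x => mfderiv I 𝓘(ℝ, ℝ) (fun g : G => f (g • x)) 1)
    (x₀ := x₀) (x := x) (mem_chart_source H (1 : G)) (Set.mem_univ _)
  have h2 := (tangentBundleCore I G).coordChange_self (achart H (1 : G)) 1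
    (mem_achart_source H (1 : G)) X
  have h3 := TangentBundle.coordChange_model_space (𝕜 := ℝ) (F := ℝ) (f ((1 : G) • x)) (f ((1 : G) • x₀)) (f ((1 : G) • x))
  change _ = (inTangentCoordinates I 𝓘(ℝ, ℝ) (fun _ : M => (1 : G))
    (fun x : M => f ((1 : G) • x)) (fun x => mfderiv I 𝓘(ℝ, ℝ) (fun g : G => f (g • x)) 1) x₀ x) X
  rw [h1]
  erw [h3]
  change _ = (mfderiv I 𝓘(ℝ, ℝ) (fun g : G => f (g • x)) 1) ((tangentBundleCore I G).coordChange
    (achart H (1 : G)) (achart H (1 : G)) 1 X)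
  rw [h2]
  rfl

theorem mdifferentiableAt_orbit (f : C^∞⟮J, M; ℝ⟯) (x : M) :
    MDifferentiableAt I 𝓘(ℝ, ℝ) (fun g : G => f (g • x)) 1 := by
  have h : ContMDiff (I.prod J) J ∞ (fun p : G × M => p.1 • p.2) := contMDiff_smul
  have h2 : ContMDiff I 𝓘(ℝ, ℝ) ∞ (fun g : G => f (g • x)) :=
    f.contMDiff.comp (h.comp (contMDiff_id.prodMk contMDiff_const))
  exact h2.contMDiffAt.mdifferentiableAt (by simp)

/-- The vector field `X^M` generated by `X` in the Lie algebra of `G`: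
`(X^M f)(x) = d/dt f(exp(-tX) x)` at `t = 0`, which is the derivative of `g ↦ f (g • x)` at `1` in the
direction `-X`. -/
noncomputable def fundamentalField (X : GroupLieAlgebra I G) :
    Derivation ℝ C^∞⟮J, M; ℝ⟯ C^∞⟮J, M; ℝ⟯ :=
  Derivation.mk'
  { toFun f := ⟨fun x => -orbitDeriv I X f x, (contMDiff_orbitDeriv X f).neg⟩
    map_add' f g := by
      ext x
      have h := ((mdifferentiableAt_orbit (I := I) (G := G) f x).hasMFDerivAt.add
        (mdifferentiableAt_orbit (I := I) (G := G) g x).hasMFDerivAt).mfderiv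
      change -orbitDeriv I X (⇑f + ⇑g) x =
        -orbitDeriv I X f x +
        -orbitDeriv I X g x
      have h' : orbitDeriv I X (⇑f + ⇑g) x = orbitDeriv I X f x + orbitDeriv I X g x :=
        congrArg (fun T => T X) h
      rw [h', neg_add]
    map_smul' c f := by
      ext x
      have h := ((mdifferentiableAt_orbit (I := I) (G := G) f x).hasMFDerivAt.const_smul c).mfderiv
      change -orbitDeriv I X (c • ⇑f) x =
        c * -orbitDeriv I X f x
      have h' : orbitDeriv I X (c • ⇑f) x = c * orbitDeriv I X f x := congrArg (fun T => T X) h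
      rw [h', mul_neg] }
  (fun f g => by
    ext x
    have h := ((mdifferentiableAt_orbit (I := I) (G := G) f x).hasMFDerivAt.mul
        (mdifferentiableAt_orbit (I := I) (G := G) g x).hasMFDerivAt).mfderiv
    change -orbitDeriv I X (⇑f * ⇑g) x =
        f x * -orbitDeriv I X g x +
        g x * -orbitDeriv I X f x
    have h' : orbitDeriv I X (⇑f * ⇑g) x = f ((1 : G) • x) * orbitDeriv I X g x +
      g ((1 : G) • x) * orbitDeriv I X f x := congrArg (fun T => T X) h
    rw [h', one_smul]
    ring)
end Action
section Weil
variable (𝔤 : Type*) [AddCommGroup 𝔤] [Module ℝ 𝔤]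

/-- The Weil algebra `W(𝔤) = Λ(𝔤^*) ⊗ S(𝔤^*)`. -/
abbrev Weil : Type _ :=
  ExteriorAlgebra ℝ (Module.Dual ℝ 𝔤) ⊗[ℝ] SymmetricAlgebra ℝ (Module.Dual ℝ 𝔤)

/-- The grading of `W(𝔤)` by exterior degree. As `S(𝔤^*)` sits in even total degrees, its parity is
the parity of the total degree, and so it gives the usual signs in tensor products. -/
noncomputable def Weil.grading (p : ℕ) : Submodule ℝ (Weil 𝔤) :=
  DirectSum.decomposeTensor (fun p : ℕ => ⋀[ℝ]^p (Module.Dual ℝ 𝔤))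
    (SymmetricAlgebra ℝ (Module.Dual ℝ 𝔤)) p

noncomputable instance : GradedAlgebra (Weil.grading 𝔤) where
  one_mem := ⟨⟨1, SetLike.GradedOne.one_mem⟩ ⊗ₜ 1, rfl⟩
  mul_mem := by
    rintro i j _ _ ⟨a, rfl⟩ ⟨b, rfl⟩
    induction a using TensorProduct.induction_on with
    | zero => simp
    | add x y hx hy => rw [map_add, add_mul]; exact add_mem hx hy
    | tmul x s =>
      induction b using TensorProduct.induction_on with
      | zero => simp
      | add x y hx hy => rw [map_add, mul_add]; exact add_mem hx hy
      | tmul y t =>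
        refine ⟨⟨x.1 * y.1, SetLike.mul_mem_graded x.2 y.2⟩ ⊗ₜ (s * t), ?_⟩
        simp only [LinearMap.rTensor_tmul, Submodule.subtype_apply,
          Algebra.TensorProduct.tmul_mul_tmul]
  toDecomposition := DirectSum.tensorDecomposition _ _

variable {𝔤} {n : ℕ} (e : Module.Basis (Fin n) ℝ 𝔤)

/-- The generator `θ^i` of `Λ(𝔤^*)`. -/
noncomputable def Weil.θ (i : Fin n) : Weil 𝔤 := ExteriorAlgebra.ι ℝ (e.coord i) ⊗ₜ 1
/-- The generator `φ^i` of `S(𝔤^*)`. -/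
noncomputable def Weil.φ (i : Fin n) : Weil 𝔤 := 1 ⊗ₜ SymmetricAlgebra.ι ℝ _ (e.coord i)

/-- The contraction `i_X` on `W(𝔤)`: the antiderivation with `i_X θ^s = θ^s(X)`, `i_X φ^s = 0`. -/
noncomputable def Weil.contract (X : 𝔤) : Module.End ℝ (Weil 𝔤) :=
  TensorProduct.map (CliffordAlgebra.contractLeft (Q := 0) (Module.Dual.eval ℝ 𝔤 X)) LinearMap.id

/-- The derivation `∂/∂φ^i` of `W(𝔤)`. -/
noncomputable def Weil.pderiv (i : Fin n) : Module.End ℝ (Weil 𝔤) :=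
  TensorProduct.map LinearMap.id
    ((SymmetricAlgebra.equivMvPolynomial e.dualBasis).symm.toLinearMap ∘ₗ
      (MvPolynomial.pderiv (R := ℝ) i).toLinearMap ∘ₗ
      (SymmetricAlgebra.equivMvPolynomial e.dualBasis).toLinearMap)

/-- Structure constants: `[e_j, e_k] = ∑ i, c^i_{jk} e_i`. -/
noncomputable def structureConstant [Bracket 𝔤 𝔤] (i j k : Fin n) : ℝ := e.coord i ⁅e j, e k⁆

/-- The differential `d_W`: the antiderivation with `d_W θ^i = -1/2 ∑ c^i_{jk} θ^j θ^k + φ^i` and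
`d_W φ^i = -∑ c^i_{jk} θ^j φ^k` (see `Weil.d_θ`, `Weil.d_φ`), written out as
`∑ i, (d_W θ^i) i_{e_i} + (d_W φ^i) ∂/∂φ^i`. -/
noncomputable def Weil.d [Bracket 𝔤 𝔤] : Module.End ℝ (Weil 𝔤) :=
  ∑ i, (LinearMap.mulLeft ℝ (-(2⁻¹ : ℝ) • (∑ j, ∑ k,
      structureConstant e i j k • (Weil.θ e j * Weil.θ e k)) + Weil.φ e i) ∘ₗ Weil.contract (e i) +
    LinearMap.mulLeft ℝ (-∑ j, ∑ k, structureConstant e i j k • (Weil.θ e j * Weil.φ e k)) ∘ₗ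
      Weil.pderiv e i)

theorem Weil.d_θ [Bracket 𝔤 𝔤] (i : Fin n) : Weil.d e (Weil.θ e i) = -(2⁻¹ : ℝ) • (∑ j, ∑ k,
      structureConstant e i j k • (Weil.θ e j * Weil.θ e k)) + Weil.φ e i := by
  have h1 : ∀ r, Weil.contract (e r) (Weil.θ e i) = if r = i then 1 else 0 := by
    intro r
    simp [Weil.contract, Weil.θ, ExteriorAlgebra.ι, CliffordAlgebra.contractLeft_ι, Finsupp.single_apply]
    by_cases h : r = i
    · subst h; simp; rfl
    · simp [h, Ne.symm h]
  have h2 : ∀ r, Weil.pderiv e r (Weil.θ e i) = 0 := by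
    intro r
    simp [Weil.pderiv, Weil.θ]
  simp [Weil.d, h1, h2]

theorem Weil.d_φ [Bracket 𝔤 𝔤] (i : Fin n) : Weil.d e (Weil.φ e i) = -∑ j, ∑ k, structureConstant e i j k • (Weil.θ e j * Weil.φ e k) := by
  have h1 : ∀ r, Weil.contract (e r) (Weil.φ e i) = 0 := by
    intro r
    simp [Weil.contract, Weil.φ]
  have h2 : ∀ r, Weil.pderiv e r (Weil.φ e i) = if r = i then 1 else 0 := by
    intro r
    have : SymmetricAlgebra.equivMvPolynomial e.dualBasis (SymmetricAlgebra.ι ℝ (Module.Dual ℝ 𝔤) (e.coord i)) = MvPolynomial.X i := by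
      rw [← SymmetricAlgebra.equivMvPolynomial_ι_apply e.dualBasis, Module.Basis.coe_dualBasis]
    simp [Weil.pderiv, Weil.φ, this, Pi.single_apply]
    by_cases h : r = i
    · subst h; simp; rfl
    · simp [h, Ne.symm h]
  simp [Weil.d, h1, h2]

end Weil

section Model

variable (𝔤 : Type*) [AddCommGroup 𝔤] [Module ℝ 𝔤] (R : Type*) [CommRing R] [Algebra ℝ R]

/-- `W(𝔤) ⊗ Ω^*` over `ℝ`, with the multiplication of a tensor product of graded algebras,
`(a ⊗ b)(a' ⊗ b') = (-1)^(|b||a'|) aa' ⊗ bb'`. -/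
abbrev RealModel : Type _ := Weil.grading 𝔤 ᵍ⊗[ℝ] Forms.grading R

/-- The algebra `W(𝔤) ⊗ Ω^*`, with complex coefficients. -/
abbrev Model : Type _ := ℂ ⊗[ℝ] RealModel 𝔤 R

/-- The total degree on `W(𝔤) ⊗ Ω^*`: `θ^i` has degree 1, `φ^i` has degree 2, a `k`-form has
degree `k`. -/
noncomputable def Model.degree (m : ℕ) : Submodule ℂ (Model 𝔤 R) :=
  Submodule.span ℂ {x | ∃ p q k : ℕ, p + 2 * q + k = m ∧
    ∃ a ∈ ⋀[ℝ]^p (Module.Dual ℝ 𝔤),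
    ∃ s ∈ LinearMap.range (SymmetricAlgebra.ι ℝ (Module.Dual ℝ 𝔤)) ^ q,
    ∃ ζ ∈ Forms.grading R k,
      x = 1 ⊗ₜ[ℝ] GradedTensorProduct.of ℝ (Weil.grading 𝔤) (Forms.grading R) ((a ⊗ₜ s) ⊗ₜ ζ)}

variable {𝔤 R}

/-- The complexification of the map `a ⊗ b ↦ u(a) ⊗ v(b)` (without sign). -/
noncomputable def Model.tensorOp (u : Module.End ℝ (Weil 𝔤)) (v : Module.End ℝ (Forms R)) :
    Module.End ℂ (Model 𝔤 R) :=
  LinearMap.baseChange ℂ ((GradedTensorProduct.of ℝ (Weil.grading 𝔤) (Forms.grading R)).toLinearMap ∘ₗ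
    TensorProduct.map u v ∘ₗ
    (GradedTensorProduct.of ℝ (Weil.grading 𝔤) (Forms.grading R)).symm.toLinearMap)

variable (𝔤) in
/-- The parity involution `a ↦ (-1)^|a| a` of `W(𝔤)`. -/
noncomputable def Weil.parity : Module.End ℝ (Weil 𝔤) :=
  TensorProduct.map (CliffordAlgebra.involute (Q := (0 : QuadraticForm ℝ (Module.Dual ℝ 𝔤)))).toLinearMap LinearMap.id

variable (𝔤) in
/-- The operator `1 ⊗ v` for an operator `v` of even degree on forms. -/
noncomputable def Model.evenOp (v : Module.End ℝ (Forms R)) : Module.End ℂ (Model 𝔤 R) :=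
  Model.tensorOp LinearMap.id v

variable (𝔤) in
/-- The operator `1 ⊗ v` for an operator `v` of odd degree on forms, with the sign rule
`(1 ⊗ v)(a ⊗ b) = (-1)^|a| a ⊗ v(b)`. -/
noncomputable def Model.oddOp (v : Module.End ℝ (Forms R)) : Module.End ℂ (Model 𝔤 R) :=
  Model.tensorOp (Weil.parity 𝔤) v

/-- Left multiplication by `w ⊗ 1`; thus `w ⊗ v` is `leftMul w * (1 ⊗ v)`. -/
noncomputable def Model.leftMul (w : Weil 𝔤) : Module.End ℂ (Model 𝔤 R) :=
  LinearMap.mulLeft ℂ ((1 : ℂ) ⊗ₜ[ℝ] (w ᵍ⊗ₜ[ℝ] (1 : Forms R)))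

variable {n : ℕ} (e : Module.Basis (Fin n) ℝ 𝔤) (ξ : Fin n → Derivation ℝ R R)
  (f : Fin n → Fin n → ℝ)

variable (𝔤) in
/-- `1 ⊗ (ι_i + √-1 ∑ j, f_i^j ι_j)`, where `ι_i` is the contraction with `ξ i`. -/
noncomputable def Model.twistedContract (i : Fin n) : Module.End ℂ (Model 𝔤 R) :=
  Model.oddOp 𝔤 (Forms.contract (ξ i)) +
    ∑ j, (Complex.I * (f i j : ℂ)) • Model.oddOp 𝔤 (Forms.contract (ξ j))

variable (𝔤) in
/-- `1 ⊗ (L_i + √-1 ∑ j, f_i^j L_j)`, where `L_i` is the Lie derivative along `ξ i`. -/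
noncomputable def Model.twistedLie (i : Fin n) : Module.End ℂ (Model 𝔤 R) :=
  Model.evenOp 𝔤 (Forms.lieDerivative (ξ i)) +
    ∑ j, (Complex.I * (f i j : ℂ)) • Model.evenOp 𝔤 (Forms.lieDerivative (ξ j))

variable (R) in
/-- The Weil-model differential `D = d_W ⊗ 1 + 1 ⊗ d`. -/
noncomputable def Model.D [Bracket 𝔤 𝔤] : Module.End ℂ (Model 𝔤 R) :=
  Model.tensorOp (Weil.d e) LinearMap.id + Model.oddOp 𝔤 Forms.d

open Model in
/-- The twisted BRST operator: with `I_i = ι_i + √-1 f_i^j ι_j` and `𝓛_i = L_i + √-1 f_i^j L_j`,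
`δ = d_W ⊗ 1 + 1 ⊗ d + ∑ i, θ^i ⊗ 𝓛_i - ∑ a, φ^a ⊗ I_a + 1/2 ∑ i j k, c^i_{jk} θ^j θ^k ⊗ I_i
  - ∑ j < k, θ^j θ^k ⊗ (𝓛_j I_k - I_k 𝓛_j)`. -/
noncomputable def Model.brst [Bracket 𝔤 𝔤] : Module.End ℂ (Model 𝔤 R) :=
  tensorOp (Weil.d e) LinearMap.id + oddOp 𝔤 Forms.d +
    ∑ i, leftMul (Weil.θ e i) * twistedLie 𝔤 ξ f i -
    ∑ a, leftMul (Weil.φ e a) * twistedContract 𝔤 ξ f a +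
    (2⁻¹ : ℂ) • ∑ i, ∑ j, ∑ k, (structureConstant e i j k : ℂ) •
      (leftMul (Weil.θ e j * Weil.θ e k) * twistedContract 𝔤 ξ f i) -
    ∑ j, ∑ k ∈ Finset.Ioi j, leftMul (Weil.θ e j * Weil.θ e k) *
      (twistedLie 𝔤 ξ f j * twistedContract 𝔤 ξ f k -
        twistedContract 𝔤 ξ f k * twistedLie 𝔤 ξ f j)

/-- `θ^i ⊗ (ι_i + √-1 f_i^j ι_j)` (no summation over `i`). -/
noncomputable def Model.psiTerm (i : Fin n) : Module.End ℂ (Model 𝔤 R) :=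
  Model.leftMul (Weil.θ e i) * Model.twistedContract 𝔤 ξ f i

/-- `ψ = ∏ i, (1 - θ^i ⊗ (ι_i + √-1 f_i^j ι_j))`, the factors in the order `1, …, n`. -/
noncomputable def Model.psi : Module.End ℂ (Model 𝔤 R) :=
  (List.ofFn fun i => 1 - Model.psiTerm e ξ f i).prod

/-- `d` makes `A`, graded by `𝒢`, a differential graded algebra: `d` has degree 1, is an
antiderivation, and squares to zero. -/
structure IsDifferentialGradedAlgebra {A : Type*} [Ring A] [Algebra ℂ A]
    (𝒢 : ℕ → Submodule ℂ A) (d : Module.End ℂ A) : Prop where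
  map_degree : ∀ m, ∀ a ∈ 𝒢 m, d a ∈ 𝒢 (m + 1)
  leibniz : ∀ m, ∀ a ∈ 𝒢 m, ∀ b, d (a * b) = d a * b + (-1 : ℂ) ^ m • (a * d b)
  sq_eq_zero : ∀ a, d (d a) = 0

end Model

end BRST

open BRST

/-! Write t_i for left multiplication by θ^i, Θ_i for left multiplication by d_W θ^i, A_i and B_i
for 1 ⊗ I_i and 1 ⊗ Λ_i, and K = ∑ t_i A_i. Two facts carry the theorem: δ = e^K D e^{-K}, and
e^{-K} is multiplicative.

Conjugation. One has e^K D e^{-K} = e^{ad K} D. As d_W is an antiderivation and 1 ⊗ d is odd, D t_i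
+ t_i D = Θ_i; by Cartan's formula D A_i + A_i D = B_i. Hence [K, D] = ∑ (t_i B_i - Θ_i A_i). These
are the terms of δ with one twisted operator, since the φ-terms and the structure-constant terms add
up to -d_W θ^i ⊗ I_i (`Model.brst_eq`). From [L_X, ι_Y] = ι_[X,Y], the commutator [B_j, A_k] is a
combination of contractions and is skew in j, k, so [K, [K, D]] = -∑ t_j t_k [B_j, A_k], which is -2
times the sum over j < k. Contractions anticommute with every t_i and A_i, so the next commutator
vanishes, and the series ends with D + [K, D] + 1/2 [K, [K, D]] = δ. The argument takes place in an
abstract ring: `exp_mul_eq_mul_exp`, `exp_neg_mul_eq_mul_exp_neg`.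

Multiplicativity. I_i is an antiderivation and θ^i is odd, so T_i = t_i A_i is an ordinary
derivation, and T_i(a) T_i(b) = 0 because θ^i θ^i = 0. Therefore 1 - T_i respects products
(`prod_one_sub_apply_mul`). The T_i commute and square to zero, so their product is e^{-K}, with
inverse ∏ (1 + T_i). Each T_i preserves degree, as θ^i adds one and a contraction removes one.

It remains to see that D makes a differential graded algebra; the structure for δ is then
transported along ψ. For d_W, the square vanishes on generators by the Jacobi identity (`Weil.d_d`).
For forms, the product rules for contraction and Lie derivative come from writing the wedge as a sum
over all permutations. The rules for d follow by induction on the degree: a form of positive degree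
is determined by its contractions, and Cartan's formula turns a contracted identity into one of
lower degree. -/

namespace BRST

/-! ### Wedge products as sums over all permutations, and contraction. -/

section WedgeExpansion

/-- A permutation σ is determined by i = σ⁻¹(0) and by what it does to the remaining positions:
`i.cycleRange` moves i to 0, and `decomposeFin.symm (0, τ)` fixes 0 and acts as τ on the rest. -/
theorem sum_perm_fin_succ {N : ℕ} {A : Type*} [AddCommMonoid A] (F : Equiv.Perm (Fin (N + 1)) → A) :
    ∑ σ, F σ = ∑ i : Fin (N + 1), ∑ τ : Equiv.Perm (Fin N),
      F (Equiv.Perm.decomposeFin.symm (0, τ) * i.cycleRange) := by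
  rw [← Fintype.sum_prod_type']
  symm
  refine Fintype.sum_bijective
    (fun x : Fin (N + 1) × Equiv.Perm (Fin N) =>
      Equiv.Perm.decomposeFin.symm (0, x.2) * x.1.cycleRange) ?_ _ _ (fun _ => rfl)
  rw [Fintype.bijective_iff_injective_and_card]
  constructor
  · rintro ⟨i, τ⟩ ⟨j, τ'⟩ h
    have hi : ∀ (i : Fin (N + 1)) (τ : Equiv.Perm (Fin N)),
        (Equiv.Perm.decomposeFin.symm (0, τ) * i.cycleRange).symm 0 = i := by
      intro i τ
      rw [Equiv.symm_apply_eq]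
      simp
    have hij : i = j := by
      rw [← hi i τ, ← hi j τ']
      exact congrArg (fun σ : Equiv.Perm (Fin (N + 1)) => σ.symm 0) h
    subst hij
    have := mul_right_cancel h
    simpa using this
  · simp [Fintype.card_perm, Nat.factorial_succ]

/-- Groups the permuted tuples by the slot i in which X lands; the cycle bringing i to the front
accounts for the sign (-1)^i. -/
theorem sum_sign_perm_vecCons {N : ℕ} {V A : Type*} [AddCommGroup A] (F : (Fin (N + 1) → V) → A)
    (X : V) (w : Fin N → V) :
    ∑ σ : Equiv.Perm (Fin (N + 1)), Equiv.Perm.sign σ • F (Matrix.vecCons X w ∘ σ) =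
      ∑ i : Fin (N + 1), ∑ τ : Equiv.Perm (Fin N),
        (-1 : ℤˣ) ^ (i : ℕ) • Equiv.Perm.sign τ • F (i.insertNth X (w ∘ τ)) := by
  rw [sum_perm_fin_succ]
  refine Finset.sum_congr rfl fun i _ => Finset.sum_congr rfl fun τ _ => ?_
  have h : Matrix.vecCons X w ∘ (Equiv.Perm.decomposeFin.symm (0, τ) * i.cycleRange) =
      i.insertNth X (w ∘ τ) := by
    rw [← Fin.cons_comp_cycleRange, Equiv.Perm.coe_mul, ← Function.comp_assoc]
    congr 1
    funext j
    refine Fin.cases ?_ (fun j => ?_) j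
    · simp
    · simp
  rw [h, smul_smul, Equiv.Perm.sign_mul, Fin.sign_cycleRange, Equiv.Perm.decomposeFin.symm_sign]
  simp [mul_comm]

variable {R V : Type*} [CommRing R] [AddCommGroup V] [Module R V]

/-- Each shuffle stands for p! q! permutations with equal contributions, so multiplying by that
factor replaces shuffles by permutations. Over a real algebra the factor can be cancelled
afterwards. The free `N` absorbs casts between equal degrees. -/
theorem factorial_smul_wedge {p q N : ℕ} (h : p + q = N) (a : V [⋀^Fin p]→ₗ[R] R)
    (b : V [⋀^Fin q]→ₗ[R] R) (v : Fin N → V) :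
    (p.factorial * q.factorial) • wedge a b (v ∘ Fin.cast h) =
      ∑ σ : Equiv.Perm (Fin N), Equiv.Perm.sign σ •
        (a (fun i => v (σ (Fin.cast h (Fin.castAdd q i)))) *
          b (fun i => v (σ (Fin.cast h (Fin.natAdd p i))))) := by
  subst h
  have key := factorial_smul_wedgeSum a b
  simp only [Fintype.card_fin] at key
  have h1 : (p.factorial * q.factorial) • wedge a b =
      ((p.factorial * q.factorial) • wedgeSum a b).domDomCongr finSumFinEquiv := by
    ext v; simp [wedge]
  have h2 := congrArg (fun f => f v) h1
  simp only [AlternatingMap.smul_apply] at h2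
  change (p.factorial * q.factorial) • wedge a b v = _
  rw [h2, key, ← alt_domDomCongr, MultilinearMap.alternatization_apply]
  refine Finset.sum_congr rfl fun σ _ => ?_
  simp [mulM_apply]

/-- This lemma and the next three read an inserted tuple block by block: an insertion changes only
the block containing the slot, except that a second block lying after it is shifted by one. -/
theorem insertNth_castAdd {V : Type*} {p q : ℕ} (i : Fin (p + 1)) (X : V)
    (u : Fin (p + 1 + q) → V) (j : Fin (p + 1)) :
    (Fin.castAdd (q + 1) i : Fin (p + 1 + q + 1)).insertNth (α := fun _ => V) X u
        (Fin.castAdd (q + 1) j) =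
      i.insertNth (α := fun _ => V) X (fun j : Fin p => u ⟨j, by omega⟩) j := by
  refine Fin.succAboveCases i ?_ (fun k => ?_) j
  · rw [Fin.insertNth_apply_same]
    exact (Fin.insertNth_apply_same (α := fun _ => V) i X _).symm
  · rw [Fin.insertNth_apply_succAbove]
    have : (Fin.castAdd (q + 1) (i.succAbove k) : Fin (p + 1 + q + 1)) =
        (Fin.castAdd (q + 1) i : Fin (p + 1 + q + 1)).succAbove
          (⟨k, by omega⟩ : Fin (p + 1 + q)) := by
      apply Fin.ext
      simp only [Fin.succAbove, Fin.lt_def, Fin.val_castAdd, Fin.val_castSucc]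
      split_ifs <;> simp
    rw [this, Fin.insertNth_apply_succAbove]

theorem insertNth_natAdd {V : Type*} {p q : ℕ} (i : Fin (q + 1)) (X : V)
    (u : Fin (p + q) → V) (j : Fin (q + 1)) :
    (Fin.natAdd p i : Fin (p + q + 1)).insertNth (α := fun _ => V) X u (Fin.natAdd p j) =
      i.insertNth (α := fun _ => V) X (fun j : Fin q => u (Fin.natAdd p j)) j := by
  refine Fin.succAboveCases i ?_ (fun k => ?_) j
  · rw [Fin.insertNth_apply_same]
    exact (Fin.insertNth_apply_same (α := fun _ => V) i X _).symm
  · rw [Fin.insertNth_apply_succAbove]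
    have : (Fin.natAdd p (i.succAbove k) : Fin (p + q + 1)) =
        (Fin.natAdd p i : Fin (p + q + 1)).succAbove (Fin.natAdd p k) := by
      apply Fin.ext
      simp only [Fin.succAbove, Fin.lt_def, Fin.val_natAdd, Fin.val_castSucc]
      split_ifs <;> simp at * <;> omega
    rw [this, Fin.insertNth_apply_succAbove]

theorem insertNth_castAdd_natAdd {V : Type*} {p q : ℕ} (i : Fin (p + 1)) (X : V)
    (u : Fin (p + 1 + q) → V) (j : Fin (q + 1)) :
    (Fin.castAdd (q + 1) i : Fin (p + 1 + q + 1)).insertNth (α := fun _ => V) X u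
        (Fin.natAdd (p + 1) j) = u ⟨p + j, by omega⟩ := by
  have : (Fin.natAdd (p + 1) j : Fin (p + 1 + q + 1)) =
      (Fin.castAdd (q + 1) i : Fin (p + 1 + q + 1)).succAbove
        (⟨p + j, by omega⟩ : Fin (p + 1 + q)) := by
    apply Fin.ext
    simp only [Fin.succAbove, Fin.lt_def, Fin.val_castAdd, Fin.val_castSucc]
    split_ifs <;> simp at * <;> omega
  rw [this, Fin.insertNth_apply_succAbove]

theorem insertNth_natAdd_castAdd {V : Type*} {p q : ℕ} (i : Fin (q + 1)) (X : V)
    (u : Fin (p + q) → V) (j : Fin p) :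
    (Fin.natAdd p i : Fin (p + q + 1)).insertNth (α := fun _ => V) X u
        (Fin.castAdd (q + 1) j) = u (Fin.castAdd q j) := by
  have : (Fin.castAdd (q + 1) j : Fin (p + q + 1)) =
      (Fin.natAdd p i : Fin (p + q + 1)).succAbove (Fin.castAdd q j) := by
    apply Fin.ext
    simp only [Fin.succAbove, Fin.lt_def, Fin.val_natAdd, Fin.val_castSucc]
    split_ifs <;> simp at * <;> omega
  rw [this, Fin.insertNth_apply_succAbove]

/-- Contraction is an antiderivation of the wedge product. -/
theorem curryLeft_wedge [Algebra ℝ R] {p q : ℕ} (a : V [⋀^Fin (p + 1)]→ₗ[R] R)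
    (b : V [⋀^Fin (q + 1)]→ₗ[R] R) (X : V) (w : Fin (p + 1 + q) → V) :
    wedge a b (Matrix.vecCons X w : Fin (p + 1 + q + 1) → V) =
      wedge (a.curryLeft X) b (w ∘ Fin.cast (by omega : p + (q + 1) = p + 1 + q)) +
        (-1) ^ (p + 1) * wedge a (b.curryLeft X) w := by
  have key := factorial_smul_wedge rfl a b (Matrix.vecCons X w : Fin (p + 1 + q + 1) → V)
  have hc : (Matrix.vecCons X w : Fin (p + 1 + q + 1) → V) ∘ Fin.cast rfl =
    (Matrix.vecCons X w : Fin (p + 1 + q + 1) → V) := rfl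
  have h1 := factorial_smul_wedge (by omega : p + (q + 1) = p + 1 + q) (a.curryLeft X) b w
  have h2 := factorial_smul_wedge rfl a (b.curryLeft X) w
  rw [hc] at key
  -- Each of the p + 1 slots of `a` that X may occupy contributes the same sum, and likewise each of
  -- the q + 1 slots of `b`, with the extra sign (-1)^(p+1). The multiplicities turn p! (q+1)! and
  -- (p+1)! q! into the common factor (p+1)! (q+1)!.
  have hsum : ∑ σ : Equiv.Perm (Fin (p + 1 + q + 1)), Equiv.Perm.sign σ •
        (a (fun i => (Matrix.vecCons X w : Fin (p + 1 + q + 1) → V)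
          (σ (Fin.cast rfl (Fin.castAdd (q + 1) i)))) *
          b (fun i => (Matrix.vecCons X w : Fin (p + 1 + q + 1) → V)
            (σ (Fin.cast rfl (Fin.natAdd (p + 1) i))))) =
      (p + 1) • ∑ τ : Equiv.Perm (Fin (p + 1 + q)), Equiv.Perm.sign τ •
        (a.curryLeft X (fun i => w (τ (Fin.cast (by omega : p + (q + 1) = p + 1 + q)
          (Fin.castAdd (q + 1) i)))) *
          b (fun i => w (τ (Fin.cast (by omega : p + (q + 1) = p + 1 + q)
            (Fin.natAdd p i))))) +
      (q + 1) • ((-1) ^ (p + 1) * ∑ τ : Equiv.Perm (Fin (p + 1 + q)), Equiv.Perm.sign τ •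
        (a (fun i => w (τ (Fin.cast rfl (Fin.castAdd q i)))) *
          b.curryLeft X (fun i => w (τ (Fin.cast rfl (Fin.natAdd (p + 1) i)))))) := by
    refine (sum_sign_perm_vecCons (fun v : Fin (p + 1 + q + 1) → V =>
      a (fun i => v (Fin.castAdd (q + 1) i)) * b (fun i => v (Fin.natAdd (p + 1) i))) X w).trans ?_
    refine (Fin.sum_univ_add (a := p + 1) (b := q + 1) _).trans ?_
    congr 1
    · rw [Finset.sum_congr rfl (fun i _ => ?_), Finset.sum_const, Finset.card_univ,
        Fintype.card_fin]
      refine Finset.sum_congr rfl fun τ _ => ?_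
      simp only [insertNth_castAdd, insertNth_castAdd_natAdd]
      rw [AlternatingMap.map_insertNth]
      simp only [Units.smul_def, Fin.val_castAdd, AlternatingMap.curryLeft_apply_apply,
        zsmul_eq_mul]
      push_cast
      have hs : ((-1 : R) ^ (i : ℕ)) * (-1) ^ (i : ℕ) = 1 := by
        rw [← mul_pow]; simp
      have e1 : (fun j : Fin p => (w ∘ τ) ⟨j, by omega⟩) = fun i => w (τ (Fin.cast
        (by omega : p + (q + 1) = p + 1 + q) (Fin.castAdd (q + 1) i))) := rfl
      have e2 : (fun j : Fin (q + 1) => (w ∘ τ) ⟨p + j, by omega⟩) = fun i => w (τ (Fin.cast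
        (by omega : p + (q + 1) = p + 1 + q) (Fin.natAdd p i))) := rfl
      rw [e1, e2]
      linear_combination ((Equiv.Perm.sign τ : ℤ) : R) * a _ * b _ * hs
    · rw [Finset.sum_congr rfl (fun i _ => ?_), Finset.sum_const, Finset.card_univ,
        Fintype.card_fin, Finset.mul_sum]
      refine Finset.sum_congr rfl fun τ _ => ?_
      have l1 := insertNth_natAdd (p := p + 1) (q := q) i X (w ∘ τ)
      have l2 := insertNth_natAdd_castAdd (p := p + 1) (q := q) i X (w ∘ τ)
      simp only [l1, l2]
      rw [AlternatingMap.map_insertNth]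
      simp only [Units.smul_def, Fin.val_natAdd, AlternatingMap.curryLeft_apply_apply,
        zsmul_eq_mul]
      push_cast
      have hs : ((-1 : R) ^ (i : ℕ)) * (-1) ^ (i : ℕ) = 1 := by
        rw [← mul_pow]; simp
      rw [pow_add]
      simp only [Function.comp_apply, Fin.cast_refl, id]
      linear_combination (-1 : R) ^ (p + 1) * ((Equiv.Perm.sign τ : ℤ) : R) * a _ * b _ * hs
  replace key := key.trans hsum
  rw [← h1, ← h2] at key
  have hw : w ∘ Fin.cast rfl = w := rfl
  rw [hw] at key
  have hn : ((p + 1).factorial * (q + 1).factorial : ℝ) ≠ 0 := by positivity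
  have key2 : ((p + 1).factorial * (q + 1).factorial : ℝ) •
      wedge a b (Matrix.vecCons X w : Fin (p + 1 + q + 1) → V) =
      ((p + 1).factorial * (q + 1).factorial : ℝ) •
      (wedge (a.curryLeft X) b (w ∘ Fin.cast (by omega : p + (q + 1) = p + 1 + q)) +
        (-1) ^ (p + 1) * wedge a (b.curryLeft X) w) := by
    have hN : ∀ x : R, ((p + 1).factorial * (q + 1).factorial : ℝ) • x =
        ((p + 1).factorial * (q + 1).factorial) • x := by
      intro x
      rw [← Nat.cast_smul_eq_nsmul ℝ]
      push_cast
      rfl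
    rw [hN, hN, key]
    simp only [nsmul_eq_mul, Nat.factorial_succ]
    push_cast
    ring
  have := congrArg (fun x => ((p + 1).factorial * (q + 1).factorial : ℝ)⁻¹ • x) key2
  simpa only [smul_smul, inv_mul_cancel₀ hn, one_smul] using this

end WedgeExpansion

/-! ### Cartan calculus on differential forms. -/

section FormCalculus

variable {R : Type*} [CommRing R] [Algebra ℝ R]

theorem Forms.of_domDomCongr {k l : ℕ} (h : k = l) (ζ : AltForm R k) :
    Forms.of l (ζ.domDomCongr (finCongr h)) = Forms.of k ζ := by
  subst h
  rfl

theorem Forms.induction_on {P : Forms R → Prop} (x : Forms R) (zero : P 0)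
    (of : ∀ k a, P (Forms.of k a)) (add : ∀ x y, P x → P y → P (x + y)) : P x :=
  DirectSum.induction_on (motive := P) x zero (fun k a => of k a) add

theorem Forms.of_mem (k : ℕ) (ζ : AltForm R k) : Forms.of k ζ ∈ Forms.grading R k := ⟨ζ, rfl⟩

@[simp] theorem Forms.contract_of_zero (X : Derivation ℝ R R) (ζ : AltForm R 0) :
    Forms.contract X (Forms.of 0 ζ) = 0 := by
  simp [Forms.contract]

@[simp] theorem Forms.contract_of_succ (X : Derivation ℝ R R) {k : ℕ} (ζ : AltForm R (k + 1)) :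
    Forms.contract X (Forms.of (k + 1) ζ) = Forms.of k (ζ.curryLeft X) := by
  simp [Forms.contract]
  rfl

theorem Forms.contract_of_eq_succ (X : Derivation ℝ R R) {k m : ℕ} (h : m = k + 1)
    (ζ : AltForm R m) : Forms.contract X (Forms.of m ζ) =
      Forms.of k ((ζ.domDomCongr (finCongr h)).curryLeft X) := by
  subst h
  exact Forms.contract_of_succ X ζ

@[simp] theorem Forms.lieDerivative_of (X : Derivation ℝ R R) {k : ℕ} (ζ : AltForm R k) :
    Forms.lieDerivative X (Forms.of k ζ) = Forms.of k (lieForm X ζ) := by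
  simp [Forms.lieDerivative]

@[simp] theorem Forms.d_of {k : ℕ} (ζ : AltForm R k) :
    Forms.d (Forms.of k ζ) = Forms.of (k + 1) (extForm ζ) := by
  simp [Forms.d]

theorem extForm_eq_koszulAux {k : ℕ} (ζ : AltForm R k) (v : Fin (k + 1) → Derivation ℝ R R) :
    extForm ζ v = koszulAux ζ v := by
  simp only [koszulAux, AlternatingMap.alternatizeUncurryFin_apply, koszulTerm_apply, extForm_apply]

theorem Forms.of_injective (k : ℕ) : Function.Injective (Forms.of (R := R) k) :=
  DirectSum.of_injective (β := AltForm R) k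

theorem Forms.contract_mem (X : Derivation ℝ R R) {k : ℕ} {x : Forms R}
    (hx : x ∈ Forms.grading R (k + 1)) : Forms.contract X x ∈ Forms.grading R k := by
  obtain ⟨ζ, rfl⟩ := hx
  rw [Forms.contract_of_succ]
  exact Forms.of_mem _ _

theorem Forms.contract_eq_zero (X : Derivation ℝ R R) {x : Forms R}
    (hx : x ∈ Forms.grading R 0) : Forms.contract X x = 0 := by
  obtain ⟨ζ, rfl⟩ := hx
  exact Forms.contract_of_zero X ζ

theorem Forms.lieDerivative_mem (X : Derivation ℝ R R) {k : ℕ} {x : Forms R}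
    (hx : x ∈ Forms.grading R k) : Forms.lieDerivative X x ∈ Forms.grading R k := by
  obtain ⟨ζ, rfl⟩ := hx
  rw [Forms.lieDerivative_of]
  exact Forms.of_mem _ _

theorem Forms.d_mem {k : ℕ} {x : Forms R}
    (hx : x ∈ Forms.grading R k) : Forms.d x ∈ Forms.grading R (k + 1) := by
  obtain ⟨ζ, rfl⟩ := hx
  rw [Forms.d_of]
  exact Forms.of_mem _ _

/-- A form of positive degree with vanishing contractions vanishes. -/
theorem Forms.eq_zero_of_contract {k : ℕ} {x : Forms R} (hx : x ∈ Forms.grading R (k + 1))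
    (h : ∀ X, Forms.contract X x = 0) : x = 0 := by
  obtain ⟨ζ, rfl⟩ := hx
  have : ζ = 0 := by
    ext v
    have h1 := h (v 0)
    rw [Forms.contract_of_succ, ← map_zero (Forms.of (R := R) k)] at h1
    have h2 := congrArg (fun f => f (Fin.tail v)) (Forms.of_injective k h1)
    simpa [Matrix.vecCons] using h2
  rw [this, map_zero]

/-- The parity involution of the algebra of forms. -/
noncomputable def Forms.parity : Module.End ℝ (Forms R) :=
  Forms.lift fun k => (-1 : ℝ) ^ k • Forms.of k

theorem Forms.parity_of_mem {k : ℕ} {x : Forms R} (hx : x ∈ Forms.grading R k) :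
    Forms.parity x = (-1 : ℝ) ^ k • x := by
  obtain ⟨ζ, rfl⟩ := hx
  simp [Forms.parity]

theorem AltForm.eq_const (a : AltForm R 0) :
    a = AlternatingMap.constOfIsEmpty R _ (Fin 0) (a ![]) := by
  ext v
  rw [AlternatingMap.constOfIsEmpty_apply]
  exact congrArg a (Subsingleton.elim _ _)

theorem Forms.of_zero_mul_of {q : ℕ} (a : AltForm R 0) (b : AltForm R q) :
    Forms.of 0 a * Forms.of q b = Forms.of q (a ![] • b) := by
  rw [Forms.of_mul_of, ← wedge_const_left, Forms.of_domDomCongr, ← AltForm.eq_const]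

theorem Forms.of_mul_of_zero {q : ℕ} (a : AltForm R 0) (b : AltForm R q) :
    Forms.of q b * Forms.of 0 a = Forms.of q (a ![] • b) := by
  rw [Forms.of_mul_of, ← wedge_const_right, Forms.of_domDomCongr, ← AltForm.eq_const]

theorem Forms.contract_of_mul_of (X : Derivation ℝ R R) {p q : ℕ} (a : AltForm R p)
    (b : AltForm R q) :
    Forms.contract X (Forms.of p a * Forms.of q b) =
      Forms.contract X (Forms.of p a) * Forms.of q b +
        (-1 : ℝ) ^ p • (Forms.of p a * Forms.contract X (Forms.of q b)) := by
  rcases p with _ | p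
  · rw [Forms.of_zero_mul_of]
    rcases q with _ | q
    · simp
    · simp only [Forms.contract_of_succ, Forms.contract_of_zero, zero_mul, zero_add, pow_zero,
        one_smul, Forms.of_zero_mul_of]
      rfl
  · rcases q with _ | q
    · rw [Forms.of_mul_of_zero]
      simp only [Forms.contract_of_succ, Forms.contract_of_zero, mul_zero, smul_zero, add_zero,
        Forms.of_mul_of_zero]
      rfl
    · rw [Forms.of_mul_of]
      rw [Forms.contract_of_eq_succ X (by omega : p + 1 + (q + 1) = p + 1 + q + 1), Forms.contract_of_succ, Forms.contract_of_succ, Forms.of_mul_of, Forms.of_mul_of,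
        ← Forms.of_domDomCongr (by omega : p + (q + 1) = p + 1 + q), ← map_smul, ← map_add]
      congr 1
      ext w
      refine (curryLeft_wedge a b X w).trans ?_
      simp only [AlternatingMap.add_apply, AlternatingMap.domDomCongr_apply,
        AlternatingMap.smul_apply, Algebra.smul_def, map_pow, map_neg, map_one]
      rfl

/-- Contraction is an antiderivation. -/
theorem Forms.contract_mul (X : Derivation ℝ R R) {p : ℕ} {x : Forms R}
    (hx : x ∈ Forms.grading R p) (y : Forms R) :
    Forms.contract X (x * y) =
      Forms.contract X x * y + (-1 : ℝ) ^ p • (x * Forms.contract X y) := by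
  obtain ⟨a, rfl⟩ := hx
  induction y using Forms.induction_on with
  | zero => simp
  | of q b => exact Forms.contract_of_mul_of X a b
  | add y z hy hz => rw [mul_add, map_add, hy, hz, map_add, mul_add, mul_add, smul_add]; abel

/-- In the sum over all permutations the identity holds term by term: X acts on a product of two
values by the Leibniz rule, and the bracket terms fall into those in the slots of `a` and those in
the slots of `b`. -/
theorem lieForm_wedge (X : Derivation ℝ R R) {p q : ℕ} (a : AltForm R p) (b : AltForm R q) :
    lieForm X (wedge a b) = wedge (lieForm X a) b + wedge a (lieForm X b) := by
  ext v
  have hS : ∀ v, (p.factorial * q.factorial) • wedge a b v = _ := fun v =>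
    factorial_smul_wedge rfl a b v
  have h1 := factorial_smul_wedge rfl (lieForm X a) b v
  have h2 := factorial_smul_wedge rfl a (lieForm X b) v
  have hn : ((p.factorial * q.factorial : ℕ) : ℝ) ≠ 0 := by positivity
  have key : (p.factorial * q.factorial) • lieForm X (wedge a b) v =
      (p.factorial * q.factorial) • (wedge (lieForm X a) b + wedge a (lieForm X b)) v := by
    rw [lieForm_apply, smul_sub, Finset.smul_sum, ← map_nsmul, hS]
    simp only [hS]
    rw [AlternatingMap.add_apply, smul_add]
    refine Eq.trans ?_ (congrArg₂ (· + ·) h1 h2).symm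
    rw [Finset.sum_comm, map_sum, ← Finset.sum_sub_distrib, ← Finset.sum_add_distrib]
    refine Finset.sum_congr rfl fun σ _ => ?_
    simp only [Fin.cast_refl, id, Units.smul_def]
    rw [map_zsmul, ← Finset.smul_sum, ← smul_sub, ← smul_add]
    congr 1
    -- Naming the bracketed slot σ j instead of j makes it visible which factor it belongs to: the
    -- first p values of j touch only `a`, the others only `b`.
    rw [← Equiv.sum_comp σ, Fin.sum_univ_add]
    have e0 : ∀ (j i : Fin (p + q)) (z : Derivation ℝ R R),
        Function.update v (σ j) z (σ i) = Function.update (v ∘ σ) j z i := by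
      intro j i z
      rcases eq_or_ne i j with rfl | h
      · simp
      · simp [h]
    have e1 : ∀ (j : Fin p) (z : Derivation ℝ R R),
        (fun i => Function.update v (σ (Fin.castAdd q j)) z (σ (Fin.castAdd q i))) =
        Function.update (fun i => v (σ (Fin.castAdd q i))) j z := by
      intro j z
      funext i
      rw [e0]
      rcases eq_or_ne i j with rfl | h
      · simp
      · simp [h]
    have e2 : ∀ (j : Fin p) (z : Derivation ℝ R R),
        (fun i => Function.update v (σ (Fin.castAdd q j)) z (σ (Fin.natAdd p i))) =
        (fun i => v (σ (Fin.natAdd p i))) := by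
      intro j z
      funext i
      rw [e0, Function.update_of_ne]
      · rfl
      · intro h
        have := congrArg Fin.val h
        simp at this
        omega
    have e3 : ∀ (j : Fin q) (z : Derivation ℝ R R),
        (fun i => Function.update v (σ (Fin.natAdd p j)) z (σ (Fin.natAdd p i))) =
        Function.update (fun i => v (σ (Fin.natAdd p i))) j z := by
      intro j z
      funext i
      rw [e0]
      rcases eq_or_ne i j with rfl | h
      · simp
      · simp [h]
    have e4 : ∀ (j : Fin q) (z : Derivation ℝ R R),
        (fun i => Function.update v (σ (Fin.natAdd p j)) z (σ (Fin.castAdd q i))) =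
        (fun i => v (σ (Fin.castAdd q i))) := by
      intro j z
      funext i
      rw [e0, Function.update_of_ne]
      · rfl
      · intro h
        have := congrArg Fin.val h
        simp at this
        omega
    simp only [e1, e2, e3, e4, lieForm_apply, Derivation.leibniz, smul_eq_mul,
      ← Finset.sum_mul, ← Finset.mul_sum]
    ring
  rw [← Nat.cast_smul_eq_nsmul ℝ, ← Nat.cast_smul_eq_nsmul ℝ] at key
  simpa only [smul_smul, inv_mul_cancel₀ hn, one_smul] using
    congrArg (fun x => ((p.factorial * q.factorial : ℕ) : ℝ)⁻¹ • x) key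

/-- The Lie derivative is a derivation. -/
theorem Forms.lieDerivative_mul (X : Derivation ℝ R R) (x y : Forms R) :
    Forms.lieDerivative X (x * y) =
      Forms.lieDerivative X x * y + x * Forms.lieDerivative X y := by
  induction x using Forms.induction_on with
  | zero => simp
  | add x z hx hz => simp only [add_mul, map_add, hx, hz]; abel
  | of p a =>
    induction y using Forms.induction_on with
    | zero => simp
    | add y z hy hz => simp only [mul_add, map_add, hy, hz]; abel
    | of q b =>
      simp only [Forms.of_mul_of, Forms.lieDerivative_of, lieForm_wedge, map_add]

/-- Cartan's formula. -/
theorem Forms.contract_d (X : Derivation ℝ R R) (x : Forms R) :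
    Forms.contract X (Forms.d x) = Forms.lieDerivative X x - Forms.d (Forms.contract X x) := by
  induction x using Forms.induction_on with
  | zero => simp
  | add x z hx hz => simp only [map_add, hx, hz]; abel
  | of k ζ =>
    rw [Forms.d_of, Forms.contract_of_succ, Forms.lieDerivative_of]
    rcases k with _ | k
    · rw [Forms.contract_of_zero, map_zero, sub_zero]
      congr 1
      ext v
      rw [AlternatingMap.curryLeft_apply_apply, extForm_eq_koszulAux, koszulAux_zero]
      rw [lieForm_apply, Fin.sum_univ_zero, sub_zero, Subsingleton.elim v ![]]
      rfl
    · rw [Forms.contract_of_succ, Forms.d_of, ← map_sub]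
      congr 1
      ext w
      rw [AlternatingMap.curryLeft_apply_apply, AlternatingMap.sub_apply, extForm_eq_koszulAux,
        extForm_eq_koszulAux]
      exact koszulAux_cons ζ X w

/-- The correction ι_[X,Y] is the bracket term of L_X in slot 0, where Y has been inserted; the
other slots reproduce L_X of the contracted form. -/
theorem Forms.contract_lieDerivative (X Y : Derivation ℝ R R) (x : Forms R) :
    Forms.contract Y (Forms.lieDerivative X x) =
      Forms.lieDerivative X (Forms.contract Y x) - Forms.contract ⁅X, Y⁆ x := by
  induction x using Forms.induction_on with
  | zero => simp
  | add x z hx hz => simp only [map_add, hx, hz]; abel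
  | of k ζ =>
    rw [Forms.lieDerivative_of]
    rcases k with _ | k
    · simp
    · rw [Forms.contract_of_succ, Forms.contract_of_succ, Forms.lieDerivative_of,
        Forms.contract_of_succ, ← map_sub]
      congr 1
      ext u
      have h0 : ∀ Z : Derivation ℝ R R, Function.update (Matrix.vecCons Y u) 0 Z =
        Matrix.vecCons Z u := fun Z => Fin.update_cons_zero _ _ _
      have h1 : ∀ (i : Fin k) (Z : Derivation ℝ R R),
        Function.update (Matrix.vecCons Y u) i.succ Z =
          Matrix.vecCons Y (Function.update u i Z) := fun i Z => (Fin.cons_update _ _ _ _).symm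
      simp only [lieForm_apply, Fin.sum_univ_succ, h0, h1, Matrix.cons_val_zero,
        Matrix.cons_val_succ, AlternatingMap.curryLeft_apply_apply, AlternatingMap.sub_apply]
      ring

theorem Forms.contract_contract (X Y : Derivation ℝ R R) (x : Forms R) :
    Forms.contract X (Forms.contract Y x) = - Forms.contract Y (Forms.contract X x) := by
  induction x using Forms.induction_on with
  | zero => simp
  | add x z hx hz => simp only [map_add, hx, hz]; abel
  | of k ζ =>
    rcases k with _ | _ | k
    · simp
    · simp
    · rw [Forms.contract_of_succ, Forms.contract_of_succ, Forms.contract_of_succ,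
        Forms.contract_of_succ, ← map_neg (Forms.of k)]
      congr 1
      ext u
      have h : Matrix.vecCons Y (Matrix.vecCons X u) =
          Matrix.vecCons X (Matrix.vecCons Y u) ∘ Equiv.swap (0 : Fin (k + 2)) 1 := by
        funext i
        refine Fin.cases ?_ (fun i => Fin.cases ?_ (fun i => ?_) i) i
        · simp
        · simp
        · rw [Function.comp_apply, Equiv.swap_apply_of_ne_of_ne (by simp [Fin.ext_iff])
            (by simp [Fin.ext_iff])]
          rfl
      simp only [AlternatingMap.neg_apply, AlternatingMap.curryLeft_apply_apply]
      rw [h, AlternatingMap.map_swap _ _ (by simp)]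

/-- The exterior derivative is an antiderivation, on homogeneous forms. -/
theorem Forms.d_mul_of_mem (N : ℕ) : ∀ {p q : ℕ}, p + q = N → ∀ {x y : Forms R},
    x ∈ Forms.grading R p → y ∈ Forms.grading R q →
    Forms.d (x * y) = Forms.d x * y + (-1 : ℝ) ^ p • (x * Forms.d y) := by
  -- Induction on the total degree. After contraction, Cartan's formula leaves the product rule for
  -- ι_X x · y and x · ι_X y, whose total degree is N - 1.
  induction N using Nat.strong_induction_on with
  | _ N ih =>
  intro p q hN x y hx hy
  rw [← sub_eq_zero]
  refine Forms.eq_zero_of_contract (k := N) ?_ fun X => ?_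
  · refine sub_mem (Forms.d_mem (hN ▸ SetLike.mul_mem_graded hx hy)) (add_mem ?_ ?_)
    · have := SetLike.mul_mem_graded (Forms.d_mem hx) hy
      rwa [show p + 1 + q = N + 1 by omega] at this
    · have := SetLike.mul_mem_graded hx (Forms.d_mem hy)
      rw [show p + (q + 1) = N + 1 by omega] at this
      exact Submodule.smul_mem _ _ this
  -- The sign is -(-1)^p because ι_X x has degree p - 1; for p = 0 both sides vanish.
  have h1 : Forms.d (Forms.contract X x * y) = Forms.d (Forms.contract X x) * y -
      (-1 : ℝ) ^ p • (Forms.contract X x * Forms.d y) := by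
    rcases p with _ | p
    · simp [Forms.contract_eq_zero X hx]
    · rw [ih (p + q) (by omega) rfl (Forms.contract_mem X hx) hy, pow_succ]
      simp
  have h2 : Forms.d (x * Forms.contract X y) = Forms.d x * Forms.contract X y +
      (-1 : ℝ) ^ p • (x * Forms.d (Forms.contract X y)) := by
    rcases q with _ | q
    · simp [Forms.contract_eq_zero X hy]
    · exact ih (p + q) (by omega) rfl hx (Forms.contract_mem X hy)
  have hs : (-1 : ℝ) ^ p * (-1 : ℝ) ^ p = 1 := by rw [← mul_pow]; simp
  rw [map_sub, Forms.contract_d, Forms.lieDerivative_mul, Forms.contract_mul X hx, map_add,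
    map_add, map_smul, map_smul, h1, h2, Forms.contract_mul X (Forms.d_mem hx),
    Forms.contract_mul X hx, Forms.contract_d, Forms.contract_d]
  simp only [mul_sub, sub_mul, smul_sub, smul_add, smul_smul, hs, pow_succ, mul_neg, mul_one,
    neg_smul, one_smul]
  abel

/-- The exterior derivative is an antiderivation. -/
theorem Forms.d_mul {p : ℕ} {x : Forms R} (hx : x ∈ Forms.grading R p) (y : Forms R) :
    Forms.d (x * y) = Forms.d x * y + (-1 : ℝ) ^ p • (x * Forms.d y) := by
  induction y using Forms.induction_on with
  | zero => simp
  | of q b => exact Forms.d_mul_of_mem _ rfl hx (Forms.of_mem q b)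
  | add y z hy hz => rw [mul_add, map_add, hy, hz, map_add, mul_add, mul_add, smul_add]; abel

/-- On functions this is the definition of the bracket of derivations. In higher degree, contracting
with Z reduces it to the same identity for ι_Z x together with the Jacobi identity for X, Y, Z. -/
theorem Forms.lieDerivative_lieDerivative_of_mem (X Y : Derivation ℝ R R) (k : ℕ) :
    ∀ x ∈ Forms.grading R k, Forms.lieDerivative X (Forms.lieDerivative Y x) =
      Forms.lieDerivative Y (Forms.lieDerivative X x) + Forms.lieDerivative ⁅X, Y⁆ x := by
  induction k with
  | zero =>
    rintro _ ⟨ζ, rfl⟩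
    simp only [Forms.lieDerivative_of, ← map_add]
    congr 1
    ext v
    simp [lieForm_apply, Derivation.commutator_apply]
  | succ k ih =>
    intro x hx
    rw [← sub_eq_zero]
    refine Forms.eq_zero_of_contract (k := k) ?_ fun Z => ?_
    · exact sub_mem (Forms.lieDerivative_mem X (Forms.lieDerivative_mem Y hx))
        (add_mem (Forms.lieDerivative_mem Y (Forms.lieDerivative_mem X hx))
          (Forms.lieDerivative_mem _ hx))
    · have hJ : ⁅⁅X, Y⁆, Z⁆ = ⁅X, ⁅Y, Z⁆⁆ - ⁅Y, ⁅X, Z⁆⁆ := lie_lie X Y Z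
      have hc : ∀ A B : Derivation ℝ R R, Forms.contract (A - B) x =
          Forms.contract A x - Forms.contract B x := by
        obtain ⟨ζ, rfl⟩ := hx
        intro A B
        simp only [Forms.contract_of_succ, map_sub]
      simp only [map_sub, map_add, Forms.contract_lieDerivative, hJ, hc,
        ih _ (Forms.contract_mem Z hx)]
      abel

/-- Contracting with Z leaves the commutator formula for L_X and L_Z, and the same claim for ι_Z x,
which is zero when x is a function. -/
theorem Forms.lieDerivative_d_of_mem (X : Derivation ℝ R R) (k : ℕ) :
    ∀ x ∈ Forms.grading R k, Forms.lieDerivative X (Forms.d x) =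
      Forms.d (Forms.lieDerivative X x) := by
  induction k with
  | zero =>
    intro x hx
    rw [← sub_eq_zero]
    refine Forms.eq_zero_of_contract (k := 0) ?_ fun Z => ?_
    · exact sub_mem (Forms.lieDerivative_mem X (Forms.d_mem hx))
        (Forms.d_mem (Forms.lieDerivative_mem X hx))
    · simp only [map_sub, Forms.contract_lieDerivative, Forms.contract_d,
        Forms.contract_eq_zero _ hx, map_zero,
        Forms.lieDerivative_lieDerivative_of_mem X Z 0 x hx]
      abel
  | succ k ih =>
    intro x hx
    rw [← sub_eq_zero]
    refine Forms.eq_zero_of_contract (k := k + 1) ?_ fun Z => ?_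
    · exact sub_mem (Forms.lieDerivative_mem X (Forms.d_mem hx))
        (Forms.d_mem (Forms.lieDerivative_mem X hx))
    · simp only [map_sub, Forms.contract_lieDerivative, Forms.contract_d,
        Forms.lieDerivative_lieDerivative_of_mem X Z _ x hx, ih _ (Forms.contract_mem Z hx)]
      abel

/-- By Cartan's formula ι_X d d x = L_X d x - d L_X x + d d ι_X x. The first two terms cancel, and
the last vanishes by induction on the degree. -/
theorem Forms.d_d_of_mem (k : ℕ) : ∀ x ∈ Forms.grading R k, Forms.d (Forms.d x) = 0 := by
  induction k with
  | zero =>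
    intro x hx
    refine Forms.eq_zero_of_contract (Forms.d_mem (Forms.d_mem hx)) fun X => ?_
    rw [Forms.contract_d, Forms.contract_d, Forms.lieDerivative_d_of_mem X 0 x hx,
      Forms.contract_eq_zero X hx]
    simp
  | succ k ih =>
    intro x hx
    refine Forms.eq_zero_of_contract (Forms.d_mem (Forms.d_mem hx)) fun X => ?_
    rw [Forms.contract_d, Forms.contract_d, Forms.lieDerivative_d_of_mem X _ x hx, map_sub,
      ih _ (Forms.contract_mem X hx)]
    simp

theorem Forms.d_d (x : Forms R) : Forms.d (Forms.d x) = 0 := by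
  induction x using Forms.induction_on with
  | zero => simp
  | of k ζ => exact Forms.d_d_of_mem k _ (Forms.of_mem k ζ)
  | add x z hx hz => simp only [map_add, hx, hz, add_zero]

end FormCalculus

/-! ### Parity, contraction and the differential on the Weil algebra. -/

section WeilAlgebra

variable {𝔤 : Type*} [AddCommGroup 𝔤] [Module ℝ 𝔤]

noncomputable instance Weil.instRing : Ring (Weil 𝔤) := Algebra.TensorProduct.instRing
noncomputable instance Weil.instAddCommGroup : AddCommGroup (Weil 𝔤) :=
  Weil.instRing.toAddCommGroup
noncomputable instance Weil.instNeg : Neg (Weil 𝔤) := Weil.instRing.toNeg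
noncomputable instance Weil.instSub : Sub (Weil 𝔤) := Weil.instRing.toSub

/-- The parity involution as an algebra homomorphism. -/
noncomputable def Weil.parityHom : Weil 𝔤 →ₐ[ℝ] Weil 𝔤 :=
  Algebra.TensorProduct.map
    (CliffordAlgebra.involute (Q := (0 : QuadraticForm ℝ (Module.Dual ℝ 𝔤)))) (AlgHom.id ℝ _)

theorem Weil.parity_eq (a : Weil 𝔤) : Weil.parity 𝔤 a = Weil.parityHom a := rfl

theorem Weil.parity_tmul (x : ExteriorAlgebra ℝ (Module.Dual ℝ 𝔤))
    (s : SymmetricAlgebra ℝ (Module.Dual ℝ 𝔤)) :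
    Weil.parity 𝔤 (x ⊗ₜ s) =
      CliffordAlgebra.involute (Q := (0 : QuadraticForm ℝ (Module.Dual ℝ 𝔤))) x ⊗ₜ s := rfl

theorem Weil.parity_mul (a b : Weil 𝔤) :
    Weil.parity 𝔤 (a * b) = Weil.parity 𝔤 a * Weil.parity 𝔤 b := by
  simp only [Weil.parity_eq, map_mul]

@[simp] theorem Weil.parity_one : Weil.parity 𝔤 1 = 1 := by
  simp only [Weil.parity_eq, map_one]

@[simp] theorem Weil.parity_parity (a : Weil 𝔤) : Weil.parity 𝔤 (Weil.parity 𝔤 a) = a := by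
  induction a using TensorProduct.induction_on with
  | zero => simp
  | add x y hx hy => rw [map_add, map_add, hx, hy]
  | tmul x s => rw [Weil.parity_tmul, Weil.parity_tmul, CliffordAlgebra.involute_involute]

theorem involute_of_mem_exteriorPower {i : ℕ} {x : ExteriorAlgebra ℝ (Module.Dual ℝ 𝔤)}
    (hx : x ∈ ⋀[ℝ]^i (Module.Dual ℝ 𝔤)) :
    CliffordAlgebra.involute (Q := (0 : QuadraticForm ℝ (Module.Dual ℝ 𝔤))) x =
      (-1 : ℝ) ^ i • x := by
  induction hx using Submodule.pow_induction_on_left' with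
  | algebraMap r =>
    rw [pow_zero, one_smul]
    exact AlgHom.commutes _ r
  | add x y i hx hy h1 h2 => rw [map_add, h1, h2, smul_add]
  | mem_mul m hm i x hx h =>
    obtain ⟨m, rfl⟩ := hm
    rw [map_mul, h]
    have : CliffordAlgebra.involute (Q := (0 : QuadraticForm ℝ (Module.Dual ℝ 𝔤)))
      (ExteriorAlgebra.ι ℝ m) = - ExteriorAlgebra.ι ℝ m := CliffordAlgebra.involute_ι m
    rw [this, pow_succ]
    simp

theorem Weil.parity_of_mem {i : ℕ} {w : Weil 𝔤} (hw : w ∈ Weil.grading 𝔤 i) :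
    Weil.parity 𝔤 w = (-1 : ℝ) ^ i • w := by
  obtain ⟨a, rfl⟩ := hw
  induction a using TensorProduct.induction_on with
  | zero => simp
  | add x y hx hy => rw [map_add, map_add, hx, hy, smul_add]
  | tmul x s =>
    rw [LinearMap.rTensor_tmul, Weil.parity_tmul]
    rw [Submodule.subtype_apply, involute_of_mem_exteriorPower x.2]
    rfl

/-- The element of exterior degree one defined by a linear form. -/
noncomputable def Weil.odd : Module.Dual ℝ 𝔤 →ₗ[ℝ] Weil 𝔤 :=
  (TensorProduct.mk ℝ _ _).flip 1 ∘ₗ ExteriorAlgebra.ι ℝ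

/-- The element of symmetric degree one defined by a linear form. -/
noncomputable def Weil.even : Module.Dual ℝ 𝔤 →ₗ[ℝ] Weil 𝔤 :=
  TensorProduct.mk ℝ _ _ 1 ∘ₗ SymmetricAlgebra.ι ℝ _

theorem Weil.odd_apply (m : Module.Dual ℝ 𝔤) : Weil.odd m = ExteriorAlgebra.ι ℝ m ⊗ₜ 1 := rfl

theorem Weil.even_apply (m : Module.Dual ℝ 𝔤) :
    Weil.even m = 1 ⊗ₜ SymmetricAlgebra.ι ℝ _ m := rfl

@[simp] theorem Weil.parity_odd (m : Module.Dual ℝ 𝔤) :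
    Weil.parity 𝔤 (Weil.odd m) = - Weil.odd m := by
  rw [Weil.odd_apply, Weil.parity_tmul, ← TensorProduct.neg_tmul]
  congr 1
  exact CliffordAlgebra.involute_ι m

@[simp] theorem Weil.parity_even (m : Module.Dual ℝ 𝔤) :
    Weil.parity 𝔤 (Weil.even m) = Weil.even m := by
  rw [Weil.even_apply, Weil.parity_tmul, map_one]

theorem ι_mul_eq_involute_mul (m : Module.Dual ℝ 𝔤) (x : ExteriorAlgebra ℝ (Module.Dual ℝ 𝔤)) :
    ExteriorAlgebra.ι ℝ m * x =
      CliffordAlgebra.involute (Q := (0 : QuadraticForm ℝ (Module.Dual ℝ 𝔤))) x *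
        ExteriorAlgebra.ι ℝ m := by
  induction x using ExteriorAlgebra.induction with
  | algebraMap r =>
    have : CliffordAlgebra.involute (Q := (0 : QuadraticForm ℝ (Module.Dual ℝ 𝔤)))
      (algebraMap ℝ (ExteriorAlgebra ℝ (Module.Dual ℝ 𝔤)) r) = algebraMap ℝ _ r :=
      AlgHom.commutes _ r
    rw [this, Algebra.commutes]
  | ι l =>
    have : CliffordAlgebra.involute (Q := (0 : QuadraticForm ℝ (Module.Dual ℝ 𝔤)))
      (ExteriorAlgebra.ι ℝ l) = - ExteriorAlgebra.ι ℝ l := CliffordAlgebra.involute_ι l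
    rw [this, neg_mul, eq_neg_iff_add_eq_zero]
    exact ExteriorAlgebra.ι_add_mul_swap m l
  | mul a b ha hb => rw [map_mul, ← mul_assoc, ha, mul_assoc, hb, mul_assoc]
  | add a b ha hb => rw [map_add, mul_add, add_mul, ha, hb]

/-- Graded commutativity with an odd generator. With the involution in place of a sign, w need not
be homogeneous; the sign rules below take the same form. -/
theorem Weil.odd_mul (m : Module.Dual ℝ 𝔤) (w : Weil 𝔤) :
    Weil.odd m * w = Weil.parity 𝔤 w * Weil.odd m := by
  induction w using TensorProduct.induction_on with
  | zero => simp
  | add x y hx hy => rw [mul_add, map_add, add_mul, hx, hy]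
  | tmul x s =>
    rw [Weil.parity_tmul, Weil.odd_apply, Algebra.TensorProduct.tmul_mul_tmul,
      Algebra.TensorProduct.tmul_mul_tmul, ι_mul_eq_involute_mul, one_mul, mul_one]

theorem Weil.even_mul (m : Module.Dual ℝ 𝔤) (w : Weil 𝔤) :
    Weil.even m * w = w * Weil.even m := by
  induction w using TensorProduct.induction_on with
  | zero => simp
  | add x y hx hy => rw [mul_add, add_mul, hx, hy]
  | tmul x s =>
    rw [Weil.even_apply, Algebra.TensorProduct.tmul_mul_tmul,
      Algebra.TensorProduct.tmul_mul_tmul, one_mul, mul_one, mul_comm]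

theorem Weil.odd_mul_odd (m l : Module.Dual ℝ 𝔤) :
    Weil.odd m * Weil.odd l = - (Weil.odd l * Weil.odd m) := by
  rw [Weil.odd_mul, Weil.parity_odd, neg_mul]

theorem Weil.odd_mul_self (m : Module.Dual ℝ 𝔤) : Weil.odd m * Weil.odd m = 0 := by
  rw [Weil.odd_apply, Algebra.TensorProduct.tmul_mul_tmul, ExteriorAlgebra.ι_sq_zero,
    TensorProduct.zero_tmul]

/-- Induction on the Weil algebra as an algebra generated by its elements of lowest degree. -/
theorem Weil.induction {P : Weil 𝔤 → Prop} (w : Weil 𝔤) (algebraMap : ∀ r : ℝ, P (algebraMap ℝ _ r))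
    (odd : ∀ m, P (Weil.odd m)) (even : ∀ m, P (Weil.even m))
    (add : ∀ a b, P a → P b → P (a + b)) (mul : ∀ a b, P a → P b → P (a * b)) : P w := by
  induction w using TensorProduct.induction_on with
  | zero => simpa using algebraMap 0
  | add x y hx hy => exact add _ _ hx hy
  | tmul x s =>
    have h : x ⊗ₜ[ℝ] s = (x ⊗ₜ[ℝ] 1) * ((1 : ExteriorAlgebra ℝ (Module.Dual ℝ 𝔤)) ⊗ₜ[ℝ] s) := by
      rw [Algebra.TensorProduct.tmul_mul_tmul, one_mul, mul_one]
    rw [h]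
    clear h
    refine mul _ _ ?_ ?_
    · induction x using ExteriorAlgebra.induction with
      | algebraMap r => exact algebraMap r
      | ι m => exact odd m
      | mul a b ha hb =>
        have := mul _ _ ha hb
        rwa [Algebra.TensorProduct.tmul_mul_tmul, one_mul] at this
      | add a b ha hb => rw [TensorProduct.add_tmul]; exact add _ _ ha hb
    · induction s using SymmetricAlgebra.induction with
      | algebraMap r =>
        have := algebraMap r
        rwa [Algebra.TensorProduct.algebraMap_apply'] at this
      | ι m => exact even m
      | mul a b ha hb =>
        have := mul _ _ ha hb
        rwa [Algebra.TensorProduct.tmul_mul_tmul, one_mul] at this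
      | add a b ha hb => rw [TensorProduct.tmul_add]; exact add _ _ ha hb

/-- Induction on the left factor from the rule for a single generator; the involution collects the
sign of each generator passed. -/
theorem contractLeft_mul (l : Module.Dual ℝ (Module.Dual ℝ 𝔤))
    (x y : ExteriorAlgebra ℝ (Module.Dual ℝ 𝔤)) :
    CliffordAlgebra.contractLeft (Q := 0) l (x * y) =
      CliffordAlgebra.contractLeft (Q := 0) l x * y +
        CliffordAlgebra.involute (Q := (0 : QuadraticForm ℝ (Module.Dual ℝ 𝔤))) x *
          CliffordAlgebra.contractLeft (Q := 0) l y := by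
  induction x using CliffordAlgebra.left_induction generalizing y with
  | algebraMap r =>
    rw [CliffordAlgebra.contractLeft_algebraMap_mul, CliffordAlgebra.contractLeft_algebraMap,
      AlgHom.commutes, zero_mul, zero_add]
  | add a b ha hb => simp only [add_mul, map_add, ha, hb]; abel
  | ι_mul x m hx =>
    rw [mul_assoc, CliffordAlgebra.contractLeft_ι_mul, hx, CliffordAlgebra.contractLeft_ι_mul,
      map_mul, CliffordAlgebra.involute_ι, mul_add, sub_mul]
    simp only [neg_mul, smul_mul_assoc, mul_assoc]
    abel

theorem Weil.contract_mul (X : 𝔤) (a b : Weil 𝔤) :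
    Weil.contract X (a * b) = Weil.contract X a * b + Weil.parity 𝔤 a * Weil.contract X b := by
  induction a using TensorProduct.induction_on with
  | zero => simp
  | add x y hx hy => simp only [add_mul, map_add, hx, hy]; abel
  | tmul x s =>
    induction b using TensorProduct.induction_on with
    | zero => simp
    | add x y hx hy => simp only [mul_add, map_add, hx, hy]; abel
    | tmul y t =>
      have h : ∀ (x : ExteriorAlgebra ℝ (Module.Dual ℝ 𝔤)) s, Weil.contract X (x ⊗ₜ s) =
        CliffordAlgebra.contractLeft (Q := 0) (Module.Dual.eval ℝ 𝔤 X) x ⊗ₜ s := fun _ _ => rfl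
      rw [Algebra.TensorProduct.tmul_mul_tmul, h, h, h, Weil.parity_tmul,
        Algebra.TensorProduct.tmul_mul_tmul, Algebra.TensorProduct.tmul_mul_tmul,
        ← TensorProduct.add_tmul, contractLeft_mul]

theorem Weil.contract_parity (X : 𝔤) (a : Weil 𝔤) :
    Weil.contract X (Weil.parity 𝔤 a) = - Weil.parity 𝔤 (Weil.contract X a) := by
  have hr : ∀ r : ℝ, Weil.contract X (algebraMap ℝ (Weil 𝔤) r) = 0 := by
    intro r
    rw [Algebra.TensorProduct.algebraMap_apply]
    change (CliffordAlgebra.contractLeft (Q := 0) (Module.Dual.eval ℝ 𝔤 X)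
      (algebraMap ℝ _ r)) ⊗ₜ _ = _
    rw [CliffordAlgebra.contractLeft_algebraMap, TensorProduct.zero_tmul]
  induction a using Weil.induction with
  | algebraMap r => simp only [Weil.parity_eq, AlgHom.commutes, hr, map_zero, neg_zero]
  | odd m =>
    have : Weil.contract X (Weil.odd m) = algebraMap ℝ _ (m X) := by
      change (CliffordAlgebra.contractLeft (Q := 0) (Module.Dual.eval ℝ 𝔤 X)
        (CliffordAlgebra.ι 0 m)) ⊗ₜ _ = _
      rw [CliffordAlgebra.contractLeft_ι]
      rfl
    rw [Weil.parity_odd, map_neg, this]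
    simp only [Weil.parity_eq, AlgHom.commutes]
  | even m =>
    have : Weil.contract X (Weil.even m) = 0 := by simp [Weil.contract, Weil.even_apply]
    rw [Weil.parity_even, this, map_zero, neg_zero]
  | add a b ha hb => simp only [map_add, ha, hb, neg_add]
  | mul a b ha hb =>
    simp only [Weil.contract_mul, Weil.parity_mul, ha, hb, map_add, Weil.parity_parity]
    simp only [neg_mul, mul_neg, neg_add]

variable {n : ℕ} (e : Module.Basis (Fin n) ℝ 𝔤)

theorem Weil.pderiv_mul (i : Fin n) (a b : Weil 𝔤) :
    Weil.pderiv e i (a * b) = Weil.pderiv e i a * b + a * Weil.pderiv e i b := by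
  induction a using TensorProduct.induction_on with
  | zero => simp
  | add x y hx hy => simp only [add_mul, map_add, hx, hy]; abel
  | tmul x s =>
    induction b using TensorProduct.induction_on with
    | zero => simp
    | add x y hx hy => simp only [mul_add, map_add, hx, hy]; abel
    | tmul y t =>
      simp only [Weil.pderiv, Algebra.TensorProduct.tmul_mul_tmul, TensorProduct.map_tmul,
        ← TensorProduct.tmul_add, LinearMap.id_apply]
      congr 1
      simp only [LinearMap.comp_apply, AlgEquiv.toLinearMap_apply, map_mul,
        Derivation.coeFn_coe, Derivation.leibniz, map_add, smul_eq_mul, AlgEquiv.symm_apply_apply]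
      rw [add_comm, mul_comm t]

theorem Weil.pderiv_parity (i : Fin n) (a : Weil 𝔤) :
    Weil.pderiv e i (Weil.parity 𝔤 a) = Weil.parity 𝔤 (Weil.pderiv e i a) := by
  induction a using TensorProduct.induction_on with
  | zero => simp
  | add x y hx hy => simp only [map_add, hx, hy]
  | tmul x s => rfl

theorem Weil.θ_eq (i : Fin n) : Weil.θ e i = Weil.odd (e.coord i) := rfl
theorem Weil.φ_eq (i : Fin n) : Weil.φ e i = Weil.even (e.coord i) := rfl

theorem Weil.odd_eq_sum (m : Module.Dual ℝ 𝔤) : Weil.odd m = ∑ i, m (e i) • Weil.θ e i := by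
  simp only [Weil.θ_eq, ← map_smul, ← map_sum]
  rw [Module.Basis.sum_dual_apply_smul_coord]

theorem Weil.even_eq_sum (m : Module.Dual ℝ 𝔤) : Weil.even m = ∑ i, m (e i) • Weil.φ e i := by
  simp only [Weil.φ_eq, ← map_smul, ← map_sum]
  rw [Module.Basis.sum_dual_apply_smul_coord]

variable [Bracket 𝔤 𝔤]

theorem Weil.d_φ_eq (i : Fin n) : Weil.d e (Weil.φ e i) =
    -∑ j, ∑ k, structureConstant e i j k • (Weil.θ e j * Weil.φ e k) := Weil.d_φ e i

theorem Weil.parity_d_θ (i : Fin n) :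
    Weil.parity 𝔤 (Weil.d e (Weil.θ e i)) = Weil.d e (Weil.θ e i) := by
  rw [Weil.d_θ]
  simp only [Weil.θ_eq, Weil.φ_eq, map_add, map_smul, map_sum, Weil.parity_mul, Weil.parity_odd,
    Weil.parity_even, neg_mul_neg]

theorem Weil.parity_d_φ (i : Fin n) :
    Weil.parity 𝔤 (Weil.d e (Weil.φ e i)) = -Weil.d e (Weil.φ e i) := by
  rw [Weil.d_φ_eq]
  simp only [Weil.θ_eq, Weil.φ_eq, map_neg, map_smul, map_sum, Weil.parity_mul, Weil.parity_odd,
    Weil.parity_even, neg_mul, smul_neg, Finset.sum_neg_distrib]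

/-- d_W θ^i is even, hence central; its summands are products of two odd generators or a single even
one. -/
theorem Weil.d_θ_mul (i : Fin n) (w : Weil 𝔤) :
    Weil.d e (Weil.θ e i) * w = w * Weil.d e (Weil.θ e i) := by
  have h : ∀ m l : Module.Dual ℝ 𝔤, Weil.odd m * Weil.odd l * w = w * (Weil.odd m * Weil.odd l) := by
    intro m l
    rw [mul_assoc, Weil.odd_mul l, ← mul_assoc, Weil.odd_mul m, Weil.parity_parity, mul_assoc]
  rw [Weil.d_θ]
  simp only [Weil.θ_eq, Weil.φ_eq, add_mul, mul_add, Weil.even_mul, smul_mul_assoc,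
    mul_smul_comm, Finset.sum_mul, Finset.mul_sum, h]

theorem Weil.d_φ_mul (i : Fin n) (w : Weil 𝔤) :
    Weil.d e (Weil.φ e i) * w = Weil.parity 𝔤 w * Weil.d e (Weil.φ e i) := by
  have h : ∀ m l : Module.Dual ℝ 𝔤, Weil.odd m * Weil.even l * w =
      Weil.parity 𝔤 w * (Weil.odd m * Weil.even l) := by
    intro m l
    rw [mul_assoc, Weil.even_mul l, ← mul_assoc, Weil.odd_mul m, mul_assoc]
  rw [Weil.d_φ_eq]
  simp only [Weil.θ_eq, Weil.φ_eq, neg_mul, mul_neg, smul_mul_assoc,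
    mul_smul_comm, Finset.sum_mul, Finset.mul_sum, h]

/-- In this form the antiderivation and parity properties of d_W can be read off from those of the
coefficients, `Weil.contract` and `Weil.pderiv`. -/
theorem Weil.d_apply (w : Weil 𝔤) : Weil.d e w =
    ∑ i, (Weil.d e (Weil.θ e i) * Weil.contract (e i) w +
      Weil.d e (Weil.φ e i) * Weil.pderiv e i w) := by
  simp only [Weil.d_θ, Weil.d_φ]
  simp only [Weil.d, LinearMap.sum_apply, LinearMap.add_apply, LinearMap.comp_apply,
    LinearMap.mulLeft_apply]

/-- `d_W` is an antiderivation. -/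
theorem Weil.d_mul (a b : Weil 𝔤) :
    Weil.d e (a * b) = Weil.d e a * b + Weil.parity 𝔤 a * Weil.d e b := by
  rw [Weil.d_apply e (a * b), Weil.d_apply e a, Weil.d_apply e b, Finset.sum_mul, Finset.mul_sum,
    ← Finset.sum_add_distrib]
  refine Finset.sum_congr rfl fun i _ => ?_
  rw [Weil.contract_mul, Weil.pderiv_mul]
  simp only [mul_add, add_mul]
  -- The sign on the second summand has two sources: for the contraction part it comes from the
  -- antiderivation rule, the coefficient being central; for the derivation ∂/∂φ^i it comes from
  -- moving the odd coefficient d_W φ^i past a.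
  rw [← mul_assoc _ (Weil.parity 𝔤 a), Weil.d_θ_mul e i (Weil.parity 𝔤 a), ← mul_assoc _ a,
    Weil.d_φ_mul e i a]
  simp only [mul_assoc]
  abel

theorem Weil.d_parity (a : Weil 𝔤) :
    Weil.d e (Weil.parity 𝔤 a) = - Weil.parity 𝔤 (Weil.d e a) := by
  rw [Weil.d_apply e (Weil.parity 𝔤 a), Weil.d_apply e a, map_sum, ← Finset.sum_neg_distrib]
  refine Finset.sum_congr rfl fun i _ => ?_
  rw [map_add, Weil.parity_mul, Weil.parity_mul, Weil.parity_d_θ, Weil.parity_d_φ,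
    Weil.contract_parity, Weil.pderiv_parity]
  simp only [mul_neg, neg_mul, neg_add, neg_neg]

theorem Weil.d_algebraMap (r : ℝ) : Weil.d e (algebraMap ℝ (Weil 𝔤) r) = 0 := by
  have h : Weil.d e 1 = 0 := by
    have := Weil.d_mul e 1 1
    simpa using this
  rw [Algebra.algebraMap_eq_smul_one, map_smul, h, smul_zero]

end WeilAlgebra

/-! ### The Jacobi identity and d² = 0 on generators. -/

section Jacobi

variable {n : ℕ}

/-- The antisymmetry and the Jacobi identity of structure constants. -/
def IsJacobi (c : Fin n → Fin n → Fin n → ℝ) : Prop :=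
  (∀ i j k, c i j k = - c i k j) ∧ ∀ i j k l, ∑ m, c i j m * c m k l + ∑ m, c i k m * c m l j +
    ∑ m, c i l m * c m j k = 0

variable {A : Type*} [Ring A] [Algebra ℝ A] {c : Fin n → Fin n → Fin n → ℝ}
  {θ φ : Fin n → A} {d : Module.End ℝ A}

theorem IsJacobi.d_d_odd_eq_zero (hc : IsJacobi c) (hθ : ∀ i j, θ i * θ j = -(θ j * θ i))
    (hdθ : ∀ i, d (θ i) = -(2⁻¹ : ℝ) • (∑ j, ∑ k, c i j k • (θ j * θ k)) + φ i)
    (hdφ : ∀ i, d (φ i) = -∑ j, ∑ k, c i j k • (θ j * φ k))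
    (hd : ∀ i w, d (θ i * w) = d (θ i) * w - θ i * d w)
    (hcomm : ∀ i j, d (θ i) * θ j = θ j * d (θ i)) (i : Fin n) : d (d (θ i)) = 0 := by
  have h1 : ∑ j, ∑ k, c i j k • d (θ j * θ k) =
      -(2 : ℝ) • ∑ j, ∑ k, c i j k • (θ j * d (θ k)) := by
    have h : ∑ j, ∑ k, c i j k • (θ k * d (θ j)) = - ∑ j, ∑ k, c i j k • (θ j * d (θ k)) := by
      rw [Finset.sum_comm]
      simp only [← Finset.sum_neg_distrib]
      refine Finset.sum_congr rfl fun j _ => Finset.sum_congr rfl fun k _ => ?_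
      rw [hc.1 i k j, neg_smul]
    simp only [hd, hcomm, smul_sub, Finset.sum_sub_distrib, h]
    module
  have h2 : d (d (θ i)) = ∑ j, ∑ k, c i j k • (θ j * (d (θ k) - φ k)) := by
    rw [hdθ i, map_add, map_smul, hdφ]
    simp only [map_sum, map_smul]
    rw [h1]
    simp only [mul_sub, smul_sub, Finset.sum_sub_distrib]
    module
  have h3 : d (d (θ i)) = -(2⁻¹ : ℝ) • ∑ j, ∑ l, ∑ m,
      (∑ k, c i j k * c k l m) • (θ j * θ l * θ m) := by
    rw [h2, Finset.smul_sum]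
    refine Finset.sum_congr rfl fun j _ => ?_
    simp only [hdθ, add_sub_cancel_right, mul_smul_comm, Finset.mul_sum, Finset.smul_sum,
      Finset.sum_smul, smul_smul]
    rw [Finset.sum_comm]
    refine Finset.sum_congr rfl fun l _ => ?_
    rw [Finset.sum_comm]
    refine Finset.sum_congr rfl fun m _ => Finset.sum_congr rfl fun k _ => ?_
    rw [mul_assoc (θ j)]
    congr 1
    ring
  set g : Fin n → Fin n → Fin n → ℝ := fun j l m => ∑ k, c i j k * c k l m with hg
  set T : Fin n → Fin n → Fin n → A := fun j l m => θ j * θ l * θ m with hT0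
  have hT : ∀ j l m, T l m j = T j l m := by
    intro j l m
    simp only [hT0]
    rw [mul_assoc, hθ m j, mul_neg, ← mul_assoc, hθ l j, neg_mul, neg_neg]
  have e1 : ∑ j, ∑ l, ∑ m, g l m j • T j l m = ∑ j, ∑ l, ∑ m, g j l m • T j l m := by
    have : ∀ j l m, g l m j • T j l m = g l m j • T l m j := fun j l m => by rw [hT j l m]
    refine (Finset.sum_congr rfl fun j _ => Finset.sum_congr rfl fun l _ =>
      Finset.sum_congr rfl fun m _ => this j l m).trans ?_
    rw [Finset.sum_comm]
    refine Finset.sum_congr rfl fun l _ => ?_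
    rw [Finset.sum_comm]
  have e2 : ∑ j, ∑ l, ∑ m, g m j l • T j l m = ∑ j, ∑ l, ∑ m, g j l m • T j l m := by
    have : ∀ j l m, g m j l • T j l m = g m j l • T m j l := fun j l m => by rw [hT m j l]
    refine (Finset.sum_congr rfl fun j _ => Finset.sum_congr rfl fun l _ =>
      Finset.sum_congr rfl fun m _ => this j l m).trans ?_
    rw [Finset.sum_congr rfl fun j _ => Finset.sum_comm]
    rw [Finset.sum_comm]
  have e3 : ∑ j, ∑ l, ∑ m, (g j l m + g l m j + g m j l) • T j l m = 0 := by
    refine Finset.sum_eq_zero fun j _ => Finset.sum_eq_zero fun l _ =>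
      Finset.sum_eq_zero fun m _ => ?_
    rw [hc.2 i j l m, zero_smul]
  simp only [add_smul, Finset.sum_add_distrib, e1, e2] at e3
  rw [h3]
  -- The sum is split into three equal copies, one for each cyclic rotation; hence 1/6 in place of
  -- 1/2.
  have : -(2⁻¹ : ℝ) • ∑ j, ∑ l, ∑ m, g j l m • T j l m =
      (-6⁻¹ : ℝ) • (∑ j, ∑ l, ∑ m, g j l m • T j l m + ∑ j, ∑ l, ∑ m, g j l m • T j l m +
        ∑ j, ∑ l, ∑ m, g j l m • T j l m) := by module
  exact this.trans (by rw [e3, smul_zero])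

/-- The φφ-terms vanish, being symmetric against skew coefficients. What remains is a sum over θ^j
θ^l φ^m. Only θ^j and θ^l can be exchanged, and skewness of c in its lower indices makes two of the
three Jacobi sums equal. -/
theorem IsJacobi.d_d_even_eq_zero (hc : IsJacobi c) (hθ : ∀ i j, θ i * θ j = -(θ j * θ i))
    (hφ : ∀ i j, φ i * φ j = φ j * φ i)
    (hdθ : ∀ i, d (θ i) = -(2⁻¹ : ℝ) • (∑ j, ∑ k, c i j k • (θ j * θ k)) + φ i)
    (hdφ : ∀ i, d (φ i) = -∑ j, ∑ k, c i j k • (θ j * φ k))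
    (hd : ∀ i w, d (θ i * w) = d (θ i) * w - θ i * d w) (i : Fin n) : d (d (φ i)) = 0 := by
  set g : Fin n → Fin n → Fin n → ℝ := fun j l m => ∑ k, c i j k * c k l m with hg
  set U : Fin n → Fin n → Fin n → A := fun j l m => θ j * θ l * φ m with hUdef
  have hU : ∀ j l m, U j l m = - U l j m := by
    intro j l m
    simp only [hUdef]
    rw [hθ, neg_mul]
  have hg' : ∀ j l m, g j l m = - g j m l := by
    intro j l m
    simp only [hg, ← Finset.sum_neg_distrib]
    refine Finset.sum_congr rfl fun k _ => ?_
    rw [hc.1 k l m, mul_neg]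
  have h0 : ∑ j, ∑ k, c i j k • (φ j * φ k) = 0 := by
    have : ∑ j, ∑ k, c i j k • (φ j * φ k) = - ∑ j, ∑ k, c i j k • (φ j * φ k) := by
      conv_lhs => rw [Finset.sum_comm]
      simp only [← Finset.sum_neg_distrib]
      refine Finset.sum_congr rfl fun j _ => Finset.sum_congr rfl fun k _ => ?_
      rw [hc.1 i k j, neg_smul, hφ]
    have h2 : ∑ j, ∑ k, c i j k • (φ j * φ k) = (2⁻¹ : ℝ) • (∑ j, ∑ k, c i j k • (φ j * φ k) -
        -∑ j, ∑ k, c i j k • (φ j * φ k)) := by module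
    rw [h2, ← this, sub_self, smul_zero]
  have h1 : ∑ j, ∑ k, c i j k • ((d (θ j) - φ j) * φ k) =
      (2⁻¹ : ℝ) • ∑ j, ∑ l, ∑ m, g m j l • U j l m := by
    have : ∀ j k, c i j k • ((d (θ j) - φ j) * φ k) = (2⁻¹ : ℝ) • ∑ l, ∑ m,
        (c i k j * c j l m) • U l m k := by
      intro j k
      simp only [hdθ, add_sub_cancel_right, smul_mul_assoc, Finset.sum_mul, Finset.smul_sum,
        smul_smul]
      refine Finset.sum_congr rfl fun l _ => Finset.sum_congr rfl fun m _ => ?_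
      rw [hc.1 i j k]
      congr 1
      ring
    simp only [this, ← Finset.smul_sum]
    congr 1
    simp only [hg, Finset.sum_smul]
    calc ∑ j, ∑ k, ∑ l, ∑ m, (c i k j * c j l m) • U l m k
        = ∑ j, ∑ l, ∑ k, ∑ m, (c i k j * c j l m) • U l m k :=
          Finset.sum_congr rfl fun j _ => Finset.sum_comm
      _ = ∑ l, ∑ j, ∑ k, ∑ m, (c i k j * c j l m) • U l m k := Finset.sum_comm
      _ = ∑ l, ∑ j, ∑ m, ∑ k, (c i k j * c j l m) • U l m k :=
          Finset.sum_congr rfl fun l _ => Finset.sum_congr rfl fun j _ => Finset.sum_comm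
      _ = ∑ l, ∑ m, ∑ j, ∑ k, (c i k j * c j l m) • U l m k :=
          Finset.sum_congr rfl fun l _ => Finset.sum_comm
      _ = ∑ l, ∑ m, ∑ k, ∑ j, (c i k j * c j l m) • U l m k :=
          Finset.sum_congr rfl fun l _ => Finset.sum_congr rfl fun m _ => Finset.sum_comm
  have h2 : ∑ j, ∑ k, c i j k • (θ j * d (φ k)) = - ∑ j, ∑ l, ∑ m, g j l m • U j l m := by
    rw [← Finset.sum_neg_distrib]
    refine Finset.sum_congr rfl fun j _ => ?_
    simp only [hdφ, mul_neg, smul_neg, Finset.sum_neg_distrib, Finset.mul_sum,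
      mul_smul_comm, Finset.smul_sum, smul_smul, hg, Finset.sum_smul]
    congr 1
    rw [Finset.sum_comm]
    refine Finset.sum_congr rfl fun l _ => ?_
    rw [Finset.sum_comm]
    refine Finset.sum_congr rfl fun m _ => Finset.sum_congr rfl fun k _ => ?_
    rw [hUdef]
    simp only [mul_assoc]
  have h3 : d (d (φ i)) =
      - ((2⁻¹ : ℝ) • ∑ j, ∑ l, ∑ m, g m j l • U j l m + ∑ j, ∑ l, ∑ m, g j l m • U j l m) := by
    have : ∀ j k, d (θ j * φ k) =
        (d (θ j) - φ j) * φ k + φ j * φ k - θ j * d (φ k) := by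
      intro j k
      rw [hd, sub_mul]
      abel
    rw [hdφ i]
    simp only [map_neg, map_sum, map_smul, this, smul_sub, smul_add, Finset.sum_sub_distrib,
      Finset.sum_add_distrib]
    rw [h0, h1, h2]
    module
  -- Exchanging j and l changes the sign of U; exchanging the last two indices of g changes it back.
  have e1 : ∑ j, ∑ l, ∑ m, g l m j • U j l m = ∑ j, ∑ l, ∑ m, g j l m • U j l m := by
    rw [Finset.sum_comm]
    refine Finset.sum_congr rfl fun l _ => Finset.sum_congr rfl fun j _ =>
      Finset.sum_congr rfl fun m _ => ?_
    rw [hU, hg', neg_smul_neg]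
  have e3 : ∑ j, ∑ l, ∑ m, (g j l m + g l m j + g m j l) • U j l m = 0 := by
    refine Finset.sum_eq_zero fun j _ => Finset.sum_eq_zero fun l _ =>
      Finset.sum_eq_zero fun m _ => ?_
    rw [hc.2 i j l m, zero_smul]
  simp only [add_smul, Finset.sum_add_distrib, e1] at e3
  rw [h3]
  have : -((2⁻¹ : ℝ) • ∑ j, ∑ l, ∑ m, g m j l • U j l m +
      ∑ j, ∑ l, ∑ m, g j l m • U j l m) = (-2⁻¹ : ℝ) • (∑ j, ∑ l, ∑ m, g j l m • U j l m +
      ∑ j, ∑ l, ∑ m, g j l m • U j l m + ∑ j, ∑ l, ∑ m, g m j l • U j l m) := by module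
  rw [this, e3, smul_zero]

end Jacobi

/-! ### The square of d_W. -/

section WeilDifferential

variable {𝔤 : Type*} [AddCommGroup 𝔤] [Module ℝ 𝔤] {n : ℕ} {e : Module.Basis (Fin n) ℝ 𝔤}
  [Bracket 𝔤 𝔤]

theorem Weil.d_θ_mul_eq (i : Fin n) (w : Weil 𝔤) :
    Weil.d e (Weil.θ e i * w) = Weil.d e (Weil.θ e i) * w - Weil.θ e i * Weil.d e w := by
  rw [Weil.d_mul, Weil.θ_eq, Weil.parity_odd, neg_mul, sub_eq_add_neg]

theorem Weil.d_d (hc : IsJacobi (structureConstant e)) (w : Weil 𝔤) :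
    Weil.d e (Weil.d e w) = 0 := by
  induction w using Weil.induction with
  | algebraMap r => rw [Weil.d_algebraMap, map_zero]
  | odd m =>
    have h : ∀ i, Weil.d e (Weil.d e (Weil.θ e i)) = 0 :=
      hc.d_d_odd_eq_zero (fun i j => Weil.odd_mul_odd _ _) (Weil.d_θ e) (Weil.d_φ e)
        Weil.d_θ_mul_eq (fun i j => Weil.d_θ_mul e i _)
    rw [Weil.odd_eq_sum e, map_sum, map_sum]
    exact Finset.sum_eq_zero fun i _ => by rw [map_smul, map_smul, h, smul_zero]
  | even m =>
    have h : ∀ i, Weil.d e (Weil.d e (Weil.φ e i)) = 0 :=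
      hc.d_d_even_eq_zero (fun i j => Weil.odd_mul_odd _ _) (fun i j => Weil.even_mul _ _)
        (Weil.d_θ e) (Weil.d_φ e) Weil.d_θ_mul_eq
    rw [Weil.even_eq_sum e, map_sum, map_sum]
    exact Finset.sum_eq_zero fun i _ => by rw [map_smul, map_smul, h, smul_zero]
  | add a b ha hb => rw [map_add, map_add, ha, hb, add_zero]
  -- The cross terms in d(d(ab)) cancel because d_W anticommutes with the parity involution, so
  -- vanishing propagates from generators to products.
  | mul a b ha hb =>
    rw [Weil.d_mul, map_add, Weil.d_mul, Weil.d_mul, ha, hb, Weil.d_parity, Weil.parity_parity]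
    simp only [zero_mul, mul_zero, zero_add, add_zero, neg_mul, add_neg_cancel]

end WeilDifferential

/-! ### The total degree on the Weil algebra. -/

section WeilDegree

variable {𝔤 : Type*} [AddCommGroup 𝔤] [Module ℝ 𝔤]

variable (𝔤) in
/-- The total degree on the Weil algebra. -/
noncomputable def Weil.degree (m : ℕ) : Submodule ℝ (Weil 𝔤) :=
  Submodule.span ℝ {x | ∃ p q : ℕ, p + 2 * q = m ∧ ∃ a ∈ ⋀[ℝ]^p (Module.Dual ℝ 𝔤),
    ∃ s ∈ LinearMap.range (SymmetricAlgebra.ι ℝ (Module.Dual ℝ 𝔤)) ^ q, x = a ⊗ₜ s}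

theorem one_mem_exteriorPower_zero :
    (1 : ExteriorAlgebra ℝ (Module.Dual ℝ 𝔤)) ∈ ⋀[ℝ]^0 (Module.Dual ℝ 𝔤) :=
  SetLike.GradedOne.one_mem (A := fun p : ℕ => ⋀[ℝ]^p (Module.Dual ℝ 𝔤))

theorem one_mem_range_ι_pow_zero : (1 : SymmetricAlgebra ℝ (Module.Dual ℝ 𝔤)) ∈
    LinearMap.range (SymmetricAlgebra.ι ℝ (Module.Dual ℝ 𝔤)) ^ 0 := by
  rw [pow_zero]
  exact Submodule.one_le.1 le_rfl

theorem Weil.tmul_mem_degree {p q m : ℕ} (h : p + 2 * q = m)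
    {a : ExteriorAlgebra ℝ (Module.Dual ℝ 𝔤)} (ha : a ∈ ⋀[ℝ]^p (Module.Dual ℝ 𝔤))
    {s : SymmetricAlgebra ℝ (Module.Dual ℝ 𝔤)}
    (hs : s ∈ LinearMap.range (SymmetricAlgebra.ι ℝ (Module.Dual ℝ 𝔤)) ^ q) :
    (a ⊗ₜ s : Weil 𝔤) ∈ Weil.degree 𝔤 m :=
  Submodule.subset_span ⟨p, q, h, a, ha, s, hs, rfl⟩

theorem Weil.mul_mem_degree {l m : ℕ} {a b : Weil 𝔤} (ha : a ∈ Weil.degree 𝔤 l)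
    (hb : b ∈ Weil.degree 𝔤 m) : a * b ∈ Weil.degree 𝔤 (l + m) := by
  induction ha using Submodule.span_induction with
  | zero => rw [zero_mul]; exact zero_mem _
  | add x y _ _ hx hy => rw [add_mul]; exact add_mem hx hy
  | smul r x _ hx => rw [smul_mul_assoc]; exact Submodule.smul_mem _ _ hx
  | mem x hx =>
    obtain ⟨p, q, h, a, ha, s, hs, rfl⟩ := hx
    induction hb using Submodule.span_induction with
    | zero => rw [mul_zero]; exact zero_mem _
    | add x y _ _ hx hy => rw [mul_add]; exact add_mem hx hy
    | smul r x _ hx => rw [mul_smul_comm]; exact Submodule.smul_mem _ _ hx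
    | mem x hx =>
      obtain ⟨p', q', h', a', ha', s', hs', rfl⟩ := hx
      rw [Algebra.TensorProduct.tmul_mul_tmul]
      refine Weil.tmul_mem_degree (p := p + p') (q := q + q') (by omega)
        (SetLike.mul_mem_graded ha ha') ?_
      rw [pow_add]
      exact Submodule.mul_mem_mul hs hs'

theorem Weil.odd_mem_degree (m : Module.Dual ℝ 𝔤) : Weil.odd m ∈ Weil.degree 𝔤 1 := by
  refine Weil.tmul_mem_degree (p := 1) (q := 0) rfl ?_ one_mem_range_ι_pow_zero
  change _ ∈ LinearMap.range (ExteriorAlgebra.ι ℝ) ^ 1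
  rw [pow_one]
  exact ⟨m, rfl⟩

theorem Weil.even_mem_degree (m : Module.Dual ℝ 𝔤) : Weil.even m ∈ Weil.degree 𝔤 2 := by
  refine Weil.tmul_mem_degree (p := 0) (q := 1) rfl one_mem_exteriorPower_zero ?_
  rw [pow_one]
  exact ⟨m, rfl⟩

theorem Weil.parity_mem_degree {m : ℕ} {w : Weil 𝔤} (hw : w ∈ Weil.degree 𝔤 m) :
    Weil.parity 𝔤 w = (-1 : ℝ) ^ m • w := by
  induction hw using Submodule.span_induction with
  | zero => rw [map_zero, smul_zero]
  | add x y _ _ hx hy => rw [map_add, hx, hy, smul_add]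
  | smul r x _ hx => rw [map_smul, hx, smul_comm]
  | mem x hx =>
    obtain ⟨p, q, h, a, ha, s, hs, rfl⟩ := hx
    rw [Weil.parity_tmul, involute_of_mem_exteriorPower ha, ← h, pow_add, pow_mul]
    simp
    rfl

variable {n : ℕ} (e : Module.Basis (Fin n) ℝ 𝔤) [Bracket 𝔤 𝔤]

theorem sum_sum_smul_mem {ι A : Type*} [Fintype ι] [AddCommMonoid A] [Module ℝ A]
    (N : Submodule ℝ A) (c : ι → ι → ℝ) {x : ι → ι → A} (h : ∀ j k, x j k ∈ N) :
    ∑ j, ∑ k, c j k • x j k ∈ N :=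
  N.sum_mem fun j _ => N.sum_mem fun k _ => N.smul_mem _ (h j k)

theorem Weil.d_θ_mem_degree (i : Fin n) : Weil.d e (Weil.θ e i) ∈ Weil.degree 𝔤 2 := by
  rw [Weil.d_θ]
  refine Submodule.add_mem _ (Submodule.smul_mem _ _ ?_) (Weil.even_mem_degree (e.coord i))
  refine sum_sum_smul_mem (Weil.degree 𝔤 2) (fun j k => structureConstant e i j k) fun j k => ?_
  rw [Weil.θ_eq, Weil.θ_eq]
  exact Weil.mul_mem_degree (l := 1) (m := 1) (Weil.odd_mem_degree _) (Weil.odd_mem_degree _)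

theorem Weil.d_φ_mem_degree (i : Fin n) : Weil.d e (Weil.φ e i) ∈ Weil.degree 𝔤 3 := by
  rw [Weil.d_φ_eq, ← neg_one_smul ℝ]
  refine Submodule.smul_mem _ _ ?_
  refine sum_sum_smul_mem (Weil.degree 𝔤 3) (fun j k => structureConstant e i j k) fun j k => ?_
  rw [Weil.θ_eq, Weil.φ_eq]
  exact Weil.mul_mem_degree (l := 1) (m := 2) (Weil.odd_mem_degree _) (Weil.even_mem_degree _)

theorem Weil.d_odd_mem_degree (m : Module.Dual ℝ 𝔤) :
    Weil.d e (Weil.odd m) ∈ Weil.degree 𝔤 2 := by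
  rw [Weil.odd_eq_sum e, map_sum]
  exact Submodule.sum_mem _ fun i _ => by
    rw [map_smul]
    exact Submodule.smul_mem _ _ (Weil.d_θ_mem_degree e i)

theorem Weil.d_even_mem_degree (m : Module.Dual ℝ 𝔤) :
    Weil.d e (Weil.even m) ∈ Weil.degree 𝔤 3 := by
  rw [Weil.even_eq_sum e, map_sum]
  exact Submodule.sum_mem _ fun i _ => by
    rw [map_smul]
    exact Submodule.smul_mem _ _ (Weil.d_φ_mem_degree e i)

/-- By the product rule, raising the degree by one passes from factors to products, so it need only
be checked on generators. -/
theorem Weil.d_mul_mem_degree {l m : ℕ} {a b : Weil 𝔤} (ha : a ∈ Weil.degree 𝔤 l)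
    (hb : b ∈ Weil.degree 𝔤 m) (hda : Weil.d e a ∈ Weil.degree 𝔤 (l + 1))
    (hdb : Weil.d e b ∈ Weil.degree 𝔤 (m + 1)) :
    Weil.d e (a * b) ∈ Weil.degree 𝔤 (l + m + 1) := by
  rw [Weil.d_mul, Weil.parity_mem_degree ha, smul_mul_assoc]
  refine Submodule.add_mem _ ?_ (Submodule.smul_mem _ _ ?_)
  · have := Weil.mul_mem_degree hda hb
    rwa [show l + 1 + m = l + m + 1 by omega] at this
  · rw [add_assoc]
    exact Weil.mul_mem_degree ha hdb

theorem Weil.d_tmul_one_mem_degree {p : ℕ} {a : ExteriorAlgebra ℝ (Module.Dual ℝ 𝔤)}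
    (ha : a ∈ ⋀[ℝ]^p (Module.Dual ℝ 𝔤)) :
    Weil.d e (a ⊗ₜ 1) ∈ Weil.degree 𝔤 (p + 1) := by
  induction ha using Submodule.pow_induction_on_left' with
  | algebraMap r =>
    have : Weil.d e ((algebraMap ℝ _ r) ⊗ₜ 1) = 0 := Weil.d_algebraMap e r
    rw [this]
    exact zero_mem _
  | add x y i hx hy h1 h2 => rw [TensorProduct.add_tmul, map_add]; exact add_mem h1 h2
  | mem_mul m hm i x hx h =>
    obtain ⟨m, rfl⟩ := hm
    have h1 : ((ExteriorAlgebra.ι ℝ m * x) ⊗ₜ 1 : Weil 𝔤) = Weil.odd m * (x ⊗ₜ 1) := by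
      rw [Weil.odd_apply, Algebra.TensorProduct.tmul_mul_tmul, one_mul]
    have h2 : (x ⊗ₜ 1 : Weil 𝔤) ∈ Weil.degree 𝔤 i :=
      Weil.tmul_mem_degree (p := i) (q := 0) rfl hx one_mem_range_ι_pow_zero
    have h3 := Weil.d_mul_mem_degree e (Weil.odd_mem_degree m) h2 (Weil.d_odd_mem_degree e m) h
    refine h1 ▸ ?_
    rwa [add_comm 1 i] at h3

theorem Weil.d_one_tmul_mem_degree {q : ℕ} {s : SymmetricAlgebra ℝ (Module.Dual ℝ 𝔤)}
    (hs : s ∈ LinearMap.range (SymmetricAlgebra.ι ℝ (Module.Dual ℝ 𝔤)) ^ q) :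
    Weil.d e (1 ⊗ₜ s) ∈ Weil.degree 𝔤 (2 * q + 1) := by
  induction hs using Submodule.pow_induction_on_left' with
  | algebraMap r =>
    have : Weil.d e (1 ⊗ₜ (algebraMap ℝ _ r)) = 0 := by
      rw [← Algebra.TensorProduct.algebraMap_apply']
      exact Weil.d_algebraMap e r
    rw [this]
    exact zero_mem _
  | add x y i hx hy h1 h2 => rw [TensorProduct.tmul_add, map_add]; exact add_mem h1 h2
  | mem_mul m hm i x hx h =>
    obtain ⟨m, rfl⟩ := hm
    have h1 : (1 ⊗ₜ (SymmetricAlgebra.ι ℝ _ m * x) : Weil 𝔤) = Weil.even m * (1 ⊗ₜ x) := by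
      rw [Weil.even_apply, Algebra.TensorProduct.tmul_mul_tmul, one_mul]
    have h2 : (1 ⊗ₜ x : Weil 𝔤) ∈ Weil.degree 𝔤 (2 * i) :=
      Weil.tmul_mem_degree (p := 0) (q := i) (by omega) one_mem_exteriorPower_zero hx
    have h3 := Weil.d_mul_mem_degree e (Weil.even_mem_degree m) h2 (Weil.d_even_mem_degree e m) h
    refine h1 ▸ ?_
    rwa [show 2 + 2 * i = 2 * i.succ by omega] at h3

theorem Weil.d_mem_degree {m : ℕ} {w : Weil 𝔤} (hw : w ∈ Weil.degree 𝔤 m) :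
    Weil.d e w ∈ Weil.degree 𝔤 (m + 1) := by
  induction hw using Submodule.span_induction with
  | zero => rw [map_zero]; exact zero_mem _
  | add x y _ _ hx hy => rw [map_add]; exact add_mem hx hy
  | smul r x _ hx => rw [map_smul]; exact Submodule.smul_mem _ _ hx
  | mem x hx =>
    obtain ⟨p, q, h, a, ha, s, hs, rfl⟩ := hx
    have h1 : (a ⊗ₜ s : Weil 𝔤) = (a ⊗ₜ 1) * (1 ⊗ₜ s) := by
      rw [Algebra.TensorProduct.tmul_mul_tmul, one_mul, mul_one]
    rw [h1, ← h]
    refine Weil.d_mul_mem_degree e ?_ ?_ (Weil.d_tmul_one_mem_degree e ha)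
      (Weil.d_one_tmul_mem_degree e hs)
    · exact Weil.tmul_mem_degree (p := p) (q := 0) rfl ha one_mem_range_ι_pow_zero
    · exact Weil.tmul_mem_degree (p := 0) (q := q) (by omega) one_mem_exteriorPower_zero hs

end WeilDegree

/-! ### The tensor product of the Weil algebra with the forms. -/

section ModelBasic

variable {𝔤 : Type*} [AddCommGroup 𝔤] [Module ℝ 𝔤] {R : Type*} [CommRing R] [Algebra ℝ R]

/-- The element `w ⊗ ζ` of the complexified model. -/
noncomputable def Model.mk : Weil 𝔤 →ₗ[ℝ] Forms R →ₗ[ℝ] Model 𝔤 R :=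
  (TensorProduct.mk ℝ (Weil 𝔤) (Forms R)).compr₂
    (TensorProduct.mk ℝ ℂ (RealModel 𝔤 R) 1 ∘ₗ
      (GradedTensorProduct.of ℝ (Weil.grading 𝔤) (Forms.grading R)).toLinearMap)

theorem Model.mk_apply (w : Weil 𝔤) (ζ : Forms R) : Model.mk w ζ =
    1 ⊗ₜ[ℝ] GradedTensorProduct.of ℝ (Weil.grading 𝔤) (Forms.grading R) (w ⊗ₜ ζ) := rfl

theorem Model.induction {P : Model 𝔤 R → Prop} (x : Model 𝔤 R) (zero : P 0)
    (mk : ∀ (w : Weil 𝔤) (k : ℕ), ∀ ζ ∈ Forms.grading R k, P (Model.mk w ζ))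
    (add : ∀ x y, P x → P y → P (x + y)) (smul : ∀ (c : ℂ) x, P x → P (c • x)) : P x := by
  induction x using TensorProduct.induction_on with
  | zero => exact zero
  | add x y hx hy => exact add x y hx hy
  | tmul c y =>
    have hc : (c ⊗ₜ[ℝ] y : Model 𝔤 R) = c • ((1 : ℂ) ⊗ₜ[ℝ] y) := by
      rw [TensorProduct.smul_tmul', smul_eq_mul, mul_one]
    rw [hc]
    refine smul c _ ?_
    clear hc
    change (fun z : Weil 𝔤 ⊗[ℝ] Forms R => P ((1 : ℂ) ⊗ₜ[ℝ]
      GradedTensorProduct.of ℝ (Weil.grading 𝔤) (Forms.grading R) z)) y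
    induction y using TensorProduct.induction_on with
    | zero => simpa using zero
    | add a b ha hb =>
      have h := add _ _ ha hb
      rwa [← TensorProduct.tmul_add, ← map_add] at h
    | tmul w ζ =>
      change P (Model.mk w ζ)
      induction ζ using Forms.induction_on with
      | zero => simpa using zero
      | of k a => exact mk w k _ (Forms.of_mem k a)
      | add a b ha hb =>
        rw [map_add]
        exact add _ _ ha hb

theorem Model.tensorOp_mk (u : Module.End ℝ (Weil 𝔤)) (v : Module.End ℝ (Forms R)) (w : Weil 𝔤)
    (ζ : Forms R) : Model.tensorOp u v (Model.mk w ζ) = Model.mk (u w) (v ζ) := rfl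

theorem Model.end_ext {u v : Module.End ℂ (Model 𝔤 R)}
    (h : ∀ w ζ, u (Model.mk w ζ) = v (Model.mk w ζ)) : u = v := by
  refine LinearMap.ext fun x => ?_
  induction x using Model.induction with
  | zero => rw [map_zero, map_zero]
  | mk w k ζ _ => exact h w ζ
  | add x y hx hy => rw [map_add, map_add, hx, hy]
  | smul c x hx => rw [map_smul, map_smul, hx]

theorem Model.tensorOp_mul (u u' : Module.End ℝ (Weil 𝔤)) (v v' : Module.End ℝ (Forms R)) :
    Model.tensorOp u v * Model.tensorOp u' v' = Model.tensorOp (u * u') (v * v') :=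
  Model.end_ext fun _ _ => rfl

theorem Model.tensorOp_add_left (u u' : Module.End ℝ (Weil 𝔤)) (v : Module.End ℝ (Forms R)) :
    Model.tensorOp (u + u') v = Model.tensorOp u v + Model.tensorOp u' v :=
  Model.end_ext fun w ζ => by
    rw [LinearMap.add_apply]
    simp only [Model.tensorOp_mk, LinearMap.add_apply, map_add]

theorem Model.tensorOp_add_right (u : Module.End ℝ (Weil 𝔤)) (v v' : Module.End ℝ (Forms R)) :
    Model.tensorOp u (v + v') = Model.tensorOp u v + Model.tensorOp u v' :=
  Model.end_ext fun w ζ => by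
    rw [LinearMap.add_apply]
    simp only [Model.tensorOp_mk, LinearMap.add_apply, map_add]

theorem Model.tensorOp_neg_left (u : Module.End ℝ (Weil 𝔤)) (v : Module.End ℝ (Forms R)) :
    Model.tensorOp (-u) v = -Model.tensorOp u v :=
  Model.end_ext fun w ζ => by
    rw [LinearMap.neg_apply, Model.tensorOp_mk, Model.tensorOp_mk, LinearMap.neg_apply]
    exact LinearMap.map_neg₂ Model.mk (u w) (v ζ)

theorem Model.tensorOp_neg_right (u : Module.End ℝ (Weil 𝔤)) (v : Module.End ℝ (Forms R)) :
    Model.tensorOp u (-v) = -Model.tensorOp u v :=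
  Model.end_ext fun w ζ => by
    rw [LinearMap.neg_apply, Model.tensorOp_mk, Model.tensorOp_mk, LinearMap.neg_apply]
    exact map_neg (Model.mk (u w)) (v ζ)

theorem Model.tensorOp_zero_left (v : Module.End ℝ (Forms R)) :
    Model.tensorOp (0 : Module.End ℝ (Weil 𝔤)) v = 0 :=
  Model.end_ext fun _ ζ => LinearMap.map_zero₂ Model.mk (v ζ)

theorem Model.tensorOp_zero_right (u : Module.End ℝ (Weil 𝔤)) :
    Model.tensorOp u (0 : Module.End ℝ (Forms R)) = 0 :=
  Model.end_ext fun w _ => map_zero (Model.mk (u w))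

theorem Weil.parity_pow_of_mem {i : ℕ} {w : Weil 𝔤} (hw : w ∈ Weil.grading 𝔤 i) (j : ℕ) :
    (Weil.parity 𝔤 ^ j) w = (-1 : ℝ) ^ (j * i) • w := by
  induction j with
  | zero => rw [pow_zero, zero_mul, pow_zero, one_smul]; rfl
  | succ j ih =>
    rw [pow_succ, Module.End.mul_apply, Weil.parity_of_mem hw, map_smul, ih, smul_smul, ← pow_add,
      Nat.succ_mul, add_comm]

theorem Weil.induction_grading {P : Weil 𝔤 → Prop} (w : Weil 𝔤) (zero : P 0)
    (mem : ∀ i, ∀ w ∈ Weil.grading 𝔤 i, P w) (add : ∀ a b, P a → P b → P (a + b)) : P w :=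
  DirectSum.Decomposition.inductionOn (ℳ := Weil.grading 𝔤) (motive := P) zero
    (fun {i} m => mem i m m.2) add w

/-- The Koszul sign for moving a j-form past w' is the j-th power of the parity involution applied
to w', so only ζ has to be homogeneous. -/
theorem Model.mk_mul_mk (w w' : Weil 𝔤) {j : ℕ} {ζ : Forms R} (hζ : ζ ∈ Forms.grading R j)
    (ζ' : Forms R) : Model.mk w ζ * Model.mk w' ζ' =
      Model.mk (w * (Weil.parity 𝔤 ^ j) w') (ζ * ζ') := by
  induction w' using Weil.induction_grading with
  | zero => simp
  | add a b ha hb => simp only [map_add, mul_add, LinearMap.add_apply, ha, hb]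
  | mem i w' hw' =>
    rw [Weil.parity_pow_of_mem hw', mul_smul_comm, map_smul, LinearMap.smul_apply]
    have h := GradedTensorProduct.tmul_coe_mul_coe_tmul (Weil.grading 𝔤) (Forms.grading R) w
      (⟨ζ, hζ⟩ : Forms.grading R j) (⟨w', hw'⟩ : Weil.grading 𝔤 i) ζ'
    simp only [Model.mk_apply]
    rw [Algebra.TensorProduct.tmul_mul_tmul, one_mul]
    refine (congrArg (fun z => (1 : ℂ) ⊗ₜ[ℝ] z) h).trans ?_
    change (1 : ℂ) ⊗ₜ[ℝ] ((-1 : ℤˣ) ^ (j * i) • GradedTensorProduct.of ℝ (Weil.grading 𝔤)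
      (Forms.grading R) ((w * w') ⊗ₜ (ζ * ζ'))) = _
    rcases Nat.even_or_odd (j * i) with hp | hp
    · rw [hp.neg_one_pow, one_smul, hp.neg_one_pow, one_smul]
    · rw [hp.neg_one_pow, hp.neg_one_pow, neg_one_smul, Units.neg_smul, one_smul,
        TensorProduct.tmul_neg]

end ModelBasic

/-! ### Antiderivations, and their products with odd elements. -/

section OddDerivation

variable {A : Type*} [Ring A] [Algebra ℂ A]

/-- `v` is an antiderivation with respect to the parity operator `P`. -/
def IsOddDerivation (P v : Module.End ℂ A) : Prop :=
  ∀ a b, v (a * b) = v a * b + P a * v b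

variable {P : Module.End ℂ A}

theorem IsOddDerivation.add {u v : Module.End ℂ A} (hu : IsOddDerivation P u)
    (hv : IsOddDerivation P v) : IsOddDerivation P (u + v) := fun a b => by
  simp only [LinearMap.add_apply, hu a b, hv a b, add_mul, mul_add]
  abel

theorem IsOddDerivation.smul (c : ℂ) {v : Module.End ℂ A} (hv : IsOddDerivation P v) :
    IsOddDerivation P (c • v) := fun a b => by
  simp only [LinearMap.smul_apply, hv a b, smul_add, smul_mul_assoc, mul_smul_comm]

theorem IsOddDerivation.zero : IsOddDerivation P 0 := fun a b => by simp

theorem IsOddDerivation.sum {ι : Type*} (s : Finset ι) {v : ι → Module.End ℂ A}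
    (hv : ∀ i, IsOddDerivation P (v i)) : IsOddDerivation P (∑ i ∈ s, v i) := by
  classical
  induction s using Finset.induction_on with
  | empty => rw [Finset.sum_empty]; exact IsOddDerivation.zero
  | insert i s hi ih => rw [Finset.sum_insert hi]; exact (hv i).add ih

variable {v : Module.End ℂ A} {θ : A}

/-- Left multiplication by an odd element turns an antiderivation into a derivation. -/
theorem IsOddDerivation.mulLeft_mul (hv : IsOddDerivation P v) (hθ : ∀ x, θ * P x = x * θ)
    (a b : A) : (LinearMap.mulLeft ℂ θ * v) (a * b) =
      (LinearMap.mulLeft ℂ θ * v) a * b + a * (LinearMap.mulLeft ℂ θ * v) b := by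
  simp only [Module.End.mul_apply, LinearMap.mulLeft_apply]
  rw [hv, mul_add, ← mul_assoc, ← mul_assoc, hθ, mul_assoc a]

/-- Moving the second θ to the left past v(a) only applies P to v(a) and brings the two factors θ
together. -/
theorem mulLeft_mul_mul_mulLeft_mul (hθ : ∀ x, θ * P x = x * θ) (hθθ : θ * θ = 0) (a b : A) :
    (LinearMap.mulLeft ℂ θ * v) a * (LinearMap.mulLeft ℂ θ * v) b = 0 := by
  simp only [Module.End.mul_apply, LinearMap.mulLeft_apply]
  rw [mul_assoc, ← mul_assoc (v a), ← hθ, ← mul_assoc, ← mul_assoc, hθθ, zero_mul, zero_mul]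

end OddDerivation

/-! ### The differential and the twisted contractions as antiderivations. -/

section ModelDerivations

variable {𝔤 : Type*} [AddCommGroup 𝔤] [Module ℝ 𝔤] {R : Type*} [CommRing R] [Algebra ℝ R]

theorem Forms.one_mem_grading : (1 : Forms R) ∈ Forms.grading R 0 :=
  SetLike.GradedOne.one_mem (A := Forms.grading R)

theorem Model.leftMul_eq (w : Weil 𝔤) :
    (Model.leftMul w : Module.End ℂ (Model 𝔤 R)) =
      Model.tensorOp (LinearMap.mulLeft ℝ w) LinearMap.id :=
  Model.end_ext fun w' ζ => by
    change Model.mk w 1 * Model.mk w' ζ = Model.mk (w * w') ζ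
    rw [Model.mk_mul_mk w w' Forms.one_mem_grading, pow_zero, one_mul]
    rfl

variable (𝔤 R) in
/-- The parity involution of the model. -/
noncomputable def Model.parity : Module.End ℂ (Model 𝔤 R) :=
  Model.tensorOp (Weil.parity 𝔤) Forms.parity

theorem Model.real_neg_one_pow_smul (m : ℕ) (x : Model 𝔤 R) :
    (-1 : ℝ) ^ m • x = (-1 : ℂ) ^ m • x := by
  rcases Nat.even_or_odd m with h | h
  · rw [h.neg_one_pow, h.neg_one_pow, one_smul, one_smul]
  · rw [h.neg_one_pow, h.neg_one_pow, neg_one_smul, neg_one_smul]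

theorem Model.parity_mk (w : Weil 𝔤) {j : ℕ} {ζ : Forms R} (hζ : ζ ∈ Forms.grading R j) :
    Model.parity 𝔤 R (Model.mk w ζ) = (-1 : ℝ) ^ j • Model.mk (Weil.parity 𝔤 w) ζ := by
  rw [Model.parity, Model.tensorOp_mk, Forms.parity_of_mem hζ, map_smul]

/-- Both sides are bilinear, so pure tensors suffice; the hypothesis is the product rule with the
signs of the multiplication and of the parity written out. -/
theorem Model.isOddDerivation_of_mk {v : Module.End ℂ (Model 𝔤 R)}
    (h : ∀ w w' : Weil 𝔤, ∀ j, ∀ ζ ∈ Forms.grading R j, ∀ ζ' : Forms R,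
      v (Model.mk (w * (Weil.parity 𝔤 ^ j) w') (ζ * ζ')) =
        v (Model.mk w ζ) * Model.mk w' ζ' +
          (-1 : ℝ) ^ j • (Model.mk (Weil.parity 𝔤 w) ζ * v (Model.mk w' ζ'))) :
    IsOddDerivation (Model.parity 𝔤 R) v := by
  intro a b
  induction a using Model.induction with
  | zero => simp only [map_zero, zero_mul, add_zero]
  | add x y hx hy => simp only [map_add, add_mul, hx, hy]; abel
  | smul c x hx => simp only [map_smul, smul_mul_assoc, hx, smul_add]
  | mk w j ζ hζ =>
    induction b using Model.induction with
    | zero => simp only [map_zero, mul_zero, add_zero]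
    | add x y hx hy => simp only [map_add, mul_add, hx, hy]; abel
    | smul c x hx => simp only [map_smul, mul_smul_comm, hx, smul_add]
    | mk w' j' ζ' _ =>
      rw [Model.mk_mul_mk w w' hζ, Model.parity_mk w hζ, h w w' j ζ hζ ζ', smul_mul_assoc]

theorem Weil.d_parity_pow [Bracket 𝔤 𝔤] {n : ℕ} (e : Module.Basis (Fin n) ℝ 𝔤) (j : ℕ)
    (w : Weil 𝔤) : Weil.d e ((Weil.parity 𝔤 ^ j) w) =
      (-1 : ℝ) ^ j • (Weil.parity 𝔤 ^ j) (Weil.d e w) := by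
  induction j with
  | zero => rw [pow_zero, pow_zero, one_smul]; rfl
  | succ j ih =>
    rw [pow_succ', Module.End.mul_apply, Weil.d_parity, ih, map_smul, pow_succ',
      Module.End.mul_apply, mul_smul, neg_one_smul]

theorem Model.isOddDerivation_d_left [Bracket 𝔤 𝔤] {n : ℕ} (e : Module.Basis (Fin n) ℝ 𝔤) :
    IsOddDerivation (Model.parity 𝔤 R) (Model.tensorOp (Weil.d e) LinearMap.id) := by
  refine Model.isOddDerivation_of_mk fun w w' j ζ hζ ζ' => ?_
  simp only [Model.tensorOp_mk, LinearMap.id_apply]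
  rw [Weil.d_mul, Weil.d_parity_pow, Model.mk_mul_mk _ _ hζ, Model.mk_mul_mk _ _ hζ, mul_smul_comm,
    map_add, map_smul, LinearMap.add_apply, LinearMap.smul_apply]

theorem Weil.parity_pow_add_two (j : ℕ) (w : Weil 𝔤) :
    (Weil.parity 𝔤 ^ (j + 2)) w = (Weil.parity 𝔤 ^ j) w := by
  rw [pow_add, Module.End.mul_apply, pow_two, Module.End.mul_apply, Weil.parity_parity]

theorem Weil.parity_parity_pow (j : ℕ) (w : Weil 𝔤) :
    Weil.parity 𝔤 ((Weil.parity 𝔤 ^ j) w) = (Weil.parity 𝔤 ^ (j + 1)) w := by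
  rw [pow_succ', Module.End.mul_apply]

/-- `hw` fixes the degree of v ζ only modulo two, so the lemma serves both d, of degree 1, and
contractions, of degree -1. On functions a contraction is zero and `hw` is trivial. -/
theorem Model.isOddDerivation_oddOp {v : Module.End ℝ (Forms R)}
    (hv : ∀ j, ∀ ζ ∈ Forms.grading R j, ∀ ζ', v (ζ * ζ') = v ζ * ζ' + (-1 : ℝ) ^ j • (ζ * v ζ'))
    (hw : ∀ j, ∀ ζ ∈ Forms.grading R j, ∀ (w w' : Weil 𝔤) ζ',
      Model.mk w (v ζ) * Model.mk w' ζ' = Model.mk (w * (Weil.parity 𝔤 ^ (j + 1)) w') (v ζ * ζ')) :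
    IsOddDerivation (Model.parity 𝔤 R) (Model.oddOp 𝔤 v) := by
  refine Model.isOddDerivation_of_mk fun w w' j ζ hζ ζ' => ?_
  simp only [Model.oddOp, Model.tensorOp_mk]
  rw [hw j ζ hζ, Model.mk_mul_mk _ _ hζ, hv j ζ hζ, map_add, map_smul, Weil.parity_mul,
    Weil.parity_parity_pow, pow_succ, Module.End.mul_apply]

theorem Model.isOddDerivation_d_right :
    IsOddDerivation (Model.parity 𝔤 R) (Model.oddOp 𝔤 Forms.d) :=
  Model.isOddDerivation_oddOp (fun _ _ hζ ζ' => Forms.d_mul hζ ζ')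
    fun _ _ hζ w w' ζ' => Model.mk_mul_mk w w' (Forms.d_mem hζ) ζ'

theorem Model.isOddDerivation_contract (X : Derivation ℝ R R) :
    IsOddDerivation (Model.parity 𝔤 R) (Model.oddOp 𝔤 (Forms.contract X)) := by
  refine Model.isOddDerivation_oddOp (fun _ _ hζ ζ' => Forms.contract_mul X hζ ζ')
    fun j ζ hζ w w' ζ' => ?_
  cases j with
  | zero =>
    rw [Forms.contract_eq_zero X hζ, zero_mul, map_zero, map_zero, zero_mul]
  | succ j =>
    rw [Model.mk_mul_mk w w' (Forms.contract_mem X hζ), Weil.parity_pow_add_two]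

variable {n : ℕ} (e : Module.Basis (Fin n) ℝ 𝔤) (ξ : Fin n → Derivation ℝ R R)
  (f : Fin n → Fin n → ℝ)

theorem Model.isOddDerivation_D [Bracket 𝔤 𝔤] :
    IsOddDerivation (Model.parity 𝔤 R) (Model.D R e) :=
  (Model.isOddDerivation_d_left e).add Model.isOddDerivation_d_right

theorem Model.isOddDerivation_twistedContract (i : Fin n) :
    IsOddDerivation (Model.parity 𝔤 R) (Model.twistedContract 𝔤 ξ f i) :=
  (Model.isOddDerivation_contract _).add
    (IsOddDerivation.sum _ fun j => (Model.isOddDerivation_contract (ξ j)).smul _)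

theorem Model.mk_odd_mul_parity (m : Module.Dual ℝ 𝔤) (x : Model 𝔤 R) :
    Model.mk (Weil.odd m) 1 * Model.parity 𝔤 R x = x * Model.mk (Weil.odd m) 1 := by
  induction x using Model.induction with
  | zero => simp only [map_zero, mul_zero, zero_mul]
  | add x y hx hy => simp only [map_add, mul_add, add_mul, hx, hy]
  | smul c x hx => simp only [map_smul, mul_smul_comm, smul_mul_assoc, hx]
  | mk w j ζ hζ =>
    have h : (Weil.parity 𝔤 ^ j) (Weil.odd m) = (-1 : ℝ) ^ j • Weil.odd m := by
      have hm : Weil.odd m ∈ Weil.grading 𝔤 1 := by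
        refine ⟨⟨ExteriorAlgebra.ι ℝ m, ?_⟩ ⊗ₜ 1, rfl⟩
        change _ ∈ LinearMap.range (ExteriorAlgebra.ι ℝ) ^ 1
        rw [pow_one]
        exact ⟨m, rfl⟩
      rw [Weil.parity_pow_of_mem hm, mul_one]
    rw [Model.parity_mk w hζ, mul_smul_comm, Model.mk_mul_mk _ _ Forms.one_mem_grading,
      Model.mk_mul_mk _ _ hζ, h, pow_zero, Module.End.one_apply, Weil.odd_mul, Weil.parity_parity,
      one_mul, mul_one, mul_smul_comm, map_smul, LinearMap.smul_apply]

theorem Model.mk_odd_mul_self (m : Module.Dual ℝ 𝔤) :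
    (Model.mk (Weil.odd m) 1 * Model.mk (Weil.odd m) 1 : Model 𝔤 R) = 0 := by
  rw [Model.mk_mul_mk _ _ Forms.one_mem_grading, pow_zero, Module.End.one_apply, Weil.odd_mul_self]
  exact LinearMap.map_zero₂ _ _

theorem Model.psiTerm_mul (i : Fin n) (a b : Model 𝔤 R) :
    Model.psiTerm e ξ f i (a * b) = Model.psiTerm e ξ f i a * b + a * Model.psiTerm e ξ f i b :=
  (Model.isOddDerivation_twistedContract ξ f i).mulLeft_mul
    (Model.mk_odd_mul_parity (e.coord i)) a b

theorem Model.psiTerm_mul_psiTerm (i : Fin n) (a b : Model 𝔤 R) :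
    Model.psiTerm e ξ f i a * Model.psiTerm e ξ f i b = 0 :=
  mulLeft_mul_mul_mulLeft_mul (Model.mk_odd_mul_parity (e.coord i))
    (Model.mk_odd_mul_self (e.coord i)) a b

end ModelDerivations

/-! ### The total degree on the model. -/

section ModelDegree

variable {𝔤 : Type*} [AddCommGroup 𝔤] [Module ℝ 𝔤] {R : Type*} [CommRing R] [Algebra ℝ R]

theorem Model.ofReal_smul_eq (r : ℝ) (x : Model 𝔤 R) : r • x = (r : ℂ) • x := by
  induction x using TensorProduct.induction_on with
  | zero => rw [smul_zero, smul_zero]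
  | add x y hx hy => rw [smul_add, smul_add, hx, hy]
  | tmul c y => rw [TensorProduct.smul_tmul', TensorProduct.smul_tmul', Complex.real_smul,
      smul_eq_mul]

theorem Model.mk_mem_degree {l k m : ℕ} (h : l + k = m) {w : Weil 𝔤} (hw : w ∈ Weil.degree 𝔤 l)
    {ζ : Forms R} (hζ : ζ ∈ Forms.grading R k) : Model.mk w ζ ∈ Model.degree 𝔤 R m := by
  subst h
  induction hw using Submodule.span_induction with
  | zero => rw [map_zero]; exact zero_mem _
  | add x y _ _ hx hy => rw [map_add]; exact add_mem hx hy
  | smul r x _ hx =>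
    rw [map_smul, LinearMap.smul_apply, Model.ofReal_smul_eq]
    exact Submodule.smul_mem _ _ hx
  | mem x hx =>
    obtain ⟨p, q, h, a, ha, s, hs, rfl⟩ := hx
    exact Submodule.subset_span ⟨p, q, k, by rw [h], a, ha, s, hs, ζ, hζ, rfl⟩

theorem Model.map_mem {m : ℕ} {u : Module.End ℂ (Model 𝔤 R)} {N : Submodule ℂ (Model 𝔤 R)}
    (h : ∀ l k, l + k = m → ∀ w ∈ Weil.degree 𝔤 l, ∀ ζ ∈ Forms.grading R k, u (Model.mk w ζ) ∈ N)
    {x : Model 𝔤 R} (hx : x ∈ Model.degree 𝔤 R m) : u x ∈ N := by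
  induction hx using Submodule.span_induction with
  | zero => rw [map_zero]; exact zero_mem _
  | add x y _ _ hx hy => rw [map_add]; exact add_mem hx hy
  | smul r x _ hx => rw [map_smul]; exact Submodule.smul_mem _ _ hx
  | mem x hx =>
    obtain ⟨p, q, k, hm, a, ha, s, hs, ζ, hζ, rfl⟩ := hx
    exact h (p + 2 * q) k hm _ (Weil.tmul_mem_degree rfl ha hs) ζ hζ

theorem Model.parity_of_mem {m : ℕ} {x : Model 𝔤 R} (hx : x ∈ Model.degree 𝔤 R m) :
    Model.parity 𝔤 R x = (-1 : ℂ) ^ m • x := by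
  have h : (Model.parity 𝔤 R - (-1 : ℂ) ^ m • 1) x ∈ (⊥ : Submodule ℂ (Model 𝔤 R)) := by
    refine Model.map_mem (fun l k hlk w hw ζ hζ => ?_) hx
    rw [Submodule.mem_bot, LinearMap.sub_apply, LinearMap.smul_apply, Module.End.one_apply,
      sub_eq_zero, Model.parity_mk w hζ, Weil.parity_mem_degree hw, map_smul,
      LinearMap.smul_apply, smul_smul, ← pow_add, add_comm, hlk, Model.real_neg_one_pow_smul]
  rw [Submodule.mem_bot, LinearMap.sub_apply, sub_eq_zero] at h
  exact h

variable {n : ℕ} (e : Module.Basis (Fin n) ℝ 𝔤) (ξ : Fin n → Derivation ℝ R R)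
  (f : Fin n → Fin n → ℝ)

theorem Weil.smul_mem_degree {m : ℕ} (r : ℝ) {w : Weil 𝔤} (hw : w ∈ Weil.degree 𝔤 m) :
    r • w ∈ Weil.degree 𝔤 m := Submodule.smul_mem _ _ hw

theorem Weil.parity_apply_mem_degree {m : ℕ} {w : Weil 𝔤} (hw : w ∈ Weil.degree 𝔤 m) :
    Weil.parity 𝔤 w ∈ Weil.degree 𝔤 m := by
  rw [Weil.parity_mem_degree hw]
  exact Weil.smul_mem_degree _ hw

theorem Model.D_mem [Bracket 𝔤 𝔤] {m : ℕ} {x : Model 𝔤 R} (hx : x ∈ Model.degree 𝔤 R m) :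
    Model.D R e x ∈ Model.degree 𝔤 R (m + 1) := by
  refine Model.map_mem (fun l k hlk w hw ζ hζ => ?_) hx
  rw [Model.D, LinearMap.add_apply, Model.oddOp, Model.tensorOp_mk, Model.tensorOp_mk,
    LinearMap.id_apply]
  exact add_mem (Model.mk_mem_degree (by omega) (Weil.d_mem_degree e hw) hζ)
    (Model.mk_mem_degree (by omega) (Weil.parity_apply_mem_degree hw) (Forms.d_mem hζ))

/-- The odd generator adds one to the degree and the contraction removes one; on functions the
contraction vanishes, so no negative degree occurs. -/
theorem Model.leftMul_odd_oddOp_contract_mem (μ : Module.Dual ℝ 𝔤) (X : Derivation ℝ R R) {m : ℕ}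
    {x : Model 𝔤 R} (hx : x ∈ Model.degree 𝔤 R m) :
    (Model.leftMul (Weil.odd μ) * Model.oddOp 𝔤 (Forms.contract X) :
      Module.End ℂ (Model 𝔤 R)) x ∈ Model.degree 𝔤 R m := by
  refine Model.map_mem (fun l k hlk w hw ζ hζ => ?_) hx
  rw [Model.leftMul_eq, Model.oddOp, Model.tensorOp_mul, Model.tensorOp_mk, Module.End.mul_apply,
    Module.End.mul_apply, LinearMap.id_apply]
  cases k with
  | zero =>
    rw [Forms.contract_eq_zero X hζ, map_zero]
    exact zero_mem _
  | succ k =>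
    exact Model.mk_mem_degree (l := 1 + l) (by omega)
      (Weil.mul_mem_degree (Weil.odd_mem_degree μ) (Weil.parity_apply_mem_degree hw))
      (Forms.contract_mem X hζ)

theorem Model.psiTerm_mem (i : Fin n) {m : ℕ} {x : Model 𝔤 R} (hx : x ∈ Model.degree 𝔤 R m) :
    Model.psiTerm e ξ f i x ∈ Model.degree 𝔤 R m := by
  rw [Model.psiTerm, Model.twistedContract, mul_add, Finset.mul_sum, LinearMap.add_apply,
    LinearMap.sum_apply]
  refine add_mem (Model.leftMul_odd_oddOp_contract_mem _ _ hx) (sum_mem fun j _ => ?_)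
  rw [mul_smul_comm, LinearMap.smul_apply]
  exact Submodule.smul_mem _ _ (Model.leftMul_odd_oddOp_contract_mem _ _ hx)

end ModelDegree

/-! ### Graded commutation relations between the operators. -/

section OperatorRelations

variable {𝔤 : Type*} [AddCommGroup 𝔤] [Module ℝ 𝔤] {R : Type*} [CommRing R] [Algebra ℝ R]

theorem Weil.parity_mul_parity : Weil.parity 𝔤 * Weil.parity 𝔤 = 1 :=
  LinearMap.ext Weil.parity_parity

theorem Weil.parity_mul_mulLeft_odd (m : Module.Dual ℝ 𝔤) :
    Weil.parity 𝔤 * LinearMap.mulLeft ℝ (Weil.odd m) =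
      -(LinearMap.mulLeft ℝ (Weil.odd m) * Weil.parity 𝔤) := LinearMap.ext fun w => by
  rw [LinearMap.neg_apply, Module.End.mul_apply, Module.End.mul_apply, LinearMap.mulLeft_apply,
    LinearMap.mulLeft_apply, Weil.parity_mul, Weil.parity_odd, neg_mul]

/-- Each odd operator on forms carries one parity involution of the Weil factor, and two of them
cancel. The same involution makes odd operators anticommute with θ^i and with d_W. -/
theorem Model.oddOp_mul_oddOp (u v : Module.End ℝ (Forms R)) :
    Model.oddOp 𝔤 u * Model.oddOp 𝔤 v = Model.evenOp 𝔤 (u * v) := by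
  rw [Model.oddOp, Model.oddOp, Model.tensorOp_mul, Weil.parity_mul_parity]
  rfl

theorem Model.evenOp_mul_oddOp (u v : Module.End ℝ (Forms R)) :
    Model.evenOp 𝔤 u * Model.oddOp 𝔤 v = Model.oddOp 𝔤 (u * v) := Model.tensorOp_mul _ _ _ _

theorem Model.oddOp_mul_evenOp (u v : Module.End ℝ (Forms R)) :
    Model.oddOp 𝔤 u * Model.evenOp 𝔤 v = Model.oddOp 𝔤 (u * v) := Model.tensorOp_mul _ _ _ _

theorem Model.oddOp_mul_leftMul_odd (v : Module.End ℝ (Forms R)) (m : Module.Dual ℝ 𝔤) :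
    Model.oddOp 𝔤 v * Model.leftMul (Weil.odd m) =
      -(Model.leftMul (Weil.odd m) * Model.oddOp 𝔤 v) := by
  rw [Model.leftMul_eq, Model.oddOp, Model.tensorOp_mul, Model.tensorOp_mul,
    Weil.parity_mul_mulLeft_odd, Model.tensorOp_neg_left]
  rfl

theorem Model.evenOp_mul_leftMul (v : Module.End ℝ (Forms R)) (w : Weil 𝔤) :
    Model.evenOp 𝔤 v * Model.leftMul w = Model.leftMul w * Model.evenOp 𝔤 v := by
  rw [Model.leftMul_eq, Model.evenOp, Model.tensorOp_mul, Model.tensorOp_mul]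
  rfl

theorem Model.leftMul_mul (w w' : Weil 𝔤) :
    (Model.leftMul (w * w') : Module.End ℂ (Model 𝔤 R)) = Model.leftMul w * Model.leftMul w' := by
  rw [Model.leftMul_eq, Model.leftMul_eq, Model.leftMul_eq, Model.tensorOp_mul,
    LinearMap.mulLeft_mul]
  rfl

theorem Model.leftMul_neg (w : Weil 𝔤) :
    (Model.leftMul (-w) : Module.End ℂ (Model 𝔤 R)) = -Model.leftMul w := by
  rw [Model.leftMul_eq, Model.leftMul_eq, ← Model.tensorOp_neg_left]
  congr 1
  exact LinearMap.ext fun x => neg_mul w x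

theorem Model.leftMul_odd_anticomm (m l : Module.Dual ℝ 𝔤) :
    (Model.leftMul (Weil.odd m) * Model.leftMul (Weil.odd l) : Module.End ℂ (Model 𝔤 R)) =
      -(Model.leftMul (Weil.odd l) * Model.leftMul (Weil.odd m)) := by
  rw [← Model.leftMul_mul, Weil.odd_mul_odd, Model.leftMul_neg, Model.leftMul_mul]

theorem Model.leftMul_odd_mul_self (m : Module.Dual ℝ 𝔤) :
    (Model.leftMul (Weil.odd m) * Model.leftMul (Weil.odd m) : Module.End ℂ (Model 𝔤 R)) = 0 := by
  rw [← Model.leftMul_mul, Weil.odd_mul_self, Model.leftMul_eq, LinearMap.mulLeft_zero_eq_zero,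
    Model.tensorOp_zero_left]

variable {n : ℕ} (e : Module.Basis (Fin n) ℝ 𝔤)

theorem Model.leftMul_d_θ_mul_leftMul [Bracket 𝔤 𝔤] (i : Fin n) (w : Weil 𝔤) :
    (Model.leftMul (Weil.d e (Weil.θ e i)) * Model.leftMul w : Module.End ℂ (Model 𝔤 R)) =
      Model.leftMul w * Model.leftMul (Weil.d e (Weil.θ e i)) := by
  rw [← Model.leftMul_mul, Weil.d_θ_mul, Model.leftMul_mul]

theorem Model.leftMul_d_θ_mul_oddOp [Bracket 𝔤 𝔤] (i : Fin n) (v : Module.End ℝ (Forms R)) :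
    Model.leftMul (Weil.d e (Weil.θ e i)) * Model.oddOp 𝔤 v =
      Model.oddOp 𝔤 v * Model.leftMul (Weil.d e (Weil.θ e i)) := by
  rw [Model.leftMul_eq, Model.oddOp, Model.tensorOp_mul, Model.tensorOp_mul]
  congr 1
  refine LinearMap.ext fun w => ?_
  rw [Module.End.mul_apply, Module.End.mul_apply, LinearMap.mulLeft_apply, LinearMap.mulLeft_apply,
    Weil.parity_mul, Weil.parity_d_θ]

/-- The product rule for d_W gives d_W θ^i; the form part 1 ⊗ d anticommutes with θ^i and
contributes nothing. -/
theorem Model.D_mul_leftMul_θ [Bracket 𝔤 𝔤] (i : Fin n) :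
    Model.D R e * Model.leftMul (Weil.θ e i) + Model.leftMul (Weil.θ e i) * Model.D R e =
      Model.leftMul (Weil.d e (Weil.θ e i)) := by
  have h1 : Weil.d e * LinearMap.mulLeft ℝ (Weil.θ e i) +
      LinearMap.mulLeft ℝ (Weil.θ e i) * Weil.d e =
      LinearMap.mulLeft ℝ (Weil.d e (Weil.θ e i)) := LinearMap.ext fun w => by
    rw [LinearMap.add_apply, Module.End.mul_apply, Module.End.mul_apply, LinearMap.mulLeft_apply,
      LinearMap.mulLeft_apply, LinearMap.mulLeft_apply, Weil.d_θ_mul_eq]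
    exact sub_add_cancel _ _
  rw [Model.D, add_mul, mul_add, Weil.θ_eq, Model.oddOp_mul_leftMul_odd, ← Weil.θ_eq,
    Model.leftMul_eq, Model.leftMul_eq, Model.tensorOp_mul, Model.tensorOp_mul, ← h1,
    Model.tensorOp_add_left]
  change Model.tensorOp _ LinearMap.id + _ + (Model.tensorOp _ LinearMap.id + _) = _
  abel

theorem Weil.d_mul_parity [Bracket 𝔤 𝔤] :
    Weil.d e * Weil.parity 𝔤 = -(Weil.parity 𝔤 * Weil.d e) := LinearMap.ext fun w => by
  rw [LinearMap.neg_apply, Module.End.mul_apply, Module.End.mul_apply, Weil.d_parity]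

theorem Model.d_left_mul_oddOp [Bracket 𝔤 𝔤] (v : Module.End ℝ (Forms R)) :
    Model.tensorOp (Weil.d e) LinearMap.id * Model.oddOp 𝔤 v =
      -(Model.oddOp 𝔤 v * Model.tensorOp (Weil.d e) LinearMap.id) := by
  rw [Model.oddOp, Model.tensorOp_mul, Model.tensorOp_mul, Weil.d_mul_parity,
    Model.tensorOp_neg_left]
  rfl

theorem Model.evenOp_add (u v : Module.End ℝ (Forms R)) :
    Model.evenOp 𝔤 (u + v) = Model.evenOp 𝔤 u + Model.evenOp 𝔤 v := Model.tensorOp_add_right _ _ _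

/-- Cartan's formula on the form factor; d_W ⊗ 1 anticommutes with odd operators and drops out. -/
theorem Model.D_mul_oddOp_contract [Bracket 𝔤 𝔤] (X : Derivation ℝ R R) :
    Model.D R e * Model.oddOp 𝔤 (Forms.contract X) +
      Model.oddOp 𝔤 (Forms.contract X) * Model.D R e =
        Model.evenOp 𝔤 (Forms.lieDerivative X) := by
  have h : Forms.d * Forms.contract X + Forms.contract X * Forms.d = Forms.lieDerivative X :=
    LinearMap.ext fun x => by
      rw [LinearMap.add_apply, Module.End.mul_apply, Module.End.mul_apply, Forms.contract_d]
      exact add_sub_cancel _ _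
  rw [Model.D, add_mul, mul_add, Model.d_left_mul_oddOp, Model.oddOp_mul_oddOp,
    Model.oddOp_mul_oddOp, ← h, Model.evenOp_add]
  abel

/-- Both squares vanish, and d_W ⊗ 1 anticommutes with 1 ⊗ d. -/
theorem Model.D_mul_D [Bracket 𝔤 𝔤] (hc : IsJacobi (structureConstant e)) :
    Model.D R e * Model.D R e = 0 := by
  have h1 : Weil.d e * Weil.d e = 0 := LinearMap.ext (Weil.d_d hc)
  have h2 : (Forms.d * Forms.d : Module.End ℝ (Forms R)) = 0 := LinearMap.ext Forms.d_d
  rw [Model.D, add_mul, mul_add, mul_add, Model.d_left_mul_oddOp, Model.oddOp_mul_oddOp,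
    Model.tensorOp_mul, h1, h2, Model.evenOp, Model.tensorOp_zero_left, Model.tensorOp_zero_right]
  abel

theorem Model.isDifferentialGradedAlgebra_D [Bracket 𝔤 𝔤] (hc : IsJacobi (structureConstant e)) :
    IsDifferentialGradedAlgebra (Model.degree 𝔤 R) (Model.D R e) where
  map_degree _ _ := Model.D_mem e
  leibniz m a ha b := by
    rw [Model.isOddDerivation_D e a b, Model.parity_of_mem ha, smul_mul_assoc]
  sq_eq_zero := LinearMap.congr_fun (Model.D_mul_D e hc)

theorem Model.oddOp_contract_anticomm (X Y : Derivation ℝ R R) :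
    Model.oddOp 𝔤 (Forms.contract X) * Model.oddOp 𝔤 (Forms.contract Y) =
      -(Model.oddOp 𝔤 (Forms.contract Y) * Model.oddOp 𝔤 (Forms.contract X)) := by
  rw [Model.oddOp_mul_oddOp, Model.oddOp_mul_oddOp, Model.evenOp, Model.evenOp,
    ← Model.tensorOp_neg_right]
  congr 1
  exact LinearMap.ext fun x => Forms.contract_contract X Y x

theorem Model.evenOp_lieDerivative_comm (X Y : Derivation ℝ R R) :
    Model.evenOp 𝔤 (Forms.lieDerivative X) * Model.oddOp 𝔤 (Forms.contract Y) -
      Model.oddOp 𝔤 (Forms.contract Y) * Model.evenOp 𝔤 (Forms.lieDerivative X) =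
        Model.oddOp 𝔤 (Forms.contract ⁅X, Y⁆) := by
  rw [sub_eq_iff_eq_add, Model.evenOp_mul_oddOp, Model.oddOp_mul_evenOp, Model.oddOp, Model.oddOp,
    Model.oddOp, ← Model.tensorOp_add_right]
  congr 1
  refine LinearMap.ext fun x => ?_
  rw [LinearMap.add_apply, Module.End.mul_apply, Module.End.mul_apply, Forms.contract_lieDerivative]
  exact (add_sub_cancel _ _).symm

theorem Forms.contract_neg (X : Derivation ℝ R R) : Forms.contract (-X) = -Forms.contract X := by
  refine Forms.hom_ext fun k a => ?_
  rw [LinearMap.neg_apply]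
  cases k with
  | zero => rw [Forms.contract_of_zero, Forms.contract_of_zero, neg_zero]
  | succ k =>
    rw [Forms.contract_of_succ, Forms.contract_of_succ, ← map_neg]
    congr 1
    exact map_neg a.curryLeft X

theorem Model.oddOp_contract_lie_skew (X Y : Derivation ℝ R R) :
    Model.oddOp 𝔤 (Forms.contract ⁅X, Y⁆) = -Model.oddOp 𝔤 (Forms.contract ⁅Y, X⁆) := by
  rw [← lie_skew, Forms.contract_neg, Model.oddOp, Model.tensorOp_neg_right]
  rfl

end OperatorRelations

/-! ### Exponentials of nilpotent elements. -/

section Exponential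

variable {S : Type*} [Ring S] [Module ℚ S]

theorem exp_mulLeft {a : S} (ha : IsNilpotent a) :
    IsNilpotent.exp (LinearMap.mulLeft ℤ a) = LinearMap.mulLeft ℤ (IsNilpotent.exp a) := by
  obtain ⟨k, hk⟩ := ha
  have hk' : LinearMap.mulLeft ℤ a ^ k = 0 := by
    rw [LinearMap.pow_mulLeft, hk, LinearMap.mulLeft_zero_eq_zero]
  rw [IsNilpotent.exp_eq_sum hk, IsNilpotent.exp_eq_sum hk']
  refine LinearMap.ext fun x => ?_
  simp only [LinearMap.sum_apply, LinearMap.smul_apply, LinearMap.mulLeft_apply,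
    LinearMap.pow_mulLeft, Finset.sum_mul, smul_mul_assoc]

theorem exp_mulRight {a : S} (ha : IsNilpotent a) :
    IsNilpotent.exp (LinearMap.mulRight ℤ a) = LinearMap.mulRight ℤ (IsNilpotent.exp a) := by
  obtain ⟨k, hk⟩ := ha
  have hk' : LinearMap.mulRight ℤ a ^ k = 0 := by
    rw [LinearMap.pow_mulRight, hk, LinearMap.mulRight_zero_eq_zero]
  rw [IsNilpotent.exp_eq_sum hk, IsNilpotent.exp_eq_sum hk']
  refine LinearMap.ext fun x => ?_
  simp only [LinearMap.sum_apply, LinearMap.smul_apply, LinearMap.mulRight_apply,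
    LinearMap.pow_mulRight, Finset.mul_sum, mul_smul_comm]

/-- This is e^a x e^{-a} = e^{ad a} x, whose series stops after the quadratic term because ad(a)³ x
= 0. -/
theorem exp_mul_eq_mul_exp {a x y z : S} (ha : IsNilpotent a) (hx : a * x - x * a = y)
    (hy : a * y - y * a = z) (hz : a * z - z * a = 0) :
    IsNilpotent.exp a * x = (x + y + (2⁻¹ : ℚ) • z) * IsNilpotent.exp a := by
  set L := LinearMap.mulLeft ℤ a
  set Q := LinearMap.mulRight ℤ a
  have hl : IsNilpotent L := by rwa [LinearMap.isNilpotent_mulLeft_iff]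
  have hr : IsNilpotent Q := by rwa [LinearMap.isNilpotent_mulRight_iff]
  have hLQ : Commute L Q := LinearMap.commute_mulLeft_right a a
  have had : IsNilpotent (L - Q) := hLQ.isNilpotent_sub hl hr
  have h3 : ((L - Q) ^ 3) • x = 0 := by
    change (L - Q) ((L - Q) ((L - Q) x)) = 0
    change a * (a * (a * x - x * a) - (a * x - x * a) * a) -
      (a * (a * x - x * a) - (a * x - x * a) * a) * a = 0
    rw [hx, hy, hz]
  have hsum := IsNilpotent.exp_smul_eq_sum h3 had
  -- Left multiplication is L = Q + (L - Q), with Q right multiplication and L - Q = ad a; they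
  -- commute, so e^L = e^Q e^{ad a}.
  have key := IsNilpotent.exp_add_of_commute (hLQ.symm.sub_right (Commute.refl Q)) hr had
  rw [add_sub_cancel, exp_mulLeft ha, exp_mulRight ha] at key
  have key' := LinearMap.congr_fun key x
  rw [Module.End.mul_apply, LinearMap.mulLeft_apply, LinearMap.mulRight_apply] at key'
  rw [key']
  congr 1
  refine Eq.trans hsum ?_
  have h1 : (L - Q) x = y := hx
  have h2 : (L - Q) y = z := hy
  simp [Finset.sum_range_succ, pow_two, Nat.factorial, h1, h2, -LinearMap.sub_apply]

/-- Since T_i² = 0, each factor 1 - T_i is already exp(-T_i), and exponentials of commuting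
nilpotents multiply. -/
theorem prod_ofFn_one_sub_eq_exp {n : ℕ} {T : Fin n → S} (hT : ∀ i, T i * T i = 0)
    (hcomm : ∀ i j, Commute (T i) (T j)) :
    (List.ofFn fun i => 1 - T i).prod = IsNilpotent.exp (-∑ i, T i) := by
  induction n with
  | zero => simp
  | succ n ih =>
    have hnil : ∀ i, IsNilpotent (-T i) := fun i => IsNilpotent.neg ⟨2, by rw [pow_two, hT]⟩
    rw [List.ofFn_succ, List.prod_cons, ih (fun i => hT _) fun i j => hcomm _ _, Fin.sum_univ_succ,
      neg_add, IsNilpotent.exp_add_of_commute]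
    · congr 1
      have h2 : (-T 0) ^ 2 = 0 := by rw [neg_sq, pow_two, hT]
      rw [IsNilpotent.exp_eq_sum h2]
      simp [Finset.sum_range_succ, sub_eq_add_neg]
    · exact ((Commute.sum_right _ _ _ fun i _ => hcomm 0 _).neg_left).neg_right
    · exact hnil 0
    · rw [← Finset.sum_neg_distrib]
      exact Commute.isNilpotent_sum (fun i _ => hnil _)
        fun i j _ _ => ((hcomm _ _).neg_left).neg_right

end Exponential

/-! ### The commutators with K in an abstract ring. -/

section TwistedOperators

variable {S : Type*} [Ring S] {n : ℕ} {t A B Θ : Fin n → S} {D : S}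

theorem mul_mul_mul_of_anticomm (hAt : ∀ i j, A i * t j = -(t j * A i)) (i j : Fin n) :
    t i * A i * (t j * A j) = -(t i * t j * (A i * A j)) := by
  rw [mul_assoc, ← mul_assoc (A i), hAt]
  noncomm_ring

theorem commute_mul_of_anticomm (ht : ∀ i j, t i * t j = -(t j * t i))
    (hA : ∀ i j, A i * A j = -(A j * A i)) (hAt : ∀ i j, A i * t j = -(t j * A i)) (i j : Fin n) :
    Commute (t i * A i) (t j * A j) := by
  rw [Commute, SemiconjBy, mul_mul_mul_of_anticomm hAt, mul_mul_mul_of_anticomm hAt, ht j i,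
    hA j i, neg_mul_neg]

theorem mul_mul_self_eq_zero (htt : ∀ i, t i * t i = 0)
    (hAt : ∀ i j, A i * t j = -(t j * A i)) (i : Fin n) : t i * A i * (t i * A i) = 0 := by
  rw [mul_mul_mul_of_anticomm hAt, htt, zero_mul, neg_zero]

/-- Moving D through t_i A_i takes two graded exchanges, so the sign returns to plus and the two
corrections Θ_i A_i and t_i B_i remain. -/
theorem sum_mul_sub_mul_sum (hDt : ∀ i, D * t i + t i * D = Θ i)
    (hDA : ∀ i, D * A i + A i * D = B i) :
    (∑ i, t i * A i) * D - D * ∑ i, t i * A i = ∑ i, (t i * B i - Θ i * A i) := by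
  rw [Finset.sum_mul, Finset.mul_sum, ← Finset.sum_sub_distrib]
  refine Finset.sum_congr rfl fun i _ => ?_
  rw [← hDt, ← hDA]
  noncomm_ring

theorem sum_mul_sum_sub_sum_mul_sum (x y : Fin n → S) :
    (∑ i, x i) * ∑ j, y j - (∑ j, y j) * ∑ i, x i = ∑ i, ∑ j, (x i * y j - y j * x i) := by
  rw [Finset.sum_mul_sum, Finset.sum_mul_sum, Finset.sum_comm (f := fun i j => y i * x j)]
  simp only [Finset.sum_sub_distrib]

/-- The Θ-terms drop out: Θ_k commutes with every t_j and A_j, and the t_j A_j commute with each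
other after the two sign changes. Skewness in j, k brings the rest to the stated order of indices.
-/
theorem sum_mul_sum_sub (ht : ∀ i j, t i * t j = -(t j * t i))
    (hA : ∀ i j, A i * A j = -(A j * A i)) (hAt : ∀ i j, A i * t j = -(t j * A i))
    (hBt : ∀ i j, B i * t j = t j * B i) (hΘt : ∀ i j, Θ i * t j = t j * Θ i)
    (hΘA : ∀ i j, Θ i * A j = A j * Θ i)
    (hC : ∀ j k, B j * A k - A k * B j = -(B k * A j - A j * B k)) :
    (∑ i, t i * A i) * ∑ i, (t i * B i - Θ i * A i) -
      (∑ i, (t i * B i - Θ i * A i)) * ∑ i, t i * A i =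
      -∑ j, ∑ k, t j * t k * (B j * A k - A k * B j) := by
  rw [sum_mul_sum_sub_sum_mul_sum, ← Finset.sum_neg_distrib]
  refine Finset.sum_congr rfl fun j _ => ?_
  rw [← Finset.sum_neg_distrib]
  refine Finset.sum_congr rfl fun k _ => ?_
  have h1 : t j * A j * (t k * B k) = -(t j * t k * (A j * B k)) := by
    rw [mul_assoc, ← mul_assoc (A j), hAt]
    noncomm_ring
  have h2 : t k * B k * (t j * A j) = -(t j * t k * (B k * A j)) := by
    rw [mul_assoc, ← mul_assoc (B k), hBt, mul_assoc, ← mul_assoc, ht k j, neg_mul]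
  have h3 : t j * A j * (Θ k * A k) = Θ k * (t j * (A j * A k)) := by
    rw [mul_assoc, ← mul_assoc (A j), ← hΘA, mul_assoc (Θ k), ← mul_assoc, ← hΘt, mul_assoc]
  have h4 : Θ k * A k * (t j * A j) = Θ k * (t j * (A j * A k)) := by
    rw [mul_assoc, ← mul_assoc (A k), hAt, hA j k, mul_neg, neg_mul, mul_assoc]
  rw [hC, mul_sub, sub_mul, h1, h2, h3, h4]
  noncomm_ring

/-- Each t_i A_i commutes with each t_j t_k C_{jk}, because passing any factor through the other
product costs two signs or none in total. -/
theorem sum_mul_sum_sum_sub (ht : ∀ i j, t i * t j = -(t j * t i))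
    (hAt : ∀ i j, A i * t j = -(t j * A i)) {C : Fin n → Fin n → S}
    (hCt : ∀ j k i, C j k * t i = -(t i * C j k)) (hCA : ∀ j k i, C j k * A i = -(A i * C j k)) :
    (∑ i, t i * A i) * ∑ j, ∑ k, t j * t k * C j k -
      (∑ j, ∑ k, t j * t k * C j k) * ∑ i, t i * A i = 0 := by
  have h : ∀ i j k, t i * A i * (t j * t k * C j k) = t j * t k * C j k * (t i * A i) := by
    intro i j k
    have h1 : A i * (t j * t k) = t j * t k * A i := by
      rw [← mul_assoc, hAt, neg_mul, mul_assoc, hAt, mul_neg, neg_neg, mul_assoc]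
    have h2 : t i * (t j * t k) = t j * t k * t i := by
      rw [← mul_assoc, ht, neg_mul, mul_assoc, ht i, mul_neg, neg_neg, mul_assoc]
    have h3 : C j k * (t i * A i) = t i * A i * C j k := by
      rw [← mul_assoc, hCt, neg_mul, mul_assoc, hCA, mul_neg, neg_neg, mul_assoc]
    rw [mul_assoc _ (C j k), h3, mul_assoc (t i), ← mul_assoc (A i), h1, ← mul_assoc,
      ← mul_assoc, h2]
    noncomm_ring
  exact sub_eq_zero.2 (Commute.sum_left _ _ _ fun i _ => Commute.sum_right _ _ _ fun j _ =>
    Commute.sum_right _ _ _ fun k _ => h i j k).eq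

/-- Relates the sum over j < k in δ to the sum over all pairs that the double commutator produces.
-/
theorem sum_sum_Ioi_add_self {N : Type*} [AddCommGroup N] (s : Fin n → Fin n → N)
    (hs : ∀ j k, s j k = s k j) (h0 : ∀ j, s j j = 0) :
    (∑ j, ∑ k ∈ Finset.Ioi j, s j k) + ∑ j, ∑ k ∈ Finset.Ioi j, s j k = ∑ j, ∑ k, s j k := by
  have h1 : ∑ j, ∑ k ∈ Finset.Ioi j, s j k = ∑ j, ∑ k, if j < k then s j k else 0 := by
    refine Finset.sum_congr rfl fun j _ => ?_
    rw [← Finset.sum_filter]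
    exact Finset.sum_congr (by ext; simp) fun _ _ => rfl
  have h2 : ∑ j, ∑ k ∈ Finset.Ioi j, s j k = ∑ j, ∑ k, if k < j then s j k else 0 := by
    rw [h1, Finset.sum_comm]
    exact Finset.sum_congr rfl fun j _ => Finset.sum_congr rfl fun k _ => by rw [hs]
  conv_lhs => rw [h2]
  conv_lhs => arg 1; rw [← h2, h1]
  simp only [← Finset.sum_add_distrib]
  refine Finset.sum_congr rfl fun j _ => Finset.sum_congr rfl fun k _ => ?_
  rcases lt_trichotomy j k with h | h | h
  · rw [if_pos h, if_neg h.asymm, add_zero]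
  · subst h
    rw [if_neg (lt_irrefl _), h0, add_zero]
  · rw [if_pos h, if_neg h.asymm, zero_add]

/-- The exponential of `-∑ t i * A i` intertwines `D` with its twisted version. -/
theorem exp_neg_mul_eq_mul_exp_neg [Module ℚ S] (ht : ∀ i j, t i * t j = -(t j * t i))
    (htt : ∀ i, t i * t i = 0)
    (hA : ∀ i j, A i * A j = -(A j * A i)) (hAt : ∀ i j, A i * t j = -(t j * A i))
    (hBt : ∀ i j, B i * t j = t j * B i) (hDt : ∀ i, D * t i + t i * D = Θ i)
    (hDA : ∀ i, D * A i + A i * D = B i) (hΘt : ∀ i j, Θ i * t j = t j * Θ i)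
    (hΘA : ∀ i j, Θ i * A j = A j * Θ i)
    (hC : ∀ j k, B j * A k - A k * B j = -(B k * A j - A j * B k))
    (hCA : ∀ j k l, (B j * A k - A k * B j) * A l = -(A l * (B j * A k - A k * B j))) :
    IsNilpotent.exp (-∑ i, t i * A i) *
      (D + ∑ i, (t i * B i - Θ i * A i) -
        ∑ j, ∑ k ∈ Finset.Ioi j, t j * t k * (B j * A k - A k * B j)) =
      D * IsNilpotent.exp (-∑ i, t i * A i) := by
  have hK : IsNilpotent (∑ i, t i * A i) :=
    Commute.isNilpotent_sum (fun i _ => ⟨2, by rw [pow_two, mul_mul_self_eq_zero htt hAt]⟩)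
      fun i j _ _ => commute_mul_of_anticomm ht hA hAt i j
  -- B commutes with t and A anticommutes with it, so their commutator anticommutes with t.
  have hCt : ∀ j k i, (B j * A k - A k * B j) * t i = -(t i * (B j * A k - A k * B j)) := by
    intro j k i
    rw [sub_mul, mul_assoc, mul_assoc, hAt, hBt, mul_neg, ← mul_assoc, ← mul_assoc, hBt, hAt]
    noncomm_ring
  have hs := sum_sum_Ioi_add_self (fun j k => t j * t k * (B j * A k - A k * B j))
    (fun j k => by rw [ht, hC, neg_mul_neg]) fun j => by rw [htt, zero_mul]
  have e1 := sum_mul_sub_mul_sum hDt hDA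
  have e2 := sum_mul_sum_sub ht hA hAt hBt hΘt hΘA hC
  have e3 := sum_mul_sum_sum_sub ht hAt hCt hCA
  rw [← hs] at e2 e3
  set K := ∑ i, t i * A i
  set E := ∑ i, (t i * B i - Θ i * A i)
  set F := ∑ j, ∑ k ∈ Finset.Ioi j, t j * t k * (B j * A k - A k * B j)
  -- `e3` concerns the sum over all pairs, which is F + F; halving uses the rational scalars.
  have hF : K * F - F * K = 0 := by
    have h : (2 : ℚ) • (K * F - F * K) = 0 := by
      rw [two_smul, ← e3]
      noncomm_ring
    simpa using h
  -- With [K, D] = E, [K, E] = -2F and [K, F] = 0, the iterated commutators of D + E - F with -K are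
  -- y = -E + 2F and z = -2F, so x + y + z/2 = D.
  have hx : -K * (D + E - F) - (D + E - F) * -K = -E + (F + F) + (K * F - F * K) := by
    rw [← e1] at e2 ⊢
    have : -K * (D + (K * D - D * K) - F) - (D + (K * D - D * K) - F) * -K =
      -(K * D - D * K) - (K * (K * D - D * K) - (K * D - D * K) * K) + (K * F - F * K) := by
      noncomm_ring
    rw [this, e2, sub_neg_eq_add]
  rw [hF, add_zero] at hx
  have hy : -K * (-E + (F + F)) - (-E + (F + F)) * -K = -(F + F) := by
    have : -K * (-E + (F + F)) - (-E + (F + F)) * -K =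
      (K * E - E * K) - (K * F - F * K) - (K * F - F * K) := by noncomm_ring
    rw [this, e2, hF, sub_zero, sub_zero]
  have hz : -K * (-(F + F)) - (-(F + F)) * -K = 0 := by
    have : -K * (-(F + F)) - (-(F + F)) * -K = (K * F - F * K) + (K * F - F * K) := by
      noncomm_ring
    rw [this, hF, add_zero]
  rw [exp_mul_eq_mul_exp hK.neg hx hy hz]
  congr 1
  have : (2⁻¹ : ℚ) • -(F + F) = -F := by
    rw [← two_smul ℚ F, ← smul_neg, smul_smul]
    norm_num
  rw [this]
  abel

end TwistedOperators

/-! ### Passing from operators to their linear combinations. -/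

section LinearCombination

variable {S : Type*} [Ring S] [Algebra ℂ S] {n : ℕ} (g : Fin n → Fin n → ℂ) {a b : Fin n → S}

theorem sum_smul_anticomm {x : S} (c : Fin n → ℂ) (h : ∀ j, a j * x = -(x * a j)) :
    (∑ j, c j • a j) * x = -(x * ∑ j, c j • a j) := by
  simp only [Finset.sum_mul, Finset.mul_sum, smul_mul_assoc, mul_smul_comm, h, smul_neg,
    Finset.sum_neg_distrib]

theorem anticomm_sum_smul {x : S} (c : Fin n → ℂ) (h : ∀ j, x * a j = -(a j * x)) :
    x * (∑ j, c j • a j) = -((∑ j, c j • a j) * x) := by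
  simp only [Finset.sum_mul, Finset.mul_sum, smul_mul_assoc, mul_smul_comm, h, smul_neg,
    Finset.sum_neg_distrib]

theorem sum_smul_comm {x : S} (c : Fin n → ℂ) (h : ∀ j, a j * x = x * a j) :
    (∑ j, c j • a j) * x = x * ∑ j, c j • a j := by
  simp only [Finset.sum_mul, Finset.mul_sum, smul_mul_assoc, mul_smul_comm, h]

theorem sum_smul_sum_smul_anticomm (ha : ∀ i j, a i * a j = -(a j * a i)) (i j : Fin n) :
    (∑ l, g i l • a l) * (∑ l, g j l • a l) = -((∑ l, g j l • a l) * (∑ l, g i l • a l)) :=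
  sum_smul_anticomm (g i) fun l => anticomm_sum_smul (g j) (ha l)

theorem mul_sum_smul_add {D : S} (c : Fin n → ℂ) (h : ∀ j, D * a j + a j * D = b j) :
    D * (∑ j, c j • a j) + (∑ j, c j • a j) * D = ∑ j, c j • b j := by
  simp only [Finset.sum_mul, Finset.mul_sum, smul_mul_assoc, mul_smul_comm,
    ← Finset.sum_add_distrib, ← smul_add, h]

theorem sum_smul_mul_sub (j k : Fin n) :
    (∑ l, g j l • b l) * (∑ m, g k m • a m) - (∑ m, g k m • a m) * (∑ l, g j l • b l) =
      ∑ l, ∑ m, (g j l * g k m) • (b l * a m - a m * b l) := by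
  rw [sum_mul_sum_sub_sum_mul_sum]
  refine Finset.sum_congr rfl fun l _ => Finset.sum_congr rfl fun m _ => ?_
  rw [smul_mul_smul_comm, smul_mul_smul_comm, mul_comm (g k m), smul_sub]

/-- The commutator is bilinear in the two rows of coefficients, so exchanging j and k amounts to
exchanging the summation indices, where skewness is known. -/
theorem sum_smul_mul_sub_skew (h : ∀ l m, b l * a m - a m * b l = -(b m * a l - a l * b m))
    (j k : Fin n) :
    (∑ l, g j l • b l) * (∑ m, g k m • a m) - (∑ m, g k m • a m) * (∑ l, g j l • b l) =
      -((∑ l, g k l • b l) * (∑ m, g j m • a m) - (∑ m, g j m • a m) * (∑ l, g k l • b l)) := by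
  rw [sum_smul_mul_sub, sum_smul_mul_sub, Finset.sum_comm, ← Finset.sum_neg_distrib]
  refine Finset.sum_congr rfl fun l _ => ?_
  rw [← Finset.sum_neg_distrib]
  refine Finset.sum_congr rfl fun m _ => ?_
  rw [h, smul_neg, mul_comm]

theorem sum_smul_mul_sub_anticomm
    (h : ∀ l m i, (b l * a m - a m * b l) * a i = -(a i * (b l * a m - a m * b l)))
    (j k i : Fin n) :
    ((∑ l, g j l • b l) * (∑ m, g k m • a m) - (∑ m, g k m • a m) * (∑ l, g j l • b l)) *
      (∑ l, g i l • a l) =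
      -((∑ l, g i l • a l) *
        ((∑ l, g j l • b l) * (∑ m, g k m • a m) - (∑ m, g k m • a m) * (∑ l, g j l • b l))) := by
  refine anticomm_sum_smul (g i) fun p => ?_
  rw [sum_smul_mul_sub]
  simp only [Finset.sum_mul, Finset.mul_sum, smul_mul_assoc, mul_smul_comm, h, smul_neg,
    Finset.sum_neg_distrib]

end LinearCombination

/-! ### The twisted BRST operator as a conjugate of D. -/

section TwistedModel

variable {𝔤 : Type*} [AddCommGroup 𝔤] [Module ℝ 𝔤] {R : Type*} [CommRing R] [Algebra ℝ R]
  {n : ℕ} (e : Module.Basis (Fin n) ℝ 𝔤) (ξ : Fin n → Derivation ℝ R R) (f : Fin n → Fin n → ℝ)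

/-- The coefficients `δ_i^j + √-1 f_i^j` of the twisted operators. -/
noncomputable def twistCoeff (i j : Fin n) : ℂ :=
  (if i = j then 1 else 0) + Complex.I * (f i j : ℂ)

theorem sum_twistCoeff_smul {S : Type*} [AddCommGroup S] [Module ℂ S] (a : Fin n → S) (i : Fin n) :
    ∑ j, twistCoeff f i j • a j = a i + ∑ j, (Complex.I * (f i j : ℂ)) • a j := by
  simp only [twistCoeff, add_smul, Finset.sum_add_distrib, ite_smul, one_smul, zero_smul,
    Finset.sum_ite_eq, Finset.mem_univ, if_true]

theorem Model.twistedContract_eq (i : Fin n) : Model.twistedContract 𝔤 ξ f i =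
    ∑ j, twistCoeff f i j • Model.oddOp 𝔤 (Forms.contract (ξ j)) :=
  (sum_twistCoeff_smul f (fun j => Model.oddOp 𝔤 (Forms.contract (ξ j))) i).symm

theorem Model.twistedLie_eq (i : Fin n) : Model.twistedLie 𝔤 ξ f i =
    ∑ j, twistCoeff f i j • Model.evenOp 𝔤 (Forms.lieDerivative (ξ j)) :=
  (sum_twistCoeff_smul f (fun j => Model.evenOp 𝔤 (Forms.lieDerivative (ξ j))) i).symm

theorem Model.leftMul_add (w w' : Weil 𝔤) :
    (Model.leftMul (w + w') : Module.End ℂ (Model 𝔤 R)) = Model.leftMul w + Model.leftMul w' := by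
  rw [Model.leftMul_eq, Model.leftMul_eq, Model.leftMul_eq, ← Model.tensorOp_add_left]
  congr 1
  exact LinearMap.ext fun x => add_mul w w' x

theorem Model.leftMul_smul (r : ℝ) (w : Weil 𝔤) :
    (Model.leftMul (r • w) : Module.End ℂ (Model 𝔤 R)) = (r : ℂ) • Model.leftMul w := by
  rw [Model.leftMul_eq, Model.leftMul_eq]
  refine Model.end_ext fun w' ζ => ?_
  rw [LinearMap.smul_apply, Model.tensorOp_mk, Model.tensorOp_mk, ← Model.ofReal_smul_eq,
    LinearMap.mulLeft_apply, LinearMap.mulLeft_apply, smul_mul_assoc, map_smul,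
    LinearMap.smul_apply]

theorem Model.leftMul_sum {ι : Type*} (s : Finset ι) (w : ι → Weil 𝔤) :
    (Model.leftMul (∑ i ∈ s, w i) : Module.End ℂ (Model 𝔤 R)) = ∑ i ∈ s, Model.leftMul (w i) :=
  map_sum (AddMonoidHom.mk' (fun w : Weil 𝔤 => (Model.leftMul w : Module.End ℂ (Model 𝔤 R)))
    Model.leftMul_add) w s

theorem Model.leftMul_d_θ [Bracket 𝔤 𝔤] (i : Fin n) :
    (Model.leftMul (Weil.d e (Weil.θ e i)) : Module.End ℂ (Model 𝔤 R)) =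
      (-(2⁻¹ : ℂ)) • (∑ j, ∑ k, (structureConstant e i j k : ℂ) •
        Model.leftMul (Weil.θ e j * Weil.θ e k)) + Model.leftMul (Weil.φ e i) := by
  rw [Weil.d_θ, Model.leftMul_add, Model.leftMul_smul]
  simp only [Model.leftMul_sum, Model.leftMul_smul]
  push_cast
  rfl

/-- With Θ_i = d_W θ^i, the φ-terms and the structure-constant terms of δ combine into -∑ Θ_i A_i.
-/
theorem sum_sub_sum_mul_eq {S : Type*} [Ring S] [Algebra ℂ S] {T A Θ Φ : Fin n → S}
    {t : Fin n → Fin n → S} {c : Fin n → Fin n → Fin n → ℂ}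
    (hΘ : ∀ i, Θ i = (-(2⁻¹ : ℂ)) • (∑ j, ∑ k, c i j k • t j k) + Φ i) :
    ∑ i, T i - ∑ i, Φ i * A i + (2⁻¹ : ℂ) • ∑ i, ∑ j, ∑ k, c i j k • (t j k * A i) =
      ∑ i, (T i - Θ i * A i) := by
  simp only [hΘ, add_mul, neg_smul, neg_mul, smul_mul_assoc, Finset.sum_mul, Finset.sum_sub_distrib,
    Finset.sum_add_distrib, Finset.sum_neg_distrib, Finset.smul_sum]
  abel

theorem Model.brst_eq [Bracket 𝔤 𝔤] : Model.brst e ξ f = Model.D R e +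
    ∑ i, (Model.leftMul (Weil.θ e i) * Model.twistedLie 𝔤 ξ f i -
      Model.leftMul (Weil.d e (Weil.θ e i)) * Model.twistedContract 𝔤 ξ f i) -
    ∑ j, ∑ k ∈ Finset.Ioi j, Model.leftMul (Weil.θ e j) * Model.leftMul (Weil.θ e k) *
      (Model.twistedLie 𝔤 ξ f j * Model.twistedContract 𝔤 ξ f k -
        Model.twistedContract 𝔤 ξ f k * Model.twistedLie 𝔤 ξ f j) := by
  rw [← sum_sub_sum_mul_eq (T := fun i => Model.leftMul (Weil.θ e i) * Model.twistedLie 𝔤 ξ f i)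
    (A := Model.twistedContract 𝔤 ξ f) (fun i => Model.leftMul_d_θ e i)]
  simp only [← Model.leftMul_mul]
  rw [Model.brst, Model.D]
  abel

theorem Model.twistedContract_mul_leftMul_θ (i j : Fin n) :
    Model.twistedContract 𝔤 ξ f i * Model.leftMul (Weil.θ e j) =
      -(Model.leftMul (Weil.θ e j) * Model.twistedContract 𝔤 ξ f i) := by
  rw [Model.twistedContract_eq]
  exact sum_smul_anticomm _ fun l => Model.oddOp_mul_leftMul_odd _ _

theorem Model.twistedContract_anticomm (i j : Fin n) :
    Model.twistedContract 𝔤 ξ f i * Model.twistedContract 𝔤 ξ f j =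
      -(Model.twistedContract 𝔤 ξ f j * Model.twistedContract 𝔤 ξ f i) := by
  simp only [Model.twistedContract_eq]
  exact sum_smul_sum_smul_anticomm _ (fun _ _ => Model.oddOp_contract_anticomm _ _) i j

theorem Model.psiTerm_commute (i j : Fin n) :
    Commute (Model.psiTerm e ξ f i) (Model.psiTerm e ξ f j) :=
  commute_mul_of_anticomm (fun _ _ => Model.leftMul_odd_anticomm _ _)
    (Model.twistedContract_anticomm ξ f) (Model.twistedContract_mul_leftMul_θ e ξ f) i j

theorem Model.psiTerm_mul_self (i : Fin n) :
    Model.psiTerm e ξ f i * Model.psiTerm e ξ f i = 0 :=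
  mul_mul_self_eq_zero (t := fun i => Model.leftMul (Weil.θ e i))
    (fun _ => Model.leftMul_odd_mul_self _) (Model.twistedContract_mul_leftMul_θ e ξ f) i

theorem Model.isNilpotent_sum_psiTerm : IsNilpotent (∑ i, Model.psiTerm e ξ f i) :=
  Commute.isNilpotent_sum (fun i _ => ⟨2, by rw [pow_two, Model.psiTerm_mul_self]⟩)
    fun i j _ _ => Model.psiTerm_commute e ξ f i j

/-- The rational structure used by the exponential is left as an argument, so the identity holds for
whichever one occurs. -/
theorem Model.psi_eq_exp [Module ℚ (Module.End ℂ (Model 𝔤 R))] :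
    Model.psi e ξ f = IsNilpotent.exp (-∑ i, Model.psiTerm e ξ f i) :=
  prod_ofFn_one_sub_eq_exp (Model.psiTerm_mul_self e ξ f) (Model.psiTerm_commute e ξ f)

theorem Model.psi_mul_brst [Bracket 𝔤 𝔤] :
    Model.psi e ξ f * Model.brst e ξ f = Model.D R e * Model.psi e ξ f := by
  -- Rational scalars act through ℂ.
  let _ : Module ℚ (Module.End ℂ (Model 𝔤 R)) := Module.compHom _ (algebraMap ℚ ℂ)
  rw [Model.brst_eq, Model.psi_eq_exp]
  refine exp_neg_mul_eq_mul_exp_neg (Θ := fun i => Model.leftMul (Weil.d e (Weil.θ e i)))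
    (fun _ _ => Model.leftMul_odd_anticomm _ _)
    (fun _ => Model.leftMul_odd_mul_self _) (Model.twistedContract_anticomm ξ f)
    (Model.twistedContract_mul_leftMul_θ e ξ f) ?_ (Model.D_mul_leftMul_θ e) ?_
    (fun _ _ => Model.leftMul_d_θ_mul_leftMul e _ _) ?_ ?_ ?_
  · intro i j
    rw [Model.twistedLie_eq]
    exact sum_smul_comm _ fun l => Model.evenOp_mul_leftMul _ _
  · intro i
    rw [Model.twistedLie_eq, Model.twistedContract_eq]
    exact mul_sum_smul_add _ fun l => Model.D_mul_oddOp_contract e _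
  · intro i j
    rw [Model.twistedContract_eq]
    exact (sum_smul_comm _ fun l => (Model.leftMul_d_θ_mul_oddOp e i _).symm).symm
  · intro j k
    simp only [Model.twistedLie_eq, Model.twistedContract_eq]
    refine sum_smul_mul_sub_skew _ (fun l m => ?_) j k
    rw [Model.evenOp_lieDerivative_comm, Model.evenOp_lieDerivative_comm,
      Model.oddOp_contract_lie_skew]
  · intro j k i
    simp only [Model.twistedLie_eq, Model.twistedContract_eq]
    refine sum_smul_mul_sub_anticomm _ (fun l m p => ?_) j k i
    rw [Model.evenOp_lieDerivative_comm, Model.oddOp_contract_anticomm]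

/-- The product `∏ (1 + T i)`, inverse to `Model.psi`. -/
noncomputable def Model.psiInv : Module.End ℂ (Model 𝔤 R) :=
  (List.ofFn fun i => 1 - -Model.psiTerm e ξ f i).prod

theorem Model.psi_mul_psiInv : Model.psi e ξ f * Model.psiInv e ξ f = 1 ∧
    Model.psiInv e ξ f * Model.psi e ξ f = 1 := by
  let _ : Module ℚ (Module.End ℂ (Model 𝔤 R)) := Module.compHom _ (algebraMap ℚ ℂ)
  have h : Model.psiInv e ξ f = IsNilpotent.exp (∑ i, Model.psiTerm e ξ f i) := by
    rw [Model.psiInv, prod_ofFn_one_sub_eq_exp (T := fun i => -Model.psiTerm e ξ f i)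
      (fun i => (neg_mul_neg _ _).trans (Model.psiTerm_mul_self e ξ f i))
      (fun i j => ((Model.psiTerm_commute e ξ f i j).neg_left).neg_right),
      Finset.sum_neg_distrib, neg_neg]
  have hK := Model.isNilpotent_sum_psiTerm e ξ f
  rw [Model.psi_eq_exp, h]
  exact ⟨IsNilpotent.exp_neg_mul_exp_self hK, IsNilpotent.exp_mul_exp_neg_self hK⟩

theorem Model.prod_one_sub_mem {m : ℕ} (T : Fin n → Module.End ℂ (Model 𝔤 R))
    (hT : ∀ i, ∀ x ∈ Model.degree 𝔤 R m, T i x ∈ Model.degree 𝔤 R m) {x : Model 𝔤 R}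
    (hx : x ∈ Model.degree 𝔤 R m) :
    (List.ofFn fun i => 1 - T i).prod x ∈ Model.degree 𝔤 R m := by
  induction n with
  | zero => simpa using hx
  | succ n ih =>
    rw [List.ofFn_succ, List.prod_cons, Module.End.mul_apply, LinearMap.sub_apply]
    have h := ih (fun i => T i.succ) fun i => hT _
    exact sub_mem h (hT 0 _ h)

end TwistedModel

/-! ### Multiplicativity of ∏ (1 - T_i) and transport of structure. -/

section Automorphism

variable {A : Type*} [Ring A] [Algebra ℂ A]

/-- (1 - T)a · (1 - T)b differs from (1 - T)(ab) only by T(a) T(b), which is zero; products of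
multiplicative maps are multiplicative. -/
theorem prod_one_sub_apply_mul {n : ℕ} (T : Fin n → Module.End ℂ A)
    (hT : ∀ i a b, T i (a * b) = T i a * b + a * T i b) (hTT : ∀ i a b, T i a * T i b = 0) (a b : A) :
    (List.ofFn fun i => 1 - T i).prod (a * b) =
      (List.ofFn fun i => 1 - T i).prod a * (List.ofFn fun i => 1 - T i).prod b := by
  induction n with
  | zero => simp
  | succ n ih =>
    simp only [List.ofFn_succ, List.prod_cons, Module.End.mul_apply]
    rw [ih (fun i => T i.succ) (fun i => hT _) fun i => hTT _]
    simp only [LinearMap.sub_apply, Module.End.one_apply, hT, sub_mul, mul_sub, hTT]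
    abel

/-- A differential graded algebra structure transported along a degree-preserving automorphism. -/
theorem IsDifferentialGradedAlgebra.of_algEquiv {𝒢 : ℕ → Submodule ℂ A} {d δ : Module.End ℂ A}
    (hd : IsDifferentialGradedAlgebra 𝒢 d) (Ψ : A ≃ₐ[ℂ] A) (hΨ : ∀ m x, x ∈ 𝒢 m ↔ Ψ x ∈ 𝒢 m)
    (h : ∀ x, Ψ (δ x) = d (Ψ x)) : IsDifferentialGradedAlgebra 𝒢 δ where
  map_degree m a ha := by
    rw [hΨ, h]
    exact hd.map_degree m _ ((hΨ m a).1 ha)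
  leibniz m a ha b := by
    apply Ψ.injective
    rw [h, map_mul, hd.leibniz m _ ((hΨ m a).1 ha), map_add, map_mul, map_smul, map_mul, h, h]
  sq_eq_zero a := by
    apply Ψ.injective
    rw [h, h, hd.sq_eq_zero, map_zero]

end Automorphism

/-! ### The automorphism ψ of the graded algebra. -/

section TwistedModel

variable {𝔤 : Type*} [AddCommGroup 𝔤] [Module ℝ 𝔤] {R : Type*} [CommRing R] [Algebra ℝ R]
  {n : ℕ} (e : Module.Basis (Fin n) ℝ 𝔤) (ξ : Fin n → Derivation ℝ R R) (f : Fin n → Fin n → ℝ)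

/-- `Model.psi` as an algebra automorphism. -/
noncomputable def Model.psiEquiv : Model 𝔤 R ≃ₐ[ℂ] Model 𝔤 R :=
  AlgEquiv.ofLinearEquiv
    (LinearEquiv.ofLinearMap (Model.psi e ξ f) (Model.psiInv e ξ f) (Model.psi_mul_psiInv e ξ f).1
      (Model.psi_mul_psiInv e ξ f).2)
    (by
      have hmul := prod_one_sub_apply_mul (Model.psiTerm e ξ f) (Model.psiTerm_mul e ξ f)
        (Model.psiTerm_mul_psiTerm e ξ f)
      have hinv : ∀ x, Model.psi e ξ f (Model.psiInv e ξ f x) = x :=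
        LinearMap.congr_fun (Model.psi_mul_psiInv e ξ f).1
      change Model.psi e ξ f 1 = 1
      -- ψ(1) = 1 follows from multiplicativity and surjectivity: ψ(1) is a left unit for the
      -- element 1 = ψ(ψ⁻¹(1)).
      have h := hmul 1 (Model.psiInv e ξ f 1)
      rw [one_mul] at h
      change Model.psi e ξ f _ = Model.psi e ξ f 1 * Model.psi e ξ f _ at h
      rw [hinv, mul_one] at h
      exact h.symm)
    (prod_one_sub_apply_mul (Model.psiTerm e ξ f) (Model.psiTerm_mul e ξ f)
        (Model.psiTerm_mul_psiTerm e ξ f))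

theorem Model.psi_mem_iff (m : ℕ) (x : Model 𝔤 R) :
    x ∈ Model.degree 𝔤 R m ↔ Model.psi e ξ f x ∈ Model.degree 𝔤 R m := by
  refine ⟨Model.prod_one_sub_mem _ fun i x => Model.psiTerm_mem e ξ f i, fun h => ?_⟩
  -- The inverse ∏ (1 + T_i) is a product of the same shape with -T_i, so it preserves degrees too.
  have h' := Model.prod_one_sub_mem (fun i => -Model.psiTerm e ξ f i)
    (fun i x hx => neg_mem (Model.psiTerm_mem e ξ f i hx)) h
  have hx : Model.psiInv e ξ f (Model.psi e ξ f x) = x :=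
    LinearMap.congr_fun (Model.psi_mul_psiInv e ξ f).2 x
  exact hx ▸ h'

end TwistedModel

/-- ∑_m c^i_{jm} c^m_{kl} is the i-th coordinate of [e_j, [e_k, e_l]], so the identity is the Jacobi
identity in coordinates. -/
theorem isJacobi_structureConstant {𝔤 : Type*} [LieRing 𝔤] [LieAlgebra ℝ 𝔤] {n : ℕ}
    (e : Module.Basis (Fin n) ℝ 𝔤) : IsJacobi (structureConstant e) := by
  have h : ∀ i k l j, ∑ m, structureConstant e i j m * structureConstant e m k l =
      e.coord i ⁅e j, ⁅e k, e l⁆⁆ := by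
    intro i k l j
    conv_rhs => rw [← e.sum_repr ⁅e k, e l⁆, lie_sum, map_sum]
    refine Finset.sum_congr rfl fun m _ => ?_
    rw [lie_smul, map_smul, smul_eq_mul, mul_comm]
    rfl
  constructor
  · intro i j k
    rw [structureConstant, ← lie_skew, map_neg]
    rfl
  · intro i j k l
    rw [h, h, h, ← map_add, ← map_add]
    have := lie_jacobi (e j) (e k) (e l)
    rw [this, map_zero]

end BRST

/-! ### The theorem for the action of a Lie group on a manifold. -/

theorem theorem1
    {E F G M : Type*}
    [NormedAddCommGroup E] [NormedSpace ℝ E] [FiniteDimensional ℝ E]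
    [NormedAddCommGroup F] [NormedSpace ℝ F] [FiniteDimensional ℝ F]
    [TopologicalSpace G] [ChartedSpace E G] [Group G] [LieGroup 𝓘(ℝ, E) ∞ G]
    [CompactSpace G] [T2Space G]
    [TopologicalSpace M] [ChartedSpace F M] [IsManifold 𝓘(ℝ, F) ∞ M]
    [CompactSpace M] [T2Space M]
    [MulAction G M] [ContMDiffSMul 𝓘(ℝ, E) 𝓘(ℝ, F) ∞ G M]
    {n : ℕ} (e : Module.Basis (Fin n) ℝ (GroupLieAlgebra 𝓘(ℝ, E) G))
    (f : Fin n → Fin n → ℝ) :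
    let R := C^∞⟮𝓘(ℝ, F), M; ℝ⟯
    let ξ : Fin n → Derivation ℝ R R := fun i => fundamentalField (e i)
    let ψ := Model.psi e ξ f
    let δ := Model.brst e ξ f
    let D := Model.D R e
    let deg := Model.degree (GroupLieAlgebra 𝓘(ℝ, E) G) R
    let K := ∑ i, Model.psiTerm e ξ f i
    IsDifferentialGradedAlgebra deg δ ∧ IsDifferentialGradedAlgebra deg D ∧
    IsNilpotent K ∧ ψ = IsNilpotent.exp (-K) ∧
    ∃ Ψ : Model (GroupLieAlgebra 𝓘(ℝ, E) G) R ≃ₐ[ℂ] Model (GroupLieAlgebra 𝓘(ℝ, E) G) R,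
      (∀ x, Ψ x = ψ x) ∧
      (∀ m x, x ∈ deg m ↔ Ψ x ∈ deg m) ∧
      (∀ x, Ψ (δ x) = D (Ψ x)) ∧ (∀ x, δ x = Ψ.symm (D (Ψ x))) := by
  intro R ξ ψ δ D deg K
  have : CompleteSpace E := FiniteDimensional.complete ℝ E
  -- The Jacobi identity for left-invariant vector fields asks for smoothness `minSmoothness ℝ 3`,
  -- which is 3 over ℝ, and for a complete model space.
  have : LieGroup 𝓘(ℝ, E) (minSmoothness ℝ 3) G := .of_le (n := ∞) (by
    rw [minSmoothness_of_isRCLikeNormedField]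
    exact WithTop.coe_le_coe.2 (le_top (a := (3 : ℕ∞))))
  have hc : IsJacobi (structureConstant e) := isJacobi_structureConstant e
  have hD : IsDifferentialGradedAlgebra deg D := Model.isDifferentialGradedAlgebra_D e hc
  have hdeg : ∀ m x, x ∈ deg m ↔ Model.psiEquiv e ξ f x ∈ deg m := Model.psi_mem_iff e ξ f
  have hΨ : ∀ x, Model.psiEquiv e ξ f (δ x) = D (Model.psiEquiv e ξ f x) :=
    LinearMap.congr_fun (Model.psi_mul_brst e ξ f)
  exact ⟨hD.of_algEquiv _ hdeg hΨ, hD, Model.isNilpotent_sum_psiTerm e ξ f,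
    Model.psi_eq_exp e ξ f, Model.psiEquiv e ξ f, fun _ => rfl, hdeg, hΨ,
    fun x => (AlgEquiv.eq_symm_apply _).2 (hΨ x)⟩
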